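/- **Theorem 4.1.** Let $K$ be a field, $V$ a $K$-vector space with basis $e_1,\dots,e_n$, $W=V^*$ with dual basis $x_1,\dots,x_n$, $E=\bigwedge V$ (with $V$ in degree $1$), $S=\mathrm{Sym}(W)=K[x_1,\dots,x_n]$, and let $\mathbb P=\mathrm{Proj}\,S$ be the projective space of one-dimensional subspaces of $V$. Let $N=\bigoplus_{i\in\mathbb Z}N_i$ be a finitely generated graded $E$-module whose socle $\{m: Vm=0\}$ is contained in $N_0$. Let $F=\bigoplus_{i\in\mathbb Z} F_i$ be a graded $S$-module such that $\mathbf R(F)$ is a (graded, linear) injective resolution of $N$; that is, $F_i=0$ for $i<0$ and there is an exact sequence $0\to N\to \mathrm{Hom}_K(E,F_0)\to\mathrm{Hom}_K(E,F_1)\to\cdots$ of graded $E$-modules with differential $\varphi\mapsto\big(b\mapsto\sum_j x_j\varphi(e_j b)\big)$, where $\mathrm{Hom}_K(E,F_i)$ has $E$-action $(a\varphi)(b)=\varphi(ba)$ and $\mathrm{Hom}_K(E_d,F_i)$ is placed in degree $-d-i$. Let $\mathcal F$ be the sheaf on $\mathbb P$ associated with $F$. For $e\in V$ let $H(e,N)=\mathrm{Ann}_N(e)/eN$.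 Since $N$ lives in degrees $\le 0$, write $H(e,N)_{i}$ for the component of $H(e,N)$ in degree $-i$. a) For every $0\ne e\in V$ and every $i\ge 0$ there is an isomorphism of $K$-vector spaces $H(e,N)_i\cong \mathrm{Tor}_i^{\mathcal O_{\mathbb P,e}}(\kappa(e),\mathcal F_e)$, where $\kappa(e)$ is the residue field of $\mathcal O_{\mathbb P,e}$. b) For every $0\neq e\in V$ and $i\in\mathbb Z$: $H(e,N)_i\ne 0$ if and only if $0\le i\le \mathrm{pd}_{\mathcal O_{\mathbb P,e}}\mathcal F_e$ (with $\mathrm{pd}\,0=-\infty$). In particular, for every $e\in V$, $H(e,N)\ne0$ if and only if $H(e,N)_0\neq0$. c) For a point $p\in\mathbb P$ let $\kappa(p)$ be the fraction field of $S/p$, let $H(p,N)$ be the homology of multiplication by the tautological vector $\sum_j \bar x_j\otimes e_j$ on $\kappa(p)\otimes_K N$, graded in the same way, and let $\mathrm{sing}(N)=\{p\in\mathbb P: H(p,N)\ne0\}$ (a point given by $0\ne e\in V$ lies in $\mathrm{sing}(N)$ if and only if $H(e,N)\neq 0$). Let $Z$ be an irreducible component of $\mathrm{sing}(N)$, that is,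 a maximal irreducible closed subset of $\mathbb P$ contained in $\mathrm{sing}(N)$, and let $c$ be its codimension in $\mathbb P$. Then for $e$ generic on $Z$ one has $H(e,N)_i\neq0$ exactly for $0\le i\le c$. Precisely: there is an open $U\subset\mathbb P$ with $Z\cap U\ne\emptyset$ such that for every $0\ne e\in V$ whose point lies in $Z\cap U$, and likewise for every point $p\in Z\cap U$ (with $H(p,N)$ in place of $H(e,N)$; this includes the generic point of $Z$), the component with index $i\in\mathbb Z$ is nonzero if and only if $0\le i\le c$. -/

import Mathlib

open CategoryTheory TensorProduct

universe u v

namespace BGG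

noncomputable section

/-! ### The exterior algebra, the symmetric algebra and projective space -/

/-- The vector space `V = E_1` with its basis `e_1, …, e_n` (the standard basis of `K ^ n`). -/
abbrev V (K : Type u) [Field K] (n : ℕ) : Type u := Fin n → K

/-- The exterior algebra `E` of `V`. -/
abbrev E (K : Type u) [Field K] (n : ℕ) : Type u := ExteriorAlgebra K (V K n)

/-- The grading of `E` for which the elements of `V` have degree `1`. -/
abbrev gradE (K : Type u) [Field K] (n : ℕ) (d : ℕ) : Submodule K (E K n) :=
  ⋀[K]^d (V K n)

/-- The symmetric algebra `S = Sym W` of the dual space `W` of `V`: the polynomial ring on the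
basis `x_1, …, x_n` of `W` dual to `e_1, …, e_n`. -/
abbrev S (K : Type u) [Field K] (n : ℕ) : Type u := MvPolynomial (Fin n) K

/-- The grading of `S` by degree. -/
abbrev gradS (K : Type u) [Field K] (n : ℕ) (d : ℕ) : Submodule K (S K n) :=
  MvPolynomial.homogeneousSubmodule (Fin n) K d

instance instGradedAlgebraS (K : Type u) [Field K] (n : ℕ) : GradedAlgebra (gradS K n) :=
  MvPolynomial.gradedAlgebra

/-- The projective space of one-dimensional subspaces of `V`, that is `Proj S`, with its Zariski
topology; its points are the relevant homogeneous primes of `S`. -/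
abbrev P (K : Type u) [Field K] (n : ℕ) : Type u := ProjectiveSpectrum (gradS K n)

/-- `e_j`, as an element of `V`. -/
abbrev stdVec (K : Type u) [Field K] {n : ℕ} (j : Fin n) : V K n := Pi.single j 1

/-- A `ℤ`-grading `ℳ` of a module `M` over a `K`-algebra `A` graded by `𝒜` in non-negative
degrees: `M` is the direct sum of the `ℳ i`, and `𝒜 d • ℳ i ⊆ ℳ (i + d)`. -/
structure IsGradedModule {K : Type*} [Field K] {A : Type*} [Ring A] [Algebra K A]
    {M : Type*} [AddCommGroup M] [Module K M] [Module A M]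
    (𝒜 : ℕ → Submodule K A) (ℳ : ℤ → Submodule K M) : Prop where
  isInternal : DirectSum.IsInternal ℳ
  smul_mem : ∀ {d : ℕ} {i : ℤ} {a : A} {m : M}, a ∈ 𝒜 d → m ∈ ℳ i → a • m ∈ ℳ (i + d)

/-! ### The homology `H(e, N)` -/

section Homology

variable {L : Type*} [Field L] {M : Type*} [AddCommGroup M] [Module L M]

/-- The homology `ker f / im f` of `M --f--> M --f--> M`. -/
abbrev Homology (f : M →ₗ[L] M) : Type _ :=
  LinearMap.ker f ⧸ (LinearMap.range f).submoduleOf (LinearMap.ker f)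

/-- The classes in `ker f / im f` of the elements of `ker f` that lie in a given subspace `A`. -/
def homologyPart (f : M →ₗ[L] M) (A : Submodule L M) : Submodule L (Homology f) :=
  (A.submoduleOf (LinearMap.ker f)).map
    ((LinearMap.range f).submoduleOf (LinearMap.ker f)).mkQ

end Homology

section Action

variable {K : Type u} [Field K] {n : ℕ} {N : Type v} [AddCommGroup N] [Module K N]
  [Module (E K n) N] [IsScalarTower K (E K n) N]

variable (N) in
/-- Multiplication by `e ∈ V` on the `E`-module `N`. -/
def mulBy (e : V K n) : N →ₗ[K] N := Algebra.lsmul K K N (ExteriorAlgebra.ι K e)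

variable (N) in
/-- `H(e, N) = (Ann_N e) / e N`. -/
abbrev H (e : V K n) : Type v := Homology (mulBy N e)

/-- The component of degree `i` of `H(e, N)`, for `N` graded by `𝒩`. -/
abbrev Hdeg (𝒩 : ℤ → Submodule K N) (e : V K n) (i : ℤ) : Submodule K (H N e) :=
  homologyPart (mulBy N e) (𝒩 i)

variable (K n N) in
/-- The socle of `N`: the elements annihilated by the ideal of `E` generated by `V`. -/
def socle : Submodule K N := ⨅ e : V K n, LinearMap.ker (mulBy N e)

/-! ### Homology at an arbitrary point of projective space, and the singular variety

A point `p` of `Proj S` with residue field `κ(p)` (here the fraction field of `S / p`) carries the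
tautological vector `∑ x̄_j e_j` of `κ(p) ⊗ V`, which spans the corresponding line. -/

/-- The field of fractions `κ(p)` of `S / p`. -/
abbrev kappa (p : P K n) : Type u := p.asHomogeneousIdeal.toIdeal.ResidueField

variable (N) in
/-- Multiplication by the tautological vector `∑ x̄_j ⊗ e_j` on `κ(p) ⊗ N`. -/
def mulByPoint (p : P K n) : (kappa p ⊗[K] N) →ₗ[kappa p] (kappa p ⊗[K] N) :=
  ∑ j : Fin n, algebraMap (S K n) (kappa p) (MvPolynomial.X j) •
    (mulBy N (stdVec K j)).baseChange (kappa p)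

variable (N) in
/-- The homology of multiplication by the tautological vector of `p` on `κ(p) ⊗ N`. -/
abbrev HPoint (p : P K n) : Type _ := Homology (mulByPoint N p)

/-- The component of degree `i` of `HPoint N p`. -/
abbrev HPointDeg (𝒩 : ℤ → Submodule K N) (p : P K n) (i : ℤ) :
    Submodule (kappa p) (HPoint N p) :=
  homologyPart (mulByPoint N p) ((𝒩 i).baseChange (kappa p))

variable (K n N) in
/-- The singular variety `sing(N)`, as a subset of `Proj S`: the points at which the kernel of
multiplication by the tautological vector differs from its image. -/
def sing : Set (P K n) :=
  {p | LinearMap.ker (mulByPoint N p) ≠ LinearMap.range (mulByPoint N p)}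

end Action

/-! ### The point of `Proj S` given by a nonzero vector -/

/-- The point of `Proj S` given by `e ≠ 0` in `V`: the ideal generated by the homogeneous
polynomials that vanish at `e`. -/
def point {K : Type u} [Field K] {n : ℕ} (e : V K n) (he : e ≠ 0) : P K n where
  asHomogeneousIdeal := (RingHom.ker (MvPolynomial.eval e)).homogeneousCore (gradS K n)
  isPrime := (RingHom.ker_isPrime (MvPolynomial.eval e)).homogeneousCore
  not_irrelevant_le := by
    intro h
    apply he
    funext j
    have hX : (MvPolynomial.X j : S K n) ∈ HomogeneousIdeal.irrelevant (gradS K n) := by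
      rw [HomogeneousIdeal.mem_irrelevant_iff, GradedRing.proj_apply]
      exact DirectSum.decompose_of_mem_ne (gradS K n) (MvPolynomial.isHomogeneous_X K j)
        one_ne_zero
    have := Ideal.toIdeal_homogeneousCore_le (gradS K n) _ (h hX)
    simpa using this

/-! ### The complex `R(F)` and injective resolutions -/

section Resolution

variable {K : Type u} [Field K] {n : ℕ}
  {N : Type v} [AddCommGroup N] [Module K N] [Module (E K n) N]
  {F : Type u} [AddCommGroup F] [Module K F] [Module (S K n) F] [IsScalarTower K (S K n) F]

/-- The differential `Hom_K(E, F_i) → Hom_K(E, F_{i+1})` of `R(F)`, which takes `φ` to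
`b ↦ ∑ x_j φ(e_j b)`. -/
def dR {ℱ : ℤ → Submodule K F} (hF : IsGradedModule (gradS K n) ℱ) (i : ℤ) :
    (E K n →ₗ[K] ℱ i) →ₗ[K] (E K n →ₗ[K] ℱ (i + 1)) where
  toFun φ :=
    { toFun := fun b => ∑ j : Fin n,
        ⟨(MvPolynomial.X j : S K n) • (φ (ExteriorAlgebra.ι K (stdVec K j) * b) : F), by
          simpa using hF.smul_mem (d := 1) (MvPolynomial.isHomogeneous_X K j)
            (φ (ExteriorAlgebra.ι K (stdVec K j) * b)).2⟩
      map_add' := fun a b => by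
        ext; simp [mul_add, Finset.sum_add_distrib]
      map_smul' := fun c b => by
        ext; simp [Finset.smul_sum, smul_comm c] }
  map_add' φ ψ := by ext; simp [Finset.sum_add_distrib]
  map_smul' c φ := by ext; simp [Finset.smul_sum, smul_comm c]

/-- The complex `R(F)` is a (graded) injective resolution of `N`: it vanishes in negative
cohomological degrees, and for some augmentation `η` of graded `E`-modules the sequence
`0 → N --η--> Hom_K(E, F_0) → Hom_K(E, F_1) → ⋯` is exact. Here `Hom_K(E, F_i)` is the left
`E`-module with `(a φ)(b) = φ(b a)`; it is injective, being coinduced from `K`. The functionals on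
the degree `d` part of `E` with values in `F_i` have degree `-d-i`. -/
def IsInjectiveResolution {ℱ : ℤ → Submodule K F} (hF : IsGradedModule (gradS K n) ℱ)
    (𝒩 : ℤ → Submodule K N) : Prop :=
  (∀ i : ℤ, i < 0 → ℱ i = ⊥) ∧
  (∃ η : N →ₗ[K] (E K n →ₗ[K] ℱ 0),
    (∀ (a : E K n) (m : N) (b : E K n), η (a • m) b = η m (b * a)) ∧
    (∀ (i : ℤ), ∀ m ∈ 𝒩 i, ∀ (d : ℕ), -(d : ℤ) ≠ i → ∀ b ∈ gradE K n d, η m b = 0) ∧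
    Function.Injective η ∧
    LinearMap.range η = LinearMap.ker (dR hF 0)) ∧
  (∀ i : ℤ, 0 ≤ i → LinearMap.range (dR hF i) = LinearMap.ker (dR hF (i + 1)))

end Resolution

/-! ### The local ring of projective space and the stalk of the sheaf of a graded module -/

section Stalk

variable {K : Type u} [Field K] {n : ℕ}

/-- The local ring `𝒪_{P,p}` of projective space at `p`: the ring of fractions of degree `0` in
the localization of `S` at `p`. -/
abbrev localRing (p : P K n) : Type u :=
  HomogeneousLocalization.AtPrime (gradS K n) p.asHomogeneousIdeal.toIdeal

/-- The structure map `K → 𝒪_{P,p}`. -/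
def toLocalRing (p : P K n) : K →+* localRing p :=
  (algebraMap (gradS K n 0) (localRing p)).comp (algebraMap K (gradS K n 0))

variable (F : Type u) [AddCommGroup F] [Module (S K n) F]

/-- The localization of the `S`-module `F` at the prime `p`. -/
abbrev locModule (p : P K n) : Type u :=
  LocalizedModule p.asHomogeneousIdeal.toIdeal.primeCompl F

instance instModuleLocModule (p : P K n) : Module (localRing p) (locModule F p) :=
  Module.compHom _ (algebraMap (localRing p)
    (Localization p.asHomogeneousIdeal.toIdeal.primeCompl))

variable {F}

theorem val_smul_mk (p : P K n)
    (c : HomogeneousLocalization.NumDenSameDeg (gradS K n)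
      p.asHomogeneousIdeal.toIdeal.primeCompl)
    (f : F) (s : p.asHomogeneousIdeal.toIdeal.primeCompl) :
    (HomogeneousLocalization.mk c : localRing p) • (LocalizedModule.mk f s : locModule F p) =
      LocalizedModule.mk ((c.num : S K n) • f) (⟨c.den, c.den_mem⟩ * s) := by
  change (HomogeneousLocalization.mk c).val • LocalizedModule.mk f s = _
  rw [HomogeneousLocalization.val_mk, LocalizedModule.mk_smul_mk]

variable [Module K F]

/-- The stalk at `p` of the sheaf on `Proj S` associated with the graded `S`-module `F`: the
fractions `f / s` of degree `0` in the localization of `F` at `p`, as an `𝒪_{P,p}`-module. -/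
def stalk {ℱ : ℤ → Submodule K F} (hF : IsGradedModule (gradS K n) ℱ) (p : P K n) :
    Submodule (localRing p) (locModule F p) where
  carrier := {z | ∃ (d : ℕ) (f : F) (s : p.asHomogeneousIdeal.toIdeal.primeCompl),
    f ∈ ℱ d ∧ (s : S K n) ∈ gradS K n d ∧ z = LocalizedModule.mk f s}
  zero_mem' := ⟨0, 0, 1, zero_mem _, MvPolynomial.isHomogeneous_one _ _,
    (LocalizedModule.zero_mk 1).symm⟩
  add_mem' := by
    rintro _ _ ⟨d, f, s, hf, hs, rfl⟩ ⟨d', f', s', hf', hs', rfl⟩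
    refine ⟨d + d', s' • f + s • f', s * s', add_mem ?_ ?_, ?_, LocalizedModule.mk_add_mk⟩
    · have := hF.smul_mem hs' hf
      rw [Nat.cast_add]
      exact this
    · have := hF.smul_mem hs hf'
      rw [Nat.cast_add, add_comm]
      exact this
    · exact SetLike.mul_mem_graded hs hs'
  smul_mem' := by
    intro c z hz
    obtain ⟨d, f, s, hf, hs, hz⟩ := hz
    obtain ⟨c, hc⟩ := HomogeneousLocalization.mk_surjective c
    refine ⟨c.deg + d, (c.num : S K n) • f, ⟨c.den, c.den_mem⟩ * s, ?_, ?_, ?_⟩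
    · have h := hF.smul_mem c.num.2 hf
      have hd : ((c.deg + d : ℕ) : ℤ) = (d : ℤ) + (c.deg : ℤ) := by push_cast; ring
      rw [hd]
      exact h
    · exact SetLike.mul_mem_graded c.den.2 hs
    · subst hz hc
      exact val_smul_mk p c f s

/-- `Tor_i^{𝒪_{P,p}}(κ, 𝓕_p)`, where `κ` is the residue field of `𝒪_{P,p}` and `𝓕` the sheaf
associated with `F`, as a vector space over `K`. -/
abbrev torStalk {ℱ : ℤ → Submodule K F} (hF : IsGradedModule (gradS K n) ℱ) (p : P K n) (i : ℕ) :
    ModuleCat.{u} K :=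
  (ModuleCat.restrictScalars (toLocalRing p)).obj
    (((Tor (ModuleCat.{u} (localRing p)) i).obj
      (ModuleCat.of (localRing p) (IsLocalRing.ResidueField (localRing p)))).obj
      (ModuleCat.of (localRing p) (stalk hF p)))

end Stalk

/-! ### The singular variety at the points given by vectors -/

section Points

variable {K : Type u} [Field K] {n : ℕ} {N : Type v} [AddCommGroup N] [Module K N]
  [Module (E K n) N] [IsScalarTower K (E K n) N]

/-- At the point given by `e ≠ 0` the tautological vector is a nonzero multiple of `e`. -/
theorem exists_mulByPoint_point (e : V K n) (he : e ≠ 0) :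
    ∃ t : kappa (point e he), t ≠ 0 ∧
      mulByPoint N (point e he) = t • (mulBy N e).baseChange (kappa (point e he)) := by
  obtain ⟨j, hj⟩ : ∃ j, e j ≠ 0 := by
    by_contra! h
    exact he (funext h)
  set φ := algebraMap (S K n) (kappa (point e he)) with hφ
  have hmem : ∀ f : S K n, φ f = 0 ↔ f ∈ (point e he).asHomogeneousIdeal.toIdeal := fun f =>
    Ideal.algebraMap_residueField_eq_zero
  have hX : φ (MvPolynomial.X j) ≠ 0 := by
    rw [Ne, hmem]
    intro h
    exact hj (by simpa using Ideal.toIdeal_homogeneousCore_le (gradS K n) _ h)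
  have hC : ∀ c : K, φ (MvPolynomial.C c) = algebraMap K (kappa (point e he)) c := fun c =>
    (IsScalarTower.algebraMap_apply K (S K n) (kappa (point e he)) c).symm
  have hej : algebraMap K (kappa (point e he)) (e j) ≠ 0 := by simpa using hj
  have key : ∀ k, φ (MvPolynomial.X k) =
      φ (MvPolynomial.X j) / algebraMap K _ (e j) * algebraMap K _ (e k) := by
    intro k
    have h0 : φ (MvPolynomial.C (e j) * MvPolynomial.X k
        - MvPolynomial.C (e k) * MvPolynomial.X j) = 0 := by
      rw [hmem]
      refine Ideal.mem_homogeneousCore_of_homogeneous_of_mem ⟨1, ?_⟩ ?_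
      · exact ((MvPolynomial.isHomogeneous_C_mul_X _ _).sub
          (MvPolynomial.isHomogeneous_C_mul_X _ _))
      · simp [RingHom.mem_ker, mul_comm]
    rw [map_sub, map_mul, map_mul, hC, hC, sub_eq_zero] at h0
    field_simp
    rw [mul_comm, h0, mul_comm]
  refine ⟨φ (MvPolynomial.X j) / algebraMap K _ (e j), div_ne_zero hX hej, ?_⟩
  have hsum : mulBy N e = ∑ k, e k • mulBy N (stdVec K k) := by
    ext m
    conv_lhs => rw [pi_eq_sum_univ' e]
    simp [mulBy, stdVec]
  rw [mulByPoint, hsum]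
  ext m
  simp only [TensorProduct.AlgebraTensorModule.curry_apply, TensorProduct.curry_apply, LinearMap.coe_restrictScalars, LinearMap.sum_apply,
    LinearMap.smul_apply, LinearMap.baseChange_tmul, TensorProduct.tmul_sum,
    TensorProduct.tmul_smul, Finset.smul_sum]
  refine Finset.sum_congr rfl fun k _ => ?_
  rw [← hφ, key k, mul_smul, algebraMap_smul]

/-- The singular variety contains the point given by `e ≠ 0` exactly when `H(e, N) ≠ 0`. -/
theorem point_mem_sing_iff (e : V K n) (he : e ≠ 0) :
    point e he ∈ sing K n N ↔ LinearMap.ker (mulBy N e) ≠ LinearMap.range (mulBy N e) := by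
  obtain ⟨t, ht, h⟩ := exists_mulByPoint_point (N := N) e he
  rw [sing, Set.mem_ofPred_eq, h, LinearMap.ker_smul _ _ ht, LinearMap.range_smul _ _ ht, Ne, Ne,
    ← LinearMap.exact_iff, ← LinearMap.exact_iff,
    ← Module.FaithfullyFlat.lTensor_exact_iff_exact K (kappa (point e he))]
  rfl

end Points

end

end BGG

namespace BGG

noncomputable section

set_option linter.unusedSectionVars false

/-! ### Projections onto the components of a grading -/

section Projection

variable {K : Type*} [Field K] {M : Type*} [AddCommGroup M] [Module K M]
  {ℳ : ℤ → Submodule K M}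

/-! The Bernstein–Gelfand–Gelfand correspondence turns the injective resolution `R(F)` of N into a
linear free resolution ⋯ → S ⊗ N_{-1} → S ⊗ N_0 → F → 0 with differential ∑ x_j ⊗ e_j. Its exactness
comes from the double complex with terms S ⊗ Hom_K(E, F_i): the differential 1 ⊗ dR is exact beyond
S ⊗ N because S is flat over K, and the Koszul differential is exact in positive polynomial degree.
A chase (`exists_dT_eq_of_mem_ker`) carries this to S ⊗ N (`exists_dN_eq`, `augN_surjective`).

Localizing at a point p and taking fractions of degree 0 gives a resolution of the stalk by the free
modules 𝒪_p ⊗ N_{-i}, whose differential is multiplication by the vector of affine coordinates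
(`exists_resolution_stalk`). The components of N are replaced by the coordinate spaces `G 𝒩 i`, so
that the resolution lives in the universe of the local ring. At the point of a vector e the residue
field is K, and reduction modulo the maximal ideal gives, up to a nonzero scalar, the complex of
multiplication by e on N. This is a).

For b), let M be a module over a local ring, resolved by finite free modules. Then Tor_i(κ, M)
vanishes exactly when pd M < i: by Nakayama for i = 0, by the local criterion for freeness for i =
1, and by dimension shifting beyond (`surjective_residueField_iff`, `exact_residueField_iff`). So
the indices with nonzero homology form an initial segment, and sing(N) is the support of the sheaf.

For c), let p be the generic point of Z. The stalk at p is nonzero, but it vanishes at every proper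
generization of p, so each element of the maximal ideal acts locally nilpotently on it. The ring 𝒪_p
is regular of dimension c, and dividing out a regular sequence that generates the maximal ideal
raises the top index of nonzero homology by one at each step (`TopHomology.step`). Hence the
homology at p is nonzero in index c and zero in index c + 1. Vanishing in a fixed index is an open
condition (`isOpen_HPointDeg_eq_bot`). The locus for c + 1 serves as U, and the locus for c misses
Z, since otherwise it would contain p. -/

/-- The projection onto the component of degree `i` of an internal direct sum. -/
def gradedProj (h : DirectSum.IsInternal ℳ) (i : ℤ) : M →ₗ[K] ℳ i :=
  DirectSum.component K ℤ (fun i => ℳ i) i ∘ₗ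
    (LinearEquiv.ofBijective (DirectSum.coeLinearMap ℳ) h).symm.toLinearMap

theorem gradedProj_coe (h : DirectSum.IsInternal ℳ) {i : ℤ} (m : ℳ i) :
    gradedProj h i m = m := by
  have : (LinearEquiv.ofBijective (DirectSum.coeLinearMap ℳ) h).symm (m : M) =
      DirectSum.lof K ℤ (fun i => ℳ i) i m := by
    rw [LinearEquiv.symm_apply_eq]
    exact (DirectSum.coeLinearMap_lof ℳ _ m).symm
  simp [gradedProj, this, DirectSum.component.lof_self]

theorem gradedProj_of_mem (h : DirectSum.IsInternal ℳ) {i : ℤ} {m : M} (hm : m ∈ ℳ i) :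
    (gradedProj h i m : M) = m :=
  congrArg Subtype.val (gradedProj_coe h ⟨m, hm⟩)

theorem gradedProj_of_mem_ne (h : DirectSum.IsInternal ℳ) {i j : ℤ} {m : M} (hm : m ∈ ℳ j)
    (hij : j ≠ i) : gradedProj h i m = 0 := by
  have : (LinearEquiv.ofBijective (DirectSum.coeLinearMap ℳ) h).symm (m : M) =
      DirectSum.lof K ℤ (fun i => ℳ i) j ⟨m, hm⟩ := by
    rw [LinearEquiv.symm_apply_eq]
    exact (DirectSum.coeLinearMap_lof ℳ _ ⟨m, hm⟩).symm
  simp only [gradedProj, LinearMap.comp_apply, LinearEquiv.coe_coe, this,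
    DirectSum.component.of]
  rw [dif_neg hij]

theorem gradedProj_induction (h : DirectSum.IsInternal ℳ) {p : M → Prop} (h0 : p 0)
    (hadd : ∀ x y, p x → p y → p (x + y)) (hmem : ∀ i, ∀ m ∈ ℳ i, p m) (m : M) : p m := by
  have := h.submodule_iSup_eq_top
  have hm : m ∈ ⨆ i, ℳ i := this ▸ Submodule.mem_top
  exact Submodule.iSup_induction (motive := p) ℳ hm hmem h0 hadd

end Projection

/-! ### The Koszul complex of the polynomial ring -/

section Koszul

variable (K : Type u) [Field K] (n : ℕ)

/-- Multiplication by `x_j`. -/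
def mulX (j : Fin n) : S K n →ₗ[K] S K n := LinearMap.mulLeft K (MvPolynomial.X j)

/-- Division by `x_j`, discarding the remainder. -/
def divX (j : Fin n) : S K n →ₗ[K] S K n where
  toFun f := f.divMonomial (Finsupp.single j 1)
  map_add' f g := MvPolynomial.add_divMonomial f g _
  map_smul' c f := by
    ext m
    simp [MvPolynomial.coeff_divMonomial]

/-- The remainder of division by `x_j`. -/
def modX (j : Fin n) : S K n →ₗ[K] S K n := LinearMap.id - mulX K n j ∘ₗ divX K n j

/-- The homogeneous component of degree `a`. -/
abbrev compS (a : ℕ) : S K n →ₗ[K] S K n := MvPolynomial.homogeneousComponent a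

variable {K n}

theorem coeff_divX (j : Fin n) (f : S K n) (α : Fin n →₀ ℕ) :
    (divX K n j f).coeff α = f.coeff (Finsupp.single j 1 + α) :=
  MvPolynomial.coeff_divMonomial _ _ _

theorem coeff_mulX_add (j : Fin n) (f : S K n) (α : Fin n →₀ ℕ) :
    (mulX K n j f).coeff (Finsupp.single j 1 + α) = f.coeff α := by
  rw [mulX, LinearMap.mulLeft_apply, MvPolynomial.coeff_X_mul]

theorem divX_comp_mulX_self (j : Fin n) : divX K n j ∘ₗ mulX K n j = LinearMap.id := by
  apply LinearMap.ext
  intro f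
  ext α
  rw [LinearMap.comp_apply, coeff_divX, coeff_mulX_add, LinearMap.id_apply]

theorem divX_comp_mulX_of_ne {i j : Fin n} (h : i ≠ j) :
    divX K n j ∘ₗ mulX K n i = mulX K n i ∘ₗ divX K n j := by
  ext1 m
  apply LinearMap.ext
  intro c
  ext α
  simp only [LinearMap.comp_apply, coeff_divX, mulX, LinearMap.mulLeft_apply,
    MvPolynomial.coeff_X_mul']
  by_cases hi : i ∈ α.support
  · have hi' : i ∈ (Finsupp.single j 1 + α).support := by
      simp only [Finsupp.mem_support_iff, Finsupp.add_apply] at hi ⊢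
      omega
    rw [if_pos hi, if_pos hi', add_tsub_assoc_of_le]
    rw [Finsupp.single_le_iff]
    simp only [Finsupp.mem_support_iff] at hi
    omega
  · have hi' : i ∉ (Finsupp.single j 1 + α).support := by
      simp only [Finsupp.mem_support_iff, Finsupp.add_apply, not_not,
        Finsupp.single_apply, if_neg h.symm] at hi ⊢
      omega
    rw [if_neg hi, if_neg hi']

theorem divX_comm (i j : Fin n) : divX K n i ∘ₗ divX K n j = divX K n j ∘ₗ divX K n i := by
  ext1 m
  apply LinearMap.ext
  intro c
  ext α
  simp only [LinearMap.comp_apply, coeff_divX, ← add_assoc]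
  rw [add_comm (Finsupp.single j 1)]

theorem divX_comp_modX_self (j : Fin n) : divX K n j ∘ₗ modX K n j = 0 := by
  rw [modX, LinearMap.comp_sub, LinearMap.comp_id, ← LinearMap.comp_assoc, divX_comp_mulX_self,
    LinearMap.id_comp, sub_self]

theorem divX_comp_modX_of_ne {i j : Fin n} (h : i ≠ j) :
    divX K n i ∘ₗ modX K n j = modX K n j ∘ₗ divX K n i := by
  rw [modX, LinearMap.comp_sub, LinearMap.comp_id, ← LinearMap.comp_assoc,
    divX_comp_mulX_of_ne h.symm, LinearMap.comp_assoc, divX_comm, LinearMap.sub_comp,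
    LinearMap.id_comp, LinearMap.comp_assoc]

theorem compS_comp_mulX (a : ℕ) (j : Fin n) :
    compS K n (a + 1) ∘ₗ mulX K n j = mulX K n j ∘ₗ compS K n a := by
  ext1 m
  apply LinearMap.ext
  intro c
  ext α
  simp only [LinearMap.comp_apply, mulX, LinearMap.mulLeft_apply, MvPolynomial.coeff_X_mul',
    MvPolynomial.coeff_homogeneousComponent]
  by_cases hj : j ∈ α.support
  · have hd : Finsupp.degree α = Finsupp.degree (α - Finsupp.single j 1) + 1 := by
      have : α = (α - Finsupp.single j 1) + Finsupp.single j 1 := by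
        rw [tsub_add_cancel_of_le]
        rw [Finsupp.single_le_iff]
        simp only [Finsupp.mem_support_iff] at hj
        omega
      conv_lhs => rw [this]
      simp
    simp only [if_pos hj, hd, add_left_inj]
  · simp [hj]

theorem compS_comp_divX (a : ℕ) (j : Fin n) :
    compS K n a ∘ₗ divX K n j = divX K n j ∘ₗ compS K n (a + 1) := by
  ext1 m
  apply LinearMap.ext
  intro c
  ext α
  simp only [LinearMap.comp_apply, coeff_divX, MvPolynomial.coeff_homogeneousComponent, map_add,
    Finsupp.degree_single, add_comm 1, add_left_inj]

variable {H : Type*} [AddCommGroup H] [Module K H]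

/-- The coefficient of a monomial in `S ⊗ H`. -/
def coeffT (α : Fin n →₀ ℕ) : S K n ⊗[K] H →ₗ[K] H :=
  (TensorProduct.lid K H).toLinearMap ∘ₗ (MvPolynomial.lcoeff K α).rTensor H

theorem coeffT_tmul (α : Fin n →₀ ℕ) (f : S K n) (h : H) :
    coeffT α (f ⊗ₜ h) = f.coeff α • h := by
  simp [coeffT]

theorem eq_zero_of_coeffT {z : S K n ⊗[K] H} (h : ∀ α, coeffT α z = 0) : z = 0 := by
  let b := MvPolynomial.basisMonomials (Fin n) K
  apply (TensorProduct.equivFinsuppOfBasisLeft b (N := H)).injective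
  rw [map_zero]
  ext α
  have : ((Finsupp.lapply α : ((Fin n →₀ ℕ) →₀ H) →ₗ[K] H) ∘ₗ
      (TensorProduct.equivFinsuppOfBasisLeft b (N := H)).toLinearMap) = coeffT α := by
    ext f h
    simp [coeffT_tmul, b]
    rfl
  simpa [h α] using LinearMap.congr_fun this z

theorem coeffT_map (α β : Fin n →₀ ℕ) (f : S K n →ₗ[K] S K n) (H' : Type*) [AddCommGroup H']
    [Module K H'] (g : H →ₗ[K] H') (hf : ∀ s, (f s).coeff α = s.coeff β) (z : S K n ⊗[K] H) :
    coeffT α (TensorProduct.map f g z) = g (coeffT β z) := by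
  induction z with
  | zero => simp
  | add x y hx hy => simp only [map_add, hx, hy]
  | tmul s h => simp [coeffT_tmul, hf]

theorem coeffT_map_eq_zero (α : Fin n →₀ ℕ) (f : S K n →ₗ[K] S K n) {H' : Type*} [AddCommGroup H']
    [Module K H'] (g : H →ₗ[K] H') (hf : ∀ s, (f s).coeff α = 0) (z : S K n ⊗[K] H) :
    coeffT α (TensorProduct.map f g z) = 0 := by
  induction z with
  | zero => simp
  | add x y hx hy => simp only [map_add, hx, hy, add_zero]
  | tmul s h => simp [coeffT_tmul, hf]

variable (H) in
/-- The homogeneous component of degree `a` of `S ⊗ H`. -/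
def compT (a : ℕ) : S K n ⊗[K] H →ₗ[K] S K n ⊗[K] H := (compS K n a).rTensor H

theorem compT_tmul (a : ℕ) (f : S K n) (h : H) :
    compT H a (f ⊗ₜ[K] h) = MvPolynomial.homogeneousComponent a f ⊗ₜ h := rfl

theorem compT_compT (a : ℕ) (z : S K n ⊗[K] H) : compT H a (compT H a z) = compT H a z := by
  rw [compT, ← LinearMap.rTensor_comp_apply]
  congr 2
  ext1 m
  apply LinearMap.ext
  intro c
  ext α
  simp only [LinearMap.comp_apply, MvPolynomial.coeff_homogeneousComponent]
  split_ifs <;> rfl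

theorem coeffT_compT (a : ℕ) (α : Fin n →₀ ℕ) (z : S K n ⊗[K] H) :
    coeffT α (compT H a z) = if α.degree = a then coeffT α z else 0 := by
  induction z with
  | zero => simp
  | add x y hx hy =>
    simp only [map_add, hx, hy]
    split_ifs <;> simp
  | tmul s h => simp [coeffT_tmul, compT_tmul, MvPolynomial.coeff_homogeneousComponent]

/-- The conclusion holds for all large bounds, so that the bounds of two summands can be replaced by
their maximum. -/
theorem exists_sum_compT (z : S K n ⊗[K] H) :
    ∃ N : ℕ, ∀ M, N ≤ M → ∑ a ∈ Finset.range M, compT H a z = z := by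
  induction z with
  | zero => exact ⟨0, by simp⟩
  | add x y hx hy =>
    obtain ⟨N, hN⟩ := hx
    obtain ⟨N', hN'⟩ := hy
    refine ⟨max N N', fun M hM => ?_⟩
    simp only [map_add, Finset.sum_add_distrib]
    rw [hN M (le_trans (le_max_left _ _) hM), hN' M (le_trans (le_max_right _ _) hM)]
  | tmul f h =>
    refine ⟨f.totalDegree + 1, fun M hM => ?_⟩
    simp only [compT_tmul, ← TensorProduct.sum_tmul]
    congr 1
    refine Eq.trans ?_ (MvPolynomial.sum_homogeneousComponent f)
    symm
    refine Finset.sum_subset (Finset.range_mono hM) fun a _ ha => ?_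
    apply MvPolynomial.homogeneousComponent_eq_zero
    simp only [Finset.mem_range, not_lt] at ha
    omega

/-- The differential `∑ x_j ⊗ r_j` on `S ⊗ H`. -/
def dT (r : Fin n → H →ₗ[K] H) : S K n ⊗[K] H →ₗ[K] S K n ⊗[K] H :=
  ∑ j, TensorProduct.map (mulX K n j) (r j)

theorem dT_tmul (r : Fin n → H →ₗ[K] H) (f : S K n) (h : H) :
    dT r (f ⊗ₜ h) = ∑ j, (MvPolynomial.X j * f) ⊗ₜ r j h := by
  simp [dT, mulX]

theorem compT_dT (r : Fin n → H →ₗ[K] H) (a : ℕ) (z : S K n ⊗[K] H) :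
    compT H (a + 1) (dT r z) = dT r (compT H a z) := by
  simp only [dT, LinearMap.sum_apply, map_sum, compT, LinearMap.rTensor]
  simp only [← LinearMap.comp_apply, ← TensorProduct.map_comp, compS_comp_mulX, LinearMap.id_comp,
    LinearMap.comp_id]

theorem dT_comp_map {H' : Type*} [AddCommGroup H'] [Module K H'] (r : Fin n → H →ₗ[K] H)
    (r' : Fin n → H' →ₗ[K] H') (g : H →ₗ[K] H') (hg : ∀ j, g ∘ₗ r j = r' j ∘ₗ g)
    (z : S K n ⊗[K] H) : dT r' (g.lTensor _ z) = g.lTensor _ (dT r z) := by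
  simp only [dT, LinearMap.sum_apply, map_sum, LinearMap.lTensor]
  simp only [← LinearMap.comp_apply, ← TensorProduct.map_comp, hg, LinearMap.id_comp, LinearMap.comp_id]

theorem compT_map {H' : Type*} [AddCommGroup H'] [Module K H']
    (g : H →ₗ[K] H') (a : ℕ) (z : S K n ⊗[K] H) :
    compT H' a (g.lTensor _ z) = g.lTensor _ (compT H a z) := by
  simp only [compT, LinearMap.lTensor, LinearMap.rTensor,
    ← LinearMap.comp_apply, ← TensorProduct.map_comp, LinearMap.id_comp, LinearMap.comp_id]

/-- The terms of (i, j) and (j, i) cancel, since the x_j commute and the r_j anticommute. The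
diagonal terms need r_j² = 0 separately, because of characteristic 2. -/
theorem dT_dT {r : Fin n → H →ₗ[K] H} (hr : ∀ i, r i ∘ₗ r i = 0)
    (hrr : ∀ i j, r i ∘ₗ r j = - (r j ∘ₗ r i)) (z : S K n ⊗[K] H) : dT r (dT r z) = 0 := by
  induction z with
  | zero => simp
  | add x y hx hy => simp only [map_add, hx, hy, add_zero]
  | tmul f h =>
    simp only [dT_tmul, map_sum]
    rw [← Finset.sum_product']
    refine Finset.sum_involution (fun p _ => p.swap) ?_ ?_ (fun _ _ => Finset.mem_univ _)
      (fun _ _ => Prod.swap_swap _)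
    · rintro ⟨i, j⟩ -
      have := LinearMap.congr_fun (hrr i j) h
      simp only [LinearMap.comp_apply, LinearMap.neg_apply] at this
      simp only [Prod.fst_swap, Prod.snd_swap, this, TensorProduct.tmul_neg]
      rw [mul_left_comm]
      simp
    · rintro ⟨i, j⟩ - h0 h1
      simp only [Prod.swap_prod_mk, Prod.mk.injEq] at h1
      obtain ⟨rfl, -⟩ := h1
      have := LinearMap.congr_fun (hr j) h
      simp only [LinearMap.comp_apply, LinearMap.zero_apply] at this
      simp [this] at h0

/-- The operators `r_j` and `c_j` satisfy the relations `r_i c_j + c_j r_i = δ_ij` of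
multiplication and contraction on an exterior algebra. -/
def CliffordRel (r c : Fin n → H →ₗ[K] H) : Prop :=
  ∀ i j, r i ∘ₗ c j + c j ∘ₗ r i = if i = j then LinearMap.id else 0

/-- For i ≠ j the Clifford relation cancels the cross terms. For i = j it leaves the identity minus
a map into the part free of x_j. Only one variable is treated at a time, so no degree has to be
inverted and the characteristic is arbitrary. -/
theorem dT_homotopy {r c : Fin n → H →ₗ[K] H} (hrc : CliffordRel r c) (j : Fin n) :
    dT r ∘ₗ TensorProduct.map (divX K n j) (c j) + TensorProduct.map (divX K n j) (c j) ∘ₗ dT r =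
      LinearMap.id - TensorProduct.map (modX K n j) (r j ∘ₗ c j) := by
  have h : ∀ i, TensorProduct.map (mulX K n i) (r i) ∘ₗ TensorProduct.map (divX K n j) (c j) +
      TensorProduct.map (divX K n j) (c j) ∘ₗ TensorProduct.map (mulX K n i) (r i) =
      if i = j then LinearMap.id - TensorProduct.map (modX K n j) (r j ∘ₗ c j) else 0 := by
    intro i
    rw [← TensorProduct.map_comp, ← TensorProduct.map_comp]
    by_cases hij : i = j
    · subst hij
      have h1 := hrc i i
      rw [if_pos rfl] at h1
      have h2 : mulX K n i ∘ₗ divX K n i = LinearMap.id - modX K n i := by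
        simp [modX]
      rw [if_pos rfl, divX_comp_mulX_self, h2, sub_eq_add_neg, TensorProduct.map_add_left,
        add_right_comm, ← TensorProduct.map_add_right, h1, TensorProduct.map_id,
        sub_eq_add_neg (LinearMap.id : S K n ⊗[K] H →ₗ[K] _)]
      congr 1
      refine TensorProduct.ext' fun s k => ?_
      simp [TensorProduct.neg_tmul]
    · have h1 := hrc i j
      rw [if_neg hij] at h1
      rw [if_neg hij, divX_comp_mulX_of_ne hij, ← TensorProduct.map_add_right, h1,
        TensorProduct.map_zero_right]
  have h' := Finset.sum_congr (rfl : (Finset.univ : Finset (Fin n)) = _) fun i _ => h i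
  rw [Finset.sum_add_distrib, Finset.sum_ite_eq' Finset.univ j, if_pos (Finset.mem_univ j)] at h'
  rw [← h']
  apply LinearMap.ext
  intro z
  simp [dT, LinearMap.sum_apply]

/-- The Koszul complex of the polynomial ring is exact in positive polynomial degrees. -/
theorem exists_dT_eq_of_pos {r c : Fin n → H →ₗ[K] H} (hrc : CliffordRel r c)
    (hdd : ∀ z : S K n ⊗[K] H, dT r (dT r z) = 0) {a : ℕ} {z : S K n ⊗[K] H} (hz : compT H (a + 1) z = z) (hd : dT r z = 0) :
    ∃ t, compT H a t = t ∧ dT r t = z := by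
  -- The variables are eliminated one at a time: up to a boundary, z is a cycle w in which no
  -- variable of l occurs.
  have key : ∀ l : List (Fin n), ∃ t w, compT H a t = t ∧ z = dT r t + w ∧ dT r w = 0 ∧
      compT H (a + 1) w = w ∧ ∀ j ∈ l, (divX K n j).rTensor H w = 0 := by
    intro l
    induction l with
    | nil => exact ⟨0, z, by simp, by simp, hd, hz, by simp⟩
    | cons j l ih =>
      obtain ⟨t, w, ht, hzw, hdw, hw, hl⟩ := ih
      set h := TensorProduct.map (divX K n j) (c j) with hh
      set π := TensorProduct.map (modX K n j) (r j ∘ₗ c j) with hπ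
      have hhom : dT r (h w) = w - π w := by
        have := LinearMap.congr_fun (dT_homotopy hrc j) w
        simpa [hdw] using this
      have hhw : compT H a (h w) = h w := by
        conv_rhs => rw [← hw]
        simp only [hh, compT, LinearMap.rTensor, ← LinearMap.comp_apply, ← TensorProduct.map_comp,
          compS_comp_divX, LinearMap.id_comp, LinearMap.comp_id]
      refine ⟨t + h w, π w, by rw [map_add, ht, hhw], ?_, ?_, ?_, ?_⟩
      · rw [map_add, hhom, hzw]
        abel
      · have h3 : π w = w - dT r (h w) := by rw [hhom]; abel
        rw [h3, map_sub, hdd, hdw, sub_zero]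
      · have h3 : π w = w - dT r (h w) := by rw [hhom]; abel
        rw [h3, map_sub, hw, compT_dT, hhw]
      · intro k hk
        simp only [hπ, LinearMap.rTensor, ← LinearMap.comp_apply, ← TensorProduct.map_comp]
        by_cases hkj : k = j
        · subst hkj
          rw [divX_comp_modX_self, TensorProduct.map_zero_left, LinearMap.zero_apply]
        · have hk' : k ∈ l := by simpa [hkj] using hk
          have := hl k hk'
          rw [divX_comp_modX_of_ne hkj, LinearMap.id_comp, ← LinearMap.comp_id (r j ∘ₗ c j), TensorProduct.map_comp,
            LinearMap.comp_apply]
          rw [LinearMap.rTensor] at this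
          rw [this, map_zero]
  obtain ⟨t, w, ht, hzw, -, hw, hl⟩ := key (List.finRange n)
  refine ⟨t, ht, ?_⟩
  -- No variable occurs in w any more, yet w is homogeneous of positive degree a + 1.
  have : w = 0 := by
    apply eq_zero_of_coeffT
    intro α
    by_cases hα : α = 0
    · rw [← hw, coeffT_compT, if_neg]
      simp [hα]
    · obtain ⟨j, hj⟩ := Finsupp.ne_iff.mp hα
      have hle : Finsupp.single j 1 ≤ α := by
        rw [Finsupp.single_le_iff]
        simp at hj
        omega
      have h1 := coeffT_map (α - Finsupp.single j 1) α (divX K n j) H LinearMap.id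
        (fun s => by rw [coeff_divX, add_tsub_cancel_of_le hle]) w
      have h2 := hl j (List.mem_finRange j)
      rw [LinearMap.rTensor] at h2
      rw [h2, map_zero] at h1
      simpa using h1.symm
  rw [hzw, this, add_zero]

/-- The coefficient of x_j in the image of z receives only r_j of the constant coefficient of z. -/
theorem eq_zero_of_dT_of_zero {r : Fin n → H →ₗ[K] H}
    {z : S K n ⊗[K] H} (hd : dT r z = 0) (j : Fin n) :
    r j (coeffT 0 z) = 0 := by
  have h := congrArg (coeffT (Finsupp.single j 1)) hd
  rw [dT, LinearMap.sum_apply, map_sum, Finset.sum_eq_single j, map_zero] at h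
  · rwa [coeffT_map (Finsupp.single j 1) 0] at h
    intro s
    simpa using coeff_mulX_add j s 0
  · intro i _ hi
    refine coeffT_map_eq_zero _ _ _ (fun s => ?_) z
    rw [mulX, LinearMap.mulLeft_apply, MvPolynomial.coeff_X_mul', if_neg]
    simpa [Finsupp.single_apply] using hi
  · simp

end Koszul

/-! ### The functionals on the exterior algebra -/

section Functionals

variable {K : Type u} [Field K] {n : ℕ} {A : Type*} [AddCommGroup A] [Module K A]

variable (A) in
/-- The action of `e_j` on `Hom_K(E, A)`. -/
def homMul (j : Fin n) : (E K n →ₗ[K] A) →ₗ[K] (E K n →ₗ[K] A) :=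
  LinearMap.lcomp K A (LinearMap.mulRight K (ExteriorAlgebra.ι K (stdVec K j)))

variable (A) in
/-- The adjoint of the contraction with `x_j`. -/
def homContract (j : Fin n) : (E K n →ₗ[K] A) →ₗ[K] (E K n →ₗ[K] A) :=
  LinearMap.lcomp K A (CliffordAlgebra.contractRight.flip (LinearMap.proj j))

theorem homMul_apply (j : Fin n) (φ : E K n →ₗ[K] A) (b : E K n) :
    homMul A j φ b = φ (b * ExteriorAlgebra.ι K (stdVec K j)) := rfl

theorem homContract_apply (j : Fin n) (φ : E K n →ₗ[K] A) (b : E K n) :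
    homContract A j φ b = φ (CliffordAlgebra.contractRight b (LinearMap.proj j)) := rfl

/-- This is the dual of the antiderivation rule for right contraction on the exterior algebra. -/
theorem cliffordRel_hom : CliffordRel (homMul (K := K) (n := n) A) (homContract A) := by
  intro i j
  refine LinearMap.ext fun φ => LinearMap.ext fun b => ?_
  simp only [LinearMap.add_apply, LinearMap.comp_apply, homMul_apply, homContract_apply]
  have h := CliffordAlgebra.contractRight_mul_ι (Q := (0 : QuadraticForm K (V K n)))
    (LinearMap.proj j) (stdVec K i) b
  have h' := congrArg φ h
  rw [map_sub, eq_sub_iff_add_eq] at h'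
  refine h'.trans ?_
  by_cases hij : i = j
  · subst hij
    simp
  · simp [hij, Ne.symm hij]

theorem homMul_comp_self (j : Fin n) : homMul (K := K) (n := n) A j ∘ₗ homMul A j = 0 := by
  refine LinearMap.ext fun φ => LinearMap.ext fun b => ?_
  simp [homMul_apply, mul_assoc]

theorem homMul_comp_comm (i j : Fin n) :
    homMul (K := K) (n := n) A i ∘ₗ homMul A j =
      - (homMul (K := K) (n := n) A j ∘ₗ homMul A i) := by
  refine LinearMap.ext fun φ => LinearMap.ext fun b => ?_
  simp only [LinearMap.comp_apply, LinearMap.neg_apply, homMul_apply, mul_assoc]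
  rw [← map_neg, ← mul_neg, eq_neg_of_add_eq_zero_left (ExteriorAlgebra.ι_add_mul_swap _ _)]

/-- E is spanned by 1 and the products b v with v ∈ V, so an element of the socle of the coinduced
module is determined by its value at 1. -/
theorem eq_zero_of_homMul {φ : E K n →ₗ[K] A} (h : ∀ j, homMul A j φ = 0) (h1 : φ 1 = 0) :
    φ = 0 := by
  have hv : ∀ (v : V K n) (b : E K n), φ (b * ExteriorAlgebra.ι K v) = 0 := by
    intro v b
    have hv : v = ∑ j, v j • stdVec K j := pi_eq_sum_univ' v
    rw [hv, map_sum, Finset.mul_sum, map_sum]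
    refine Finset.sum_eq_zero fun j _ => ?_
    rw [map_smul, mul_smul_comm, map_smul]
    have := LinearMap.congr_fun (h j) b
    rw [homMul_apply] at this
    rw [this, LinearMap.zero_apply, smul_zero]
  refine LinearMap.ext fun b => ?_
  rw [LinearMap.zero_apply]
  induction b using CliffordAlgebra.right_induction with
  | algebraMap r => rw [Algebra.algebraMap_eq_smul_one, map_smul, h1, smul_zero]
  | add x y hx hy => rw [map_add, hx, hy, add_zero]
  | mul_ι m x _ => exact hv m x

end Functionals

/-! ### The linear free resolution of `F` -/

section LinearResolution

variable {K : Type u} [Field K] {n : ℕ}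
  {N : Type v} [AddCommGroup N] [Module K N] [Module (E K n) N] [IsScalarTower K (E K n) N]
  {F : Type u} [AddCommGroup F] [Module K F] [Module (S K n) F] [IsScalarTower K (S K n) F]
  {ℱ : ℤ → Submodule K F} (hF : IsGradedModule (gradS K n) ℱ)

theorem dR_apply (i : ℤ) (φ : E K n →ₗ[K] ℱ i) (b : E K n) :
    (dR hF i φ b : F) = ∑ j, (MvPolynomial.X j : S K n) •
      (φ (ExteriorAlgebra.ι K (stdVec K j) * b) : F) := by
  simp [dR]

/-- The differential multiplies the argument on the left and the module structure multiplies it on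
the right. -/
theorem dR_comp_homMul (i : ℤ) (j : Fin n) :
    dR hF i ∘ₗ homMul (ℱ i) j = homMul (ℱ (i + 1)) j ∘ₗ dR hF i := by
  refine LinearMap.ext fun φ => LinearMap.ext fun b => Subtype.ext ?_
  simp only [LinearMap.comp_apply, homMul_apply, dR_apply, mul_assoc]

/-- The map `S ⊗ Hom_K(E, A) → F` taking `s ⊗ φ` to `s φ(1)`, for a subspace `A` of `F`. -/
def evalT (A : Submodule K F) : S K n ⊗[K] (E K n →ₗ[K] A) →ₗ[K] F :=
  TensorProduct.lift ((Algebra.lsmul K K F : S K n →ₐ[K] _).toLinearMap.compl₂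
    (A.subtype ∘ₗ LinearMap.applyₗ (1 : E K n)))

theorem evalT_tmul (A : Submodule K F) (s : S K n) (φ : E K n →ₗ[K] A) :
    evalT A (s ⊗ₜ φ) = s • (φ 1 : F) := by
  simp [evalT]

/-- At b = 1 left and right multiplication by e_j agree, so evaluation at 1 does not distinguish the
two differentials of the double complex. -/
theorem evalT_dT (i : ℤ) (z : S K n ⊗[K] (E K n →ₗ[K] ℱ i)) :
    evalT (ℱ i) (dT (homMul (ℱ i)) z) = evalT (ℱ (i + 1)) ((dR hF i).lTensor _ z) := by
  induction z with
  | zero => simp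
  | add x y hx hy => simp only [map_add, hx, hy]
  | tmul s φ =>
    simp only [dT_tmul, map_sum, evalT_tmul, LinearMap.lTensor_tmul, dR_apply, homMul_apply,
      Finset.smul_sum, mul_one, one_mul, smul_smul, mul_comm]

/-- The chase in the double complex trades one polynomial degree a for one step in i. In degree 0, z
is 1 ⊗ φ with φ in the socle and φ(1) = 0, so z = 0. In positive degree z is a Koszul boundary of
some t; by induction the image of t under dR is the Koszul boundary of an element dR w, and t is
corrected by the Koszul boundary of w. -/
theorem exists_dT_eq_of_mem_ker
    (hex : ∀ i : ℤ, 0 ≤ i → LinearMap.range (dR hF i) = LinearMap.ker (dR hF (i + 1)))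
    (a : ℕ) : ∀ (i : ℤ), 0 ≤ i → ∀ z : S K n ⊗[K] (E K n →ₗ[K] ℱ i),
      (dR hF i).lTensor _ z = 0 → compT _ a z = z → dT (homMul (ℱ i)) z = 0 →
      evalT (ℱ i) z = 0 → ∃ z', (dR hF i).lTensor _ z' = 0 ∧ dT (homMul (ℱ i)) z' = z := by
  induction a with
  | zero =>
    intro i _ z _ hz hd he
    refine ⟨0, map_zero _, ?_⟩
    rw [map_zero]
    have hz' : z = 1 ⊗ₜ coeffT 0 z := by
      conv_lhs => rw [← hz]
      clear * -
      induction z with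
      | zero => simp
      | add x y hx hy => rw [map_add, hx, hy, map_add, TensorProduct.tmul_add]
      | tmul s φ =>
        rw [compT_tmul, coeffT_tmul, MvPolynomial.homogeneousComponent_zero, MvPolynomial.C_eq_smul_one,
          TensorProduct.smul_tmul]
    have h0 : coeffT 0 z = 0 := by
      apply eq_zero_of_homMul (fun j => eq_zero_of_dT_of_zero hd j)
      rw [hz', evalT_tmul, one_smul] at he
      exact_mod_cast he
    rw [hz', h0, TensorProduct.tmul_zero]
  | succ a ih =>
    intro i hi z hzR hz hd he
    obtain ⟨t, ht, rfl⟩ := exists_dT_eq_of_pos cliffordRel_hom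
      (dT_dT homMul_comp_self homMul_comp_comm) hz hd
    have hy := dT_comp_map (homMul (ℱ i)) (homMul (ℱ (i + 1))) (dR hF i) (dR_comp_homMul hF i)
    -- The evaluation of dR t vanishes because by `evalT_dT` it equals the evaluation of the Koszul
    -- boundary of t, which is z.
    obtain ⟨z'', hz'', hdz''⟩ := ih (i + 1) (by omega) ((dR hF i).lTensor _ t)
      (by
        rw [← LinearMap.lTensor_comp_apply]
        have : dR hF (i + 1) ∘ₗ dR hF i = 0 := by
          exact LinearMap.range_le_ker_iff.mp (hex i hi).le
        rw [this, LinearMap.lTensor_zero, LinearMap.zero_apply])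
      (by rw [compT_map, ht]) (by rw [hy, hzR]) (by rw [← evalT_dT, he])
    have hexact : Function.Exact ((dR hF i).lTensor (S K n)) ((dR hF (i + 1)).lTensor (S K n)) :=
      Module.Flat.lTensor_exact _ (LinearMap.exact_iff.mpr (hex i hi).symm)
    obtain ⟨w, rfl⟩ := (hexact z'').mp hz''
    refine ⟨t - dT (homMul (ℱ i)) w, ?_, ?_⟩
    · rw [map_sub, ← hdz'', hy, sub_self]
    · rw [map_sub, dT_dT homMul_comp_self homMul_comp_comm, sub_zero]

variable (K n N) in
/-- The differential `∑ x_j ⊗ e_j` of `S ⊗ N`. -/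
def dN : S K n ⊗[K] N →ₗ[K] S K n ⊗[K] N := dT fun j => mulBy N (stdVec K j)

theorem mulBy_comp_self (e : V K n) : mulBy N e ∘ₗ mulBy N e = 0 := by
  ext m
  simp [mulBy, smul_smul]

theorem mulBy_comp_comm (e e' : V K n) :
    mulBy N e ∘ₗ mulBy N e' = - (mulBy N e' ∘ₗ mulBy N e) := by
  ext m
  simp only [mulBy, LinearMap.comp_apply, LinearMap.neg_apply, Algebra.lsmul_coe, smul_smul]
  rw [← neg_smul, eq_neg_of_add_eq_zero_left (ExteriorAlgebra.ι_add_mul_swap _ _)]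

/-- The augmentation `S ⊗ N → F` given by an embedding of `N` in `Hom_K(E, F_0)`. -/
def augN (η : N →ₗ[K] (E K n →ₗ[K] ℱ 0)) : S K n ⊗[K] N →ₗ[K] F :=
  evalT (ℱ 0) ∘ₗ η.lTensor _

omit [Module (E K n) N] [IsScalarTower K (E K n) N] in
theorem augN_tmul (η : N →ₗ[K] (E K n →ₗ[K] ℱ 0)) (s : S K n) (m : N) :
    augN η (s ⊗ₜ m) = s • (η m 1 : F) := by
  simp [augN, evalT_tmul]

section

variable {η : N →ₗ[K] (E K n →ₗ[K] ℱ 0)}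

omit [Module (E K n) N] [IsScalarTower K (E K n) N] in
include hF in
theorem augN_compT_mem (a : ℕ) (z : S K n ⊗[K] N) : augN η (compT N a z) ∈ ℱ a := by
  induction z with
  | zero => simp
  | add x y hx hy => simp only [map_add]; exact add_mem hx hy
  | tmul s m =>
    rw [compT_tmul, augN_tmul]
    simpa using hF.smul_mem (MvPolynomial.homogeneousComponent_mem a s) (η m 1).2

omit [Module (E K n) N] [IsScalarTower K (E K n) N] in
include hF in
-- The polynomial components of z are sent to different graded components of F, so their images
-- vanish separately.
theorem augN_compT_eq_zero {z : S K n ⊗[K] N} (hz : augN η z = 0) (a : ℕ) :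
    augN η (compT N a z) = 0 := by
  obtain ⟨M, hM⟩ := exists_sum_compT z
  have h1 := hM (max M (a + 1)) (le_max_left _ _)
  have h2 := congrArg (augN η) h1
  rw [map_sum, hz] at h2
  have h3 := congrArg (gradedProj hF.isInternal a) h2
  rw [map_sum, map_zero, Finset.sum_eq_single a] at h3
  · have := gradedProj_of_mem hF.isInternal (augN_compT_mem (η := η) hF a z)
    rw [← this, h3]
    rfl
  · intro b _ hb
    exact gradedProj_of_mem_ne _ (augN_compT_mem hF b z) (by exact_mod_cast hb)
  · intro h
    simp at h

variable (hη : ∀ (a : E K n) (m : N) (b : E K n), η (a • m) b = η m (b * a))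
include hη

omit [Module (S K n) F] [IsScalarTower K (S K n) F] in
theorem comp_mulBy (j : Fin n) : η ∘ₗ mulBy N (stdVec K j) = homMul (ℱ 0) j ∘ₗ η := by
  ext m b
  simp [mulBy, hη, homMul_apply]

theorem augN_dN (hker : LinearMap.range η = LinearMap.ker (dR hF 0)) (z : S K n ⊗[K] N) :
    augN η (dN K n N z) = 0 := by
  rw [augN, LinearMap.comp_apply, dN, ← dT_comp_map _ _ η (comp_mulBy hη), evalT_dT hF,
    ← LinearMap.lTensor_comp_apply]
  have : dR hF 0 ∘ₗ η = 0 := by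
    exact LinearMap.range_le_ker_iff.mp hker.le
  rw [this, LinearMap.lTensor_zero, LinearMap.zero_apply, map_zero]

/-- The complex `S ⊗ N` is exact, except in the last place. -/
theorem exists_dN_eq (hinj : Function.Injective η)
    (hker : LinearMap.range η = LinearMap.ker (dR hF 0))
    (hex : ∀ i : ℤ, 0 ≤ i → LinearMap.range (dR hF i) = LinearMap.ker (dR hF (i + 1)))
    {z : S K n ⊗[K] N} (hd : dN K n N z = 0) (haug : augN η z = 0) : ∃ y, dN K n N y = z := by
  have hcomm := dT_comp_map (H := N) _ (homMul (ℱ 0)) η (comp_mulBy hη)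
  have hinj' : Function.Injective (η.lTensor (S K n)) :=
    Module.Flat.lTensor_preserves_injective_linearMap _ hinj
  have hexact : Function.Exact (η.lTensor (S K n)) ((dR hF 0).lTensor (S K n)) :=
    Module.Flat.lTensor_exact _ (LinearMap.exact_iff.mpr hker.symm)
  -- Each polynomial component is moved by η into S ⊗ Hom_K(E, F_0). The primitive found there is
  -- killed by dR, so by flatness it comes from S ⊗ N.
  have key : ∀ a, ∃ y, dN K n N y = compT N a z := by
    intro a
    have hda : dN K n N (compT N a z) = 0 := by
      rw [dN, ← compT_dT, ← dN, hd, map_zero]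
    obtain ⟨z', hz', hdz'⟩ := exists_dT_eq_of_mem_ker hF hex a 0 le_rfl
      (η.lTensor _ (compT N a z)) (hexact.apply_apply_eq_zero _) (by rw [compT_map, compT_compT])
      (by rw [hcomm, ← dN, hda, map_zero]) (augN_compT_eq_zero hF haug a)
    obtain ⟨y, rfl⟩ := (hexact z').mp hz'
    refine ⟨y, hinj' ?_⟩
    rw [← hdz', hcomm, dN]
  choose y hy using key
  obtain ⟨M, hM⟩ := exists_sum_compT z
  refine ⟨∑ a ∈ Finset.range M, y a, ?_⟩
  rw [map_sum, ← hM M le_rfl]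
  exact Finset.sum_congr rfl fun a _ => hy a

end

omit [Module (E K n) N] [IsScalarTower K (E K n) N] in
/-- The augmentation `S ⊗ N → F` is surjective. -/
theorem augN_surjective {η : N →ₗ[K] (E K n →ₗ[K] ℱ 0)} (h0 : ∀ i : ℤ, i < 0 → ℱ i = ⊥)
    (hker : LinearMap.range η = LinearMap.ker (dR hF 0))
    (hex : ∀ i : ℤ, 0 ≤ i → LinearMap.range (dR hF i) = LinearMap.ker (dR hF (i + 1))) :
    Function.Surjective (augN η) := by
  have hsmul : ∀ (s : S K n) (z : S K n ⊗[K] N), augN η (s • z) = s • augN η z := by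
    intro s z
    induction z with
    | zero => simp
    | add x y hx hy => simp only [smul_add, map_add, hx, hy]
    | tmul t m => rw [TensorProduct.smul_tmul', augN_tmul, augN_tmul, smul_eq_mul, mul_smul]
  -- The functional b ↦ (scalar part of b) f is a cocycle, because e_j b has no scalar part.
  let ψ : ∀ i, ℱ i → (E K n →ₗ[K] ℱ i) := fun i f =>
    (LinearMap.toSpanSingleton K (ℱ i) f) ∘ₗ (ExteriorAlgebra.algebraMapInv).toLinearMap
  have hψ1 : ∀ i f, ψ i f 1 = f := by
    intro i f
    simp [ψ]
  have hψd : ∀ i f, dR hF i (ψ i f) = 0 := by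
    intro i f
    refine LinearMap.ext fun b => Subtype.ext ?_
    simp [dR_apply, ψ, ExteriorAlgebra.algebraMapInv]
  have key : ∀ (i : ℕ), ∀ f ∈ ℱ i, f ∈ LinearMap.range (augN η) := by
    intro i
    induction i with
    | zero =>
      intro f hf
      have h : ψ 0 ⟨f, hf⟩ ∈ LinearMap.ker (dR hF 0) := hψd _ _
      rw [← hker] at h
      obtain ⟨m, hm⟩ := h
      exact ⟨1 ⊗ₜ m, by rw [augN_tmul, hm, hψ1, one_smul]⟩
    | succ i ih =>
      intro f hf
      rw [Nat.cast_succ] at hf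
      have h : ψ ((i : ℤ) + 1) ⟨f, hf⟩ ∈ LinearMap.ker (dR hF (i + 1)) := hψd _ _
      rw [← hex i (by omega)] at h
      obtain ⟨φ, hφ⟩ := h
      -- Evaluating the coboundary at 1 gives f = ∑ x_j φ(e_j): F is generated by F_0.
      have hf : f = (dR hF i φ 1 : F) := by rw [hφ, hψ1]
      rw [hf, dR_apply]
      refine sum_mem fun j _ => ?_
      obtain ⟨z, hz⟩ := ih _ (φ (ExteriorAlgebra.ι K (stdVec K j) * 1)).2
      exact ⟨(MvPolynomial.X j : S K n) • z, by rw [hsmul, hz]⟩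
  intro f
  change f ∈ LinearMap.range (augN η)
  refine gradedProj_induction hF.isInternal (p := fun f => f ∈ LinearMap.range (augN η))
    (zero_mem _) (fun _ _ => add_mem) (fun i m hm => ?_) f
  rcases lt_or_ge i 0 with hi | hi
  · rw [h0 i hi, Submodule.mem_bot] at hm
    rw [hm]
    exact zero_mem _
  · lift i to ℕ using hi
    exact key i m hm

end LinearResolution

/-! ### The local ring of projective space as an algebra -/

section LocalRing

variable {K : Type u} [Field K] {n : ℕ} (p : P K n)

/-- The localization of `S` at the prime `p`. -/
abbrev locRing : Type u := Localization p.asHomogeneousIdeal.toIdeal.primeCompl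

theorem val_toLocalRing (c : K) : (toLocalRing p c).val = algebraMap K (locRing p) c := by
  change Localization.mk (MvPolynomial.C c : S K n) 1 = _
  rw [Localization.mk_one_eq_algebraMap, IsScalarTower.algebraMap_apply K (S K n)]
  rfl

/-- The scalar multiplication is the one already present on the homogeneous localization, and the
structure map is the one along which `torStalk` restricts scalars. -/
instance instAlgebraLocalRing : Algebra K (localRing p) where
  toSMul := HomogeneousLocalization.instSMul (α := K) p.asHomogeneousIdeal.toIdeal.primeCompl
  algebraMap := toLocalRing p
  commutes' _ _ := mul_comm _ _
  smul_def' c x := by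
    apply HomogeneousLocalization.val_injective
    refine (HomogeneousLocalization.val_smul _ c x).trans ?_
    rw [HomogeneousLocalization.val_mul, val_toLocalRing, Algebra.smul_def]

instance instTowerLocRing : IsScalarTower K (localRing p) (locRing p) :=
  IsScalarTower.of_algebraMap_eq (R := K) (S := localRing p) (A := locRing p)
    fun c => (val_toLocalRing p c).symm

instance instTowerLocModuleBase (F : Type u) [AddCommGroup F] [Module K F] [Module (S K n) F]
    [IsScalarTower K (S K n) F] : IsScalarTower K (localRing p) (locModule F p) where
  smul_assoc a b x := by
    have h : algebraMap (localRing p) (locRing p) (a • b) =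
        a • algebraMap (localRing p) (locRing p) b :=
      algebraMap.coe_smul a b _
    change algebraMap (localRing p) (locRing p) (a • b) • x =
      a • (algebraMap (localRing p) (locRing p) b • x)
    rw [h, smul_assoc]

theorem exists_X_notMem : ∃ j, (MvPolynomial.X j : S K n) ∉ p.asHomogeneousIdeal.toIdeal := by
  by_contra! h
  apply p.not_irrelevant_le
  rw [HomogeneousIdeal.irrelevant_le]
  intro i hi f hf
  have hspan : f ∈ Ideal.span ((MvPolynomial.X : Fin n → S K n) '' Set.univ) := by
    rw [MvPolynomial.mem_ideal_span_X_image]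
    intro m hm
    have hd := hf (MvPolynomial.mem_support_iff.mp hm)
    by_contra! h0
    have : m = 0 := by
      ext j
      simpa using h0 j (Set.mem_univ j)
    subst this
    simp at hd
    omega
  have hle : Ideal.span ((MvPolynomial.X : Fin n → S K n) '' Set.univ) ≤
      p.asHomogeneousIdeal.toIdeal := by
    rw [Ideal.span_le]
    rintro _ ⟨j, -, rfl⟩
    exact h j
  exact hle hspan

/-- The index of a coordinate that does not vanish at `p`. -/
def idx : Fin n := (exists_X_notMem p).choose

theorem X_idx_notMem : (MvPolynomial.X (idx p) : S K n) ∉ p.asHomogeneousIdeal.toIdeal :=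
  (exists_X_notMem p).choose_spec

/-- The fraction `f / s` of elements of the same degree. -/
def frac {a : ℕ} {f s : S K n} (hf : f ∈ gradS K n a) (hs : s ∈ gradS K n a)
    (h : s ∉ p.asHomogeneousIdeal.toIdeal) : localRing p :=
  HomogeneousLocalization.mk ⟨a, ⟨f, hf⟩, ⟨s, hs⟩, h⟩

theorem mul_val_frac {a : ℕ} {f s : S K n} (hf : f ∈ gradS K n a) (hs : s ∈ gradS K n a)
    (h : s ∉ p.asHomogeneousIdeal.toIdeal) :
    algebraMap (S K n) (locRing p) s * algebraMap (localRing p) (locRing p) (frac p hf hs h) =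
      algebraMap (S K n) (locRing p) f := by
  rw [HomogeneousLocalization.algebraMap_apply, frac, HomogeneousLocalization.val_mk,
    Localization.mk_eq_mk']
  exact IsLocalization.mk'_spec' _ _ ⟨s, h⟩

theorem exists_frac (c : localRing p) : ∃ (a : ℕ) (f s : S K n) (hf : f ∈ gradS K n a)
    (hs : s ∈ gradS K n a) (h : s ∉ p.asHomogeneousIdeal.toIdeal), c = frac p hf hs h := by
  obtain ⟨c, rfl⟩ := HomogeneousLocalization.mk_surjective c
  exact ⟨c.deg, c.num, c.den, c.num.2, c.den.2, c.den_mem, rfl⟩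

/-- The affine coordinates `x_j / x_0`. -/
def coord (j : Fin n) : localRing p :=
  frac p (MvPolynomial.isHomogeneous_X K j) (MvPolynomial.isHomogeneous_X K (idx p))
    (X_idx_notMem p)

theorem isUnit_algebraMap {s : S K n} (h : s ∉ p.asHomogeneousIdeal.toIdeal) :
    IsUnit (algebraMap (S K n) (locRing p) s) :=
  IsLocalization.map_units (locRing p)
    (⟨s, h⟩ : p.asHomogeneousIdeal.toIdeal.primeCompl)

theorem algebraMap_locRing_injective : Function.Injective (algebraMap (S K n) (locRing p)) :=
  IsLocalization.injective _
    (Ideal.primeCompl_le_nonZeroDivisors p.asHomogeneousIdeal.toIdeal)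

end LocalRing

/-! ### Multiplication by a vector with entries in an algebra -/

section TautMul

variable {K : Type u} [Field K] {n : ℕ} (N : Type v) [AddCommGroup N] [Module K N]
  [Module (E K n) N] [IsScalarTower K (E K n) N]

/-- Multiplication by `∑ c_j ⊗ e_j` on `R ⊗ N`. -/
def tautMul (R : Type*) [CommRing R] [Algebra K R] (c : Fin n → R) :
    R ⊗[K] N →ₗ[R] R ⊗[K] N :=
  ∑ j, c j • (mulBy N (stdVec K j)).baseChange R

variable {N}

theorem tautMul_tmul (R : Type*) [CommRing R] [Algebra K R] (c : Fin n → R) (r : R) (m : N) :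
    tautMul N R c (r ⊗ₜ[K] m) = ∑ j, (c j * r) ⊗ₜ[K] mulBy N (stdVec K j) m := by
  simp [tautMul, LinearMap.sum_apply, TensorProduct.smul_tmul']

theorem tautMul_tautMul (R : Type*) [CommRing R] [Algebra K R] (c : Fin n → R)
    (z : R ⊗[K] N) : tautMul N R c (tautMul N R c z) = 0 := by
  induction z with
  | zero => simp
  | add x y hx hy => simp only [map_add, hx, hy, add_zero]
  | tmul r m =>
    simp only [tautMul_tmul, map_sum]
    rw [← Finset.sum_product']
    refine Finset.sum_involution (fun p _ => p.swap) ?_ ?_ (fun _ _ => Finset.mem_univ _)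
      (fun _ _ => Prod.swap_swap _)
    · rintro ⟨i, j⟩ -
      have := LinearMap.congr_fun (mulBy_comp_comm (N := N) (stdVec K i) (stdVec K j)) m
      simp only [LinearMap.comp_apply, LinearMap.neg_apply] at this
      simp only [Prod.fst_swap, Prod.snd_swap, this, TensorProduct.tmul_neg]
      rw [mul_left_comm]
      simp
    · rintro ⟨i, j⟩ - h0 h1
      simp only [Prod.swap_prod_mk, Prod.mk.injEq] at h1
      obtain ⟨rfl, -⟩ := h1
      have := LinearMap.congr_fun (mulBy_comp_self (N := N) (stdVec K j)) m
      simp only [LinearMap.comp_apply, LinearMap.zero_apply] at this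
      simp [this] at h0

/-- The factor u allows a homogeneous coordinate vector to be compared with a rescaled one. -/
theorem tautMul_map {R R' : Type*} [CommRing R] [Algebra K R] [CommRing R'] [Algebra K R']
    (φ : R →ₐ[K] R') (c : Fin n → R) (c' : Fin n → R') (u : R') (hc : ∀ j, u * φ (c j) = c' j)
    (z : R ⊗[K] N) :
    tautMul N R' c' (φ.toLinearMap.rTensor N z) = u • φ.toLinearMap.rTensor N (tautMul N R c z) := by
  induction z with
  | zero => simp
  | add x y hx hy => simp only [map_add, smul_add, hx, hy]
  | tmul r m =>
    simp only [LinearMap.rTensor_tmul, AlgHom.toLinearMap_apply, tautMul_tmul, map_sum,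
      Finset.smul_sum, TensorProduct.smul_tmul', smul_eq_mul, map_mul, ← hc, mul_assoc]

end TautMul

/-! ### The free resolution of the stalk -/

section StalkResolution

variable {K : Type u} [Field K] {n : ℕ}
  {N : Type v} [AddCommGroup N] [Module K N] 
  {F : Type u} [AddCommGroup F] [Module K F] [Module (S K n) F] [IsScalarTower K (S K n) F]
  {ℱ : ℤ → Submodule K F} (hF : IsGradedModule (gradS K n) ℱ) (p : P K n)

variable (N) in
/-- The map `S ⊗ N → S_p ⊗ N`. -/
def toLocT : S K n ⊗[K] N →ₗ[K] locRing p ⊗[K] N :=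
  (IsScalarTower.toAlgHom K (S K n) (locRing p)).toLinearMap.rTensor N

variable (N) in
/-- The map `𝒪_{P,p} ⊗ N → S_p ⊗ N`. -/
def valT : localRing p ⊗[K] N →ₗ[K] locRing p ⊗[K] N :=
  (IsScalarTower.toAlgHom K (localRing p) (locRing p)).toLinearMap.rTensor N

theorem toLocT_tmul (s : S K n) (m : N) :
    toLocT N p (s ⊗ₜ m) = algebraMap (S K n) (locRing p) s ⊗ₜ m := rfl

theorem valT_tmul (s : localRing p) (m : N) :
    valT N p (s ⊗ₜ m) = algebraMap (localRing p) (locRing p) s ⊗ₜ m := rfl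

theorem toLocT_injective : Function.Injective (toLocT N p) :=
  Module.Flat.rTensor_preserves_injective_linearMap _ (algebraMap_locRing_injective p)

theorem valT_injective : Function.Injective (valT N p) :=
  Module.Flat.rTensor_preserves_injective_linearMap _ (HomogeneousLocalization.val_injective _)

theorem toLocT_smul (s : S K n) (z : S K n ⊗[K] N) :
    toLocT N p (s • z) = algebraMap (S K n) (locRing p) s • toLocT N p z := by
  induction z with
  | zero => simp
  | add x y hx hy => simp only [map_add, smul_add, hx, hy]
  | tmul r m => simp only [TensorProduct.smul_tmul', toLocT_tmul, smul_eq_mul, map_mul]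

theorem compT_smul {a b : ℕ} {s : S K n} (hs : s ∈ gradS K n b) (z : S K n ⊗[K] N) :
    compT N (b + a) (s • z) = s • compT N a z := by
  induction z with
  | zero => simp
  | add x y hx hy => simp only [map_add, smul_add, hx, hy]
  | tmul r m =>
    simp only [TensorProduct.smul_tmul', compT_tmul, smul_eq_mul]
    congr 1
    have h := DirectSum.coe_decompose_mul_add_of_left_mem (gradS K n) hs (b := r) (j := a)
    have h' : ∀ (f : S K n) (i : ℕ), (DirectSum.decompose (gradS K n) f i : S K n) =
        MvPolynomial.homogeneousComponent i f := MvPolynomial.decomposition.decompose'_apply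
    rwa [h', h'] at h

/-- A common denominator is cleared; numerator and denominator keep the same degree, which is what
makes the fraction one of degree 0. -/
theorem exists_smul_valT (z : localRing p ⊗[K] N) : ∃ (a : ℕ) (f : S K n ⊗[K] N) (t : S K n),
    t ∈ gradS K n a ∧ t ∉ p.asHomogeneousIdeal.toIdeal ∧ compT N a f = f ∧
      algebraMap (S K n) (locRing p) t • valT N p z = toLocT N p f := by
  induction z with
  | zero =>
    exact ⟨0, 0, 1, MvPolynomial.isHomogeneous_one _ _,
      (Ideal.ne_top_iff_one _).mp p.isPrime.ne_top, by simp, by simp⟩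
  | add x y hx hy =>
    obtain ⟨a, f, t, ht, htp, hf, h⟩ := hx
    obtain ⟨a', f', t', ht', htp', hf', h'⟩ := hy
    refine ⟨a + a', t' • f + t • f', t * t', SetLike.mul_mem_graded ht ht',
      fun hm => (p.isPrime.mem_or_mem hm).elim htp htp', ?_, ?_⟩
    · rw [map_add, compT_smul ht, hf', add_comm a, compT_smul ht', hf]
    · rw [map_add, map_add (toLocT N p), toLocT_smul, toLocT_smul, ← h, ← h', smul_add, map_mul, mul_smul, mul_smul,
        smul_comm]
  | tmul c m =>
    obtain ⟨a, f, s, hf, hs, h, rfl⟩ := exists_frac p c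
    refine ⟨a, f ⊗ₜ m, s, hs, h, ?_, ?_⟩
    · rw [compT_tmul, MvPolynomial.homogeneousComponent_eq_self hf]
    · rw [valT_tmul, toLocT_tmul, TensorProduct.smul_tmul', smul_eq_mul, mul_val_frac]

theorem exists_valT_eq {a : ℕ} {t : S K n} (ht : t ∈ gradS K n a)
    (htp : t ∉ p.asHomogeneousIdeal.toIdeal) (f : S K n ⊗[K] N) :
    ∃ z, algebraMap (S K n) (locRing p) t • valT N p z = toLocT N p (compT N a f) := by
  induction f with
  | zero => exact ⟨0, by simp⟩
  | add x y hx hy =>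
    obtain ⟨z, hz⟩ := hx
    obtain ⟨z', hz'⟩ := hy
    exact ⟨z + z', by simp only [map_add, smul_add, hz, hz']⟩
  | tmul s m =>
    refine ⟨frac p (MvPolynomial.homogeneousComponent_mem a s) ht htp ⊗ₜ m, ?_⟩
    rw [valT_tmul, compT_tmul, toLocT_tmul, TensorProduct.smul_tmul', smul_eq_mul, mul_val_frac]

/-- The map `m ↦ η(m)(1) / 1`. -/
def evalLoc (η : N →ₗ[K] (E K n →ₗ[K] ℱ 0)) : N →ₗ[K] locModule F p :=
  (LocalizedModule.mkLinearMap p.asHomogeneousIdeal.toIdeal.primeCompl F).restrictScalars K ∘ₗ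
    (ℱ 0).subtype ∘ₗ LinearMap.applyₗ (1 : E K n) ∘ₗ η

/-- The augmentation `𝒪_{P,p} ⊗ N → F_p`. -/
def augLoc (η : N →ₗ[K] (E K n →ₗ[K] ℱ 0)) : localRing p ⊗[K] N →ₗ[localRing p] locModule F p :=
  (evalLoc p η).liftBaseChange (localRing p)

/-- The two augmentations, from S ⊗ N and from 𝒪_{P,p} ⊗ N, both factor through S_p ⊗ N → F_p, where
they can be compared. -/
theorem smul_augLoc (η : N →ₗ[K] (E K n →ₗ[K] ℱ 0)) {z : localRing p ⊗[K] N}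
    {f : S K n ⊗[K] N} {t : S K n}
    (h : algebraMap (S K n) (locRing p) t • valT N p z = toLocT N p f) :
    t • augLoc p η z = LocalizedModule.mk (augN η f) 1 := by
  let ψ : locRing p ⊗[K] N →ₗ[locRing p] locModule F p := (evalLoc p η).liftBaseChange (locRing p)
  have h1 : ∀ z, ψ (valT N p z) = augLoc p η z := by
    intro z
    induction z with
    | zero => simp
    | add x y hx hy => simp only [map_add, hx, hy]
    | tmul c m =>
      simp only [valT_tmul, ψ, augLoc, LinearMap.liftBaseChange_tmul]
      rfl
  have h2 : ∀ f, ψ (toLocT N p f) = LocalizedModule.mk (augN η f) 1 := by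
    intro f
    induction f with
    | zero => simp
    | add x y hx hy => simp only [map_add, hx, hy, LocalizedModule.mk_add_mk, one_smul, mul_one]
    | tmul s m =>
      simp only [toLocT_tmul, ψ, LinearMap.liftBaseChange_tmul, augN_tmul, algebraMap_smul]
      exact (LocalizedModule.smul'_mk _ _ _)
  rw [← h1, ← h2, ← h, map_smul, algebraMap_smul]

omit [Module K F] [IsScalarTower K (S K n) F] in
theorem eq_mk_of_smul_eq {t : S K n} (htp : t ∉ p.asHomogeneousIdeal.toIdeal) {w : locModule F p}
    {f : F} (h : t • w = LocalizedModule.mk f 1) : w = LocalizedModule.mk f ⟨t, htp⟩ := by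
  have hu := isUnit_algebraMap p htp
  rw [← algebraMap_smul (locRing p) t w] at h
  apply (IsUnit.smul_left_cancel hu).mp
  rw [h, algebraMap_smul, LocalizedModule.smul'_mk]
  exact (LocalizedModule.mk_cancel (⟨t, htp⟩ : p.asHomogeneousIdeal.toIdeal.primeCompl) f).symm

include hF

theorem gradedProj_augN (η : N →ₗ[K] (E K n →ₗ[K] ℱ 0)) (z : S K n ⊗[K] N) (a : ℕ) :
    (gradedProj hF.isInternal a (augN η z) : F) = augN η (compT N a z) := by
  obtain ⟨M, hM⟩ := exists_sum_compT z
  have h1 := hM (max M (a + 1)) (le_max_left _ _)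
  conv_lhs => rw [← h1]
  rw [map_sum, map_sum, Finset.sum_eq_single a]
  · exact gradedProj_of_mem hF.isInternal (augN_compT_mem hF a z)
  · intro b _ hb
    exact gradedProj_of_mem_ne _ (augN_compT_mem hF b z) (by exact_mod_cast hb)
  · intro h
    simp at h

omit [IsScalarTower K (S K n) F] in
theorem gradedProj_smul {a b : ℕ} {w : F} (hw : w ∈ ℱ a) (s : S K n) :
    (gradedProj hF.isInternal ((a : ℤ) + b) (s • w) : F) =
      MvPolynomial.homogeneousComponent b s • w := by
  have hmem : ∀ b : ℕ, MvPolynomial.homogeneousComponent b s • w ∈ ℱ ((a : ℤ) + b) := fun b =>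
    hF.smul_mem (MvPolynomial.homogeneousComponent_mem b s) hw
  have h1 : ∑ i ∈ Finset.range (max (s.totalDegree + 1) (b + 1)),
      MvPolynomial.homogeneousComponent i s = s := by
    refine Eq.trans ?_ (MvPolynomial.sum_homogeneousComponent s)
    symm
    refine Finset.sum_subset (Finset.range_mono (le_max_left _ _)) fun a _ ha => ?_
    apply MvPolynomial.homogeneousComponent_eq_zero
    simp only [Finset.mem_range, not_lt] at ha
    omega
  conv_lhs => rw [← h1]
  rw [Finset.sum_smul, map_sum, Finset.sum_eq_single b]
  · exact gradedProj_of_mem hF.isInternal (hmem b)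
  · intro i _ hi
    exact gradedProj_of_mem_ne _ (hmem i) (by simpa using hi)
  · intro h
    simp at h

omit [IsScalarTower K (S K n) F] in
-- Some homogeneous component of s lies outside p, and as w is homogeneous, each component of s
-- kills w by itself.
theorem exists_homogeneous_smul_eq_zero {a : ℕ} {w : F} (hw : w ∈ ℱ a) {s : S K n}
    (hs : s ∉ p.asHomogeneousIdeal.toIdeal) (h : s • w = 0) :
    ∃ (b : ℕ) (t : S K n), t ∈ gradS K n b ∧ t ∉ p.asHomogeneousIdeal.toIdeal ∧ t • w = 0 := by
  obtain ⟨b, hb⟩ : ∃ b, MvPolynomial.homogeneousComponent b s ∉ p.asHomogeneousIdeal.toIdeal := by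
    by_contra! hb
    apply hs
    rw [← MvPolynomial.sum_homogeneousComponent s]
    exact sum_mem fun i _ => hb i
  refine ⟨b, _, MvPolynomial.homogeneousComponent_mem b s, hb, ?_⟩
  rw [← gradedProj_smul hF hw, h, map_zero]
  rfl

theorem augLoc_mem_stalk (η : N →ₗ[K] (E K n →ₗ[K] ℱ 0)) (z : localRing p ⊗[K] N) :
    augLoc p η z ∈ stalk hF p := by
  obtain ⟨a, f, t, ht, htp, hf, h⟩ := exists_smul_valT p z
  refine ⟨a, augN η f, ⟨t, htp⟩, ?_, ht, eq_mk_of_smul_eq p htp (smul_augLoc p η h)⟩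
  rw [← hf]
  exact augN_compT_mem hF a f

/-- A preimage of the numerator need not be homogeneous; its component in the degree of the
denominator does the job. -/
theorem exists_augLoc_eq {η : N →ₗ[K] (E K n →ₗ[K] ℱ 0)} (hsurj : Function.Surjective (augN η))
    {w : locModule F p} (hw : w ∈ stalk hF p) : ∃ z, augLoc p η z = w := by
  obtain ⟨a, f, s, hf, hs, rfl⟩ := hw
  obtain ⟨y, rfl⟩ := hsurj f
  obtain ⟨z, hz⟩ := exists_valT_eq p hs s.2 y
  refine ⟨z, ?_⟩
  rw [eq_mk_of_smul_eq p s.2 (smul_augLoc p η hz), ← gradedProj_augN hF,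
    gradedProj_of_mem _ hf]

end StalkResolution

/-! ### Exactness of the localized linear resolution -/

section StalkExact

variable {K : Type u} [Field K] {n : ℕ}
  {N : Type v} [AddCommGroup N] [Module K N] [Module (E K n) N] [IsScalarTower K (E K n) N]
  {F : Type u} [AddCommGroup F] [Module K F] [Module (S K n) F] [IsScalarTower K (S K n) F]
  {ℱ : ℤ → Submodule K F} (hF : IsGradedModule (gradS K n) ℱ) (p : P K n)

theorem tautMul_toLocT (z : S K n ⊗[K] N) :
    tautMul N (locRing p) (fun j => algebraMap (S K n) (locRing p) (MvPolynomial.X j))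
      (toLocT N p z) = toLocT N p (dN K n N z) := by
  induction z with
  | zero => simp
  | add x y hx hy => simp only [map_add, hx, hy]
  | tmul s m => simp [toLocT_tmul, dN, dT_tmul, tautMul_tmul]

theorem tautMul_valT (z : localRing p ⊗[K] N) :
    tautMul N (locRing p) (fun j => algebraMap (S K n) (locRing p) (MvPolynomial.X j))
      (valT N p z) = algebraMap (S K n) (locRing p) (MvPolynomial.X (idx p)) •
        valT N p (tautMul N (localRing p) (coord p) z) :=
  tautMul_map (IsScalarTower.toAlgHom K (localRing p) (locRing p)) (coord p) _ _
    (fun _ => mul_val_frac p _ _ _) z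

variable {η : N →ₗ[K] (E K n →ₗ[K] ℱ 0)}
  (hη : ∀ (a : E K n) (m : N) (b : E K n), η (a • m) b = η m (b * a))
include hη

theorem augLoc_tautMul (hker : LinearMap.range η = LinearMap.ker (dR hF 0))
    (z : localRing p ⊗[K] N) : augLoc p η (tautMul N (localRing p) (coord p) z) = 0 := by
  obtain ⟨a, f, t, ht, htp, hf, h⟩ := exists_smul_valT p z
  have h1 : algebraMap (S K n) (locRing p) (MvPolynomial.X (idx p) * t) •
      valT N p (tautMul N (localRing p) (coord p) z) = toLocT N p (dN K n N f) := by
    rw [← tautMul_toLocT, ← h, map_smul, tautMul_valT, map_mul, mul_smul, smul_comm]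
  have h2 := smul_augLoc p η h1
  rw [augN_dN hF hη hker, LocalizedModule.zero_mk] at h2
  have hu := isUnit_algebraMap p (s := MvPolynomial.X (idx p) * t)
    (fun hm => (p.isPrime.mem_or_mem hm).elim (X_idx_notMem p) htp)
  rw [← algebraMap_smul (locRing p)] at h2
  exact (IsUnit.smul_eq_zero hu).mp h2

/-- Clearing denominators gives a cycle f over S whose augmentation is killed by a homogeneous w
outside p. Then w f is a boundary over S, and one divides by w again. -/
theorem exists_tautMul_eq (hinj : Function.Injective η)
    (hker : LinearMap.range η = LinearMap.ker (dR hF 0))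
    (hex : ∀ i : ℤ, 0 ≤ i → LinearMap.range (dR hF i) = LinearMap.ker (dR hF (i + 1)))
    {z : localRing p ⊗[K] N} (hz : tautMul N (localRing p) (coord p) z = 0)
    (haug : augLoc p η z = 0) : ∃ y, tautMul N (localRing p) (coord p) y = z := by
  obtain ⟨a, f, t, ht, htp, hf, h⟩ := exists_smul_valT p z
  have hdf : dN K n N f = 0 := by
    apply toLocT_injective p
    rw [← tautMul_toLocT, ← h, map_smul, tautMul_valT, hz]
    simp
  have h0 := smul_augLoc p η h
  rw [haug, smul_zero, ← LocalizedModule.zero_mk 1, LocalizedModule.mk_eq] at h0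
  obtain ⟨⟨s, hs⟩, hsf⟩ := h0
  replace hsf : s • augN η f = 0 := by simpa [Submonoid.smul_def] using hsf.symm
  obtain ⟨b, w, hw, hwp, hwf⟩ := exists_homogeneous_smul_eq_zero hF p
    (by rw [← hf]; exact augN_compT_mem hF a f) hs hsf
  have hsm : ∀ (s : S K n) (z : S K n ⊗[K] N), augN η (s • z) = s • augN η z := by
    intro s z
    induction z with
    | zero => simp
    | add x y hx hy => simp only [smul_add, map_add, hx, hy]
    | tmul t m => rw [TensorProduct.smul_tmul', augN_tmul, augN_tmul, smul_eq_mul, mul_smul]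
  have hdsm : ∀ (s : S K n) (z : S K n ⊗[K] N), dN K n N (s • z) = s • dN K n N z := by
    intro s z
    induction z with
    | zero => simp
    | add x y hx hy => simp only [smul_add, map_add, hx, hy]
    | tmul t m =>
      simp only [TensorProduct.smul_tmul', dN, dT_tmul, smul_eq_mul, Finset.smul_sum,
        mul_left_comm s]
  obtain ⟨g, hg⟩ := exists_dN_eq hF hη hinj hker hex (z := w • f) (by rw [hdsm, hdf, smul_zero])
    (by rw [hsm, hwf])
  -- The relevant part of g has degree one less than w f. The factor x raises it to the degree of
  -- the denominator w t, and is absorbed by the unit in `tautMul_valT`.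
  set x : S K n := MvPolynomial.X (idx p) with hx
  obtain ⟨y, hy⟩ := exists_valT_eq p (SetLike.mul_mem_graded hw ht)
    (fun hm => (p.isPrime.mem_or_mem hm).elim hwp htp) (x • g)
  refine ⟨y, valT_injective p ?_⟩
  have hcomp : dN K n N (compT N (b + a) (x • g)) = x • (w • f) := by
    rw [dN, ← compT_dT, ← dN, hdsm, hg, add_comm, compT_smul (MvPolynomial.isHomogeneous_X K _),
      compT_smul hw, hf]
  have hu1 := isUnit_algebraMap p (X_idx_notMem p)
  have hu2 := isUnit_algebraMap p (s := w * t)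
    (fun hm => (p.isPrime.mem_or_mem hm).elim hwp htp)
  apply (IsUnit.smul_left_cancel hu1).mp
  rw [← tautMul_valT]
  apply (IsUnit.smul_left_cancel hu2).mp
  rw [← map_smul, hy, tautMul_toLocT, hcomp, toLocT_smul, toLocT_smul, ← h, map_mul, mul_smul,
    smul_comm]
  exact congrArg _ (smul_comm _ _ _)

end StalkExact

/-! ### Finiteness of the exterior algebra -/

section Finite

variable {K : Type u} [Field K] {n : ℕ}

/-- The span of the products of subfamilies of a list of vectors. -/
def prodSpan : List (V K n) → Submodule K (E K n)
  | [] => Submodule.span K {1}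
  | v :: l => prodSpan l ⊔ (prodSpan l).map (LinearMap.mulLeft K (ExteriorAlgebra.ι K v))

theorem prodSpan_fg (l : List (V K n)) : (prodSpan l).FG := by
  induction l with
  | nil => exact Submodule.fg_span_singleton _
  | cons v l ih => exact ih.sup (ih.map _)

theorem one_mem_prodSpan (l : List (V K n)) : 1 ∈ prodSpan l := by
  induction l with
  | nil => exact Submodule.mem_span_singleton_self _
  | cons v l ih => exact Submodule.mem_sup_left ih

/-- A vector equal to the head of the list squares to zero; a vector of the tail is moved past the
head by anticommutativity. -/
theorem ι_mul_mem_prodSpan {l : List (V K n)} {w : V K n} (hw : w ∈ l) {b : E K n}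
    (hb : b ∈ prodSpan l) : ExteriorAlgebra.ι K w * b ∈ prodSpan l := by
  induction l generalizing w b with
  | nil => simp at hw
  | cons v l ih =>
    obtain ⟨x, hx, y, hy, rfl⟩ := Submodule.mem_sup.mp hb
    obtain ⟨y, hy, rfl⟩ := hy
    rw [mul_add]
    rcases List.mem_cons.mp hw with rfl | hw
    · refine add_mem (Submodule.mem_sup_right ⟨x, hx, rfl⟩) ?_
      simp [← mul_assoc]
    · refine add_mem (Submodule.mem_sup_left (ih hw hx)) (Submodule.mem_sup_right ?_)
      refine ⟨-(ExteriorAlgebra.ι K w * y), neg_mem (ih hw hy), ?_⟩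
      rw [LinearMap.mulLeft_apply, LinearMap.mulLeft_apply, ← mul_assoc, mul_neg, ← mul_assoc,
        eq_neg_of_add_eq_zero_left (ExteriorAlgebra.ι_add_mul_swap v w), neg_mul, neg_neg]

/-- Needed to pass from finite generation over E to finite dimension over K. -/
instance instFiniteE : Module.Finite K (E K n) := by
  let l : List (V K n) := (List.finRange n).map fun j => stdVec K j
  have htop : prodSpan l = ⊤ := by
    rw [eq_top_iff]
    rintro b -
    induction b using CliffordAlgebra.left_induction with
    | algebraMap r =>
      rw [Algebra.algebraMap_eq_smul_one]
      exact Submodule.smul_mem _ _ (one_mem_prodSpan l)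
    | add x y hx hy => exact add_mem hx hy
    | ι_mul x v hx =>
      change ExteriorAlgebra.ι K v * x ∈ _
      have hv : v = ∑ j, v j • stdVec K j := pi_eq_sum_univ' v
      rw [hv, map_sum, Finset.sum_mul]
      refine sum_mem fun j _ => ?_
      rw [map_smul, smul_mul_assoc]
      exact Submodule.smul_mem _ _ (ι_mul_mem_prodSpan
        (List.mem_map_of_mem (List.mem_finRange j)) hx)
  exact ⟨htop ▸ prodSpan_fg l⟩

end Finite

/-! ### The graded components as coordinate spaces -/

section Components

variable {K : Type u} [Field K] {N : Type v} [AddCommGroup N] [Module K N]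

/-- A coordinate space of the dimension of the component of degree `i`. -/
abbrev G (𝒩 : ℤ → Submodule K N) (i : ℤ) : Type u := Fin (Module.finrank K (𝒩 i)) → K

variable [Module.Finite K N] (𝒩 : ℤ → Submodule K N)

/-- An isomorphism of the coordinate space with the component of degree `i`. -/
def gEquiv (i : ℤ) : G 𝒩 i ≃ₗ[K] 𝒩 i := (Module.finBasis K (𝒩 i)).equivFun.symm

/-- The inclusion of the component of degree `i`. -/
def gIncl (i : ℤ) : G 𝒩 i →ₗ[K] N := (𝒩 i).subtype ∘ₗ (gEquiv 𝒩 i).toLinearMap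

theorem gIncl_mem (i : ℤ) (x : G 𝒩 i) : gIncl 𝒩 i x ∈ 𝒩 i := (gEquiv 𝒩 i x).2

theorem range_gIncl (i : ℤ) : LinearMap.range (gIncl 𝒩 i) = 𝒩 i := by
  rw [gIncl, LinearMap.range_comp, LinearEquiv.range, Submodule.map_top, Submodule.range_subtype]

variable {𝒩}

/-- The projection onto the component of degree `i`. -/
def gProj (h : DirectSum.IsInternal 𝒩) (i : ℤ) : N →ₗ[K] G 𝒩 i :=
  (gEquiv 𝒩 i).symm.toLinearMap ∘ₗ gradedProj h i

theorem gProj_comp_gIncl (h : DirectSum.IsInternal 𝒩) (i : ℤ) :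
    gProj h i ∘ₗ gIncl 𝒩 i = LinearMap.id := by
  apply LinearMap.ext
  intro x
  simp [gProj, gIncl, gradedProj_coe]

theorem gIncl_gProj (h : DirectSum.IsInternal 𝒩) (i : ℤ) (m : N) :
    gIncl 𝒩 i (gProj h i m) = gradedProj h i m := by
  simp [gProj, gIncl]

end Components

/-! ### Graded components of multiplication by a vector, and their base change -/

section GradedMul

variable {K : Type u} [Field K] {n : ℕ} {N : Type v} [AddCommGroup N] [Module K N]
  [Module (E K n) N] [IsScalarTower K (E K n) N]
  {𝒩 : ℤ → Submodule K N} (hN : IsGradedModule (gradE K n) 𝒩)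

theorem ι_mem_gradE (e : V K n) : ExteriorAlgebra.ι K e ∈ gradE K n 1 := by
  change ExteriorAlgebra.ι K e ∈ LinearMap.range (ExteriorAlgebra.ι K) ^ 1
  rw [pow_one]
  exact LinearMap.mem_range_self _ e

include hN in
theorem mulBy_mem (e : V K n) {i : ℤ} {m : N} (hm : m ∈ 𝒩 i) : mulBy N e m ∈ 𝒩 (i + 1) :=
  hN.smul_mem (ι_mem_gradE e) hm

theorem gradedProj_mulBy (e : V K n) (i : ℤ) (m : N) :
    (gradedProj hN.isInternal (i + 1) (mulBy N e m) : N) =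
      mulBy N e (gradedProj hN.isInternal i m) := by
  refine gradedProj_induction hN.isInternal (p := fun m =>
    (gradedProj hN.isInternal (i + 1) (mulBy N e m) : N) =
      mulBy N e (gradedProj hN.isInternal i m)) ?_ ?_ ?_ m
  · simp
  · intro x y hx hy
    simp only [map_add, Submodule.coe_add, hx, hy]
  · intro j m hm
    by_cases hij : j = i
    · subst hij
      rw [gradedProj_of_mem _ (mulBy_mem hN e hm), gradedProj_of_mem _ hm]
    · rw [gradedProj_of_mem_ne _ (mulBy_mem hN e hm) (by simpa using hij),
        gradedProj_of_mem_ne _ hm hij]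
      simp

variable [Module.Finite K N] (R : Type*) [CommRing R] [Algebra K R] (c : Fin n → R)

variable (𝒩) in
/-- The inclusion of the component of degree `i` in `R ⊗ N`. -/
def inclR (i : ℤ) : R ⊗[K] G 𝒩 i →ₗ[R] R ⊗[K] N := (gIncl 𝒩 i).baseChange R

variable {R} in
/-- The projection of `R ⊗ N` onto the component of degree `i`. -/
def projR (h : DirectSum.IsInternal 𝒩) (i : ℤ) : R ⊗[K] N →ₗ[R] R ⊗[K] G 𝒩 i :=
  (gProj h i).baseChange R

variable {R}

theorem projR_inclR (h : DirectSum.IsInternal 𝒩) (i : ℤ) (z : R ⊗[K] G 𝒩 i) :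
    projR h i (inclR 𝒩 R i z) = z := by
  rw [projR, inclR, ← LinearMap.comp_apply, ← LinearMap.baseChange_comp, gProj_comp_gIncl,
    LinearMap.baseChange_id, LinearMap.id_apply]

theorem inclR_injective (h : DirectSum.IsInternal 𝒩) (i : ℤ) :
    Function.Injective (inclR 𝒩 R i) :=
  Function.LeftInverse.injective (projR_inclR h i)

theorem inclR_projR_tautMul (i : ℤ) (z : R ⊗[K] N) :
    inclR 𝒩 R (i + 1) (projR hN.isInternal (i + 1) (tautMul N R c z)) =
      tautMul N R c (inclR 𝒩 R i (projR hN.isInternal i z)) := by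
  induction z with
  | zero => simp
  | add x y hx hy => simp only [map_add, hx, hy]
  | tmul r m =>
    simp only [tautMul_tmul, map_sum, projR, inclR, LinearMap.baseChange_tmul, gIncl_gProj,
      gradedProj_mulBy hN]

/-- The component `R ⊗ N_i → R ⊗ N_j` of multiplication by `∑ c_j ⊗ e_j`. -/
def compMul (h : DirectSum.IsInternal 𝒩) (c : Fin n → R) (i j : ℤ) :
    R ⊗[K] G 𝒩 i →ₗ[R] R ⊗[K] G 𝒩 j :=
  projR h j ∘ₗ tautMul N R c ∘ₗ inclR 𝒩 R i

/-- The relation of the indices is a hypothesis, since indices such as 1 - (k + 1) and 1 - k satisfy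
it only up to a computation. -/
theorem inclR_compMul {i j : ℤ} (hij : i + 1 = j) (z : R ⊗[K] G 𝒩 i) :
    inclR 𝒩 R j (compMul hN.isInternal c i j z) = tautMul N R c (inclR 𝒩 R i z) := by
  subst hij
  rw [compMul, LinearMap.comp_apply, LinearMap.comp_apply, inclR_projR_tautMul hN, projR_inclR]

theorem compMul_projR {i j : ℤ} (hij : i + 1 = j) (z : R ⊗[K] N) :
    compMul hN.isInternal c i j (projR hN.isInternal i z) =
      projR hN.isInternal j (tautMul N R c z) := by
  subst hij
  apply inclR_injective hN.isInternal
  rw [inclR_compMul hN c rfl, inclR_projR_tautMul hN]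

theorem compMul_eq_zero_iff {i j : ℤ} (hij : i + 1 = j) (z : R ⊗[K] G 𝒩 i) :
    compMul hN.isInternal c i j z = 0 ↔ tautMul N R c (inclR 𝒩 R i z) = 0 := by
  rw [← inclR_compMul hN c hij, (injective_iff_map_eq_zero' _).mp (inclR_injective hN.isInternal j)]

/-- Multiplication is homogeneous of degree one, so a preimage of an element of degree j may be
replaced by its component of degree i. -/
theorem mem_range_compMul_iff {i j : ℤ} (hij : i + 1 = j) (z : R ⊗[K] G 𝒩 j) :
    z ∈ LinearMap.range (compMul hN.isInternal c i j) ↔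
      inclR 𝒩 R j z ∈ LinearMap.range (tautMul N R c) := by
  constructor
  · rintro ⟨y, rfl⟩
    exact ⟨inclR 𝒩 R i y, (inclR_compMul hN c hij y).symm⟩
  · rintro ⟨y, hy⟩
    exact ⟨projR hN.isInternal i y, by rw [compMul_projR hN c hij, hy, projR_inclR]⟩

theorem compMul_comp {i j k : ℤ} (hij : i + 1 = j) (hjk : j + 1 = k) (z : R ⊗[K] G 𝒩 i) :
    compMul hN.isInternal c j k (compMul hN.isInternal c i j z) = 0 := by
  rw [compMul_eq_zero_iff hN c hjk, inclR_compMul hN c hij, tautMul_tautMul]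

theorem exact_compMul_iff {i j k : ℤ} (hij : i + 1 = j) (hjk : j + 1 = k) :
    Function.Exact (compMul hN.isInternal c i j) (compMul hN.isInternal c j k) ↔
      ∀ z : R ⊗[K] G 𝒩 j, tautMul N R c (inclR 𝒩 R j z) = 0 →
        inclR 𝒩 R j z ∈ LinearMap.range (tautMul N R c) := by
  simp only [← compMul_eq_zero_iff hN c hjk, ← mem_range_compMul_iff hN c hij]
  refine ⟨fun h z hz => (h z).mp hz, fun h z => ⟨h z, ?_⟩⟩
  rintro ⟨y, rfl⟩
  exact compMul_comp hN c hij hjk y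

theorem range_inclR (i : ℤ) : LinearMap.range (inclR 𝒩 R i) = (𝒩 i).baseChange R := by
  rw [inclR, gIncl, LinearMap.baseChange_comp, LinearMap.range_comp,
    LinearMap.range_eq_top.mpr, Submodule.map_top]
  · rfl
  · exact LinearMap.lTensor_surjective _ (gEquiv 𝒩 i).surjective

theorem homologyPart_eq_bot_iff {L : Type*} [Field L] {M : Type*} [AddCommGroup M] [Module L M]
    (f : M →ₗ[L] M) (A : Submodule L M) :
    homologyPart f A = ⊥ ↔ ∀ m ∈ A, f m = 0 → m ∈ LinearMap.range f := by
  rw [homologyPart, ← LinearMap.le_ker_iff_map, Submodule.ker_mkQ]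
  constructor
  · intro h m hm hf
    exact h (show (⟨m, hf⟩ : LinearMap.ker f) ∈ A.submoduleOf _ from hm)
  · rintro h ⟨m, hf⟩ hm
    exact h m hm hf

variable {L : Type*} [Field L] [Algebra K L]

/-- The homology of the graded vector space `L ⊗ N` in degree `j`, as an exactness condition. -/
theorem homologyPart_tautMul_eq_bot_iff (c : Fin n → L) {i j k : ℤ} (hij : i + 1 = j)
    (hjk : j + 1 = k) :
    homologyPart (tautMul N L c) ((𝒩 j).baseChange L) = ⊥ ↔
      Function.Exact (compMul hN.isInternal c i j) (compMul hN.isInternal c j k) := by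
  rw [homologyPart_eq_bot_iff, exact_compMul_iff hN c hij hjk, ← range_inclR]
  exact ⟨fun h z => h _ ⟨z, rfl⟩, by rintro h _ ⟨z, rfl⟩; exact h z⟩

omit [Module.Finite K N] in
theorem mulByPoint_eq_tautMul (p : P K n) : mulByPoint N p =
    tautMul N (kappa p) fun j => algebraMap (S K n) (kappa p) (MvPolynomial.X j) := rfl

omit [Module.Finite K N] in
theorem mulBy_eq_sum (e : V K n) : mulBy N e = ∑ k, e k • mulBy N (stdVec K k) := by
  ext m
  conv_lhs => rw [pi_eq_sum_univ' e]
  simp [mulBy, stdVec]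

omit [Module.Finite K N] in
theorem lid_tautMul (e : V K n) (z : K ⊗[K] N) :
    TensorProduct.lid K N (tautMul N K e z) = mulBy N e (TensorProduct.lid K N z) := by
  induction z with
  | zero => simp
  | add x y hx hy => simp only [map_add, hx, hy]
  | tmul r m =>
    rw [mulBy_eq_sum e]
    simp only [tautMul_tmul, map_sum, TensorProduct.lid_tmul, map_smul,
      LinearMap.sum_apply, LinearMap.smul_apply, Finset.smul_sum, smul_smul, mul_comm r]

theorem Hdeg_eq_bot_iff (e : V K n) {i j k : ℤ} (hij : i + 1 = j) (hjk : j + 1 = k) :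
    Hdeg 𝒩 e j = ⊥ ↔
      Function.Exact (compMul (R := K) hN.isInternal e i j) (compMul hN.isInternal e j k) := by
  rw [Hdeg, homologyPart_eq_bot_iff, exact_compMul_iff hN e hij hjk]
  have hl : ∀ x : G 𝒩 j, TensorProduct.lid K N (inclR 𝒩 K j (1 ⊗ₜ x)) = gIncl 𝒩 j x := by
    intro x
    simp [inclR]
  have h1 : ∀ z : K ⊗[K] G 𝒩 j, ∃ x, z = 1 ⊗ₜ x := fun z =>
    ⟨TensorProduct.lid K _ z, by
      apply (TensorProduct.lid K _).injective
      simp⟩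
  have h2 : ∀ z : K ⊗[K] N, z ∈ LinearMap.range (tautMul N K e) ↔
      TensorProduct.lid K N z ∈ LinearMap.range (mulBy N e) := by
    intro z
    constructor
    · rintro ⟨y, rfl⟩
      exact ⟨_, (lid_tautMul e y).symm⟩
    · rintro ⟨y, hy⟩
      refine ⟨(TensorProduct.lid K N).symm y, (TensorProduct.lid K N).injective ?_⟩
      rw [lid_tautMul, LinearEquiv.apply_symm_apply, hy]
  have h3 : ∀ z : K ⊗[K] N, tautMul N K e z = 0 ↔ mulBy N e (TensorProduct.lid K N z) = 0 := by
    intro z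
    rw [← lid_tautMul, LinearEquiv.map_eq_zero_iff]
  simp only [h2, h3]
  constructor
  · intro h z hz
    obtain ⟨x, rfl⟩ := h1 z
    rw [hl] at hz ⊢
    exact h _ (gIncl_mem 𝒩 j x) hz
  · intro h m hm hz
    rw [← range_gIncl 𝒩 j] at hm
    obtain ⟨x, rfl⟩ := hm
    have := h (1 ⊗ₜ x)
    rw [hl] at this
    exact this hz

theorem compMul_tmul {R : Type*} [CommRing R] [Algebra K R] (h : DirectSum.IsInternal 𝒩)
    (c : Fin n → R) (i j : ℤ) (r : R) (x : G 𝒩 i) : compMul h c i j (r ⊗ₜ[K] x) =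
      ∑ k, (c k * r) ⊗ₜ[K] gProj h j (mulBy N (stdVec K k) (gIncl 𝒩 i x)) := by
  simp only [compMul, LinearMap.comp_apply, inclR, projR, LinearMap.baseChange_tmul, tautMul_tmul,
    map_sum]

/-- Compatibility of the maps `compMul` with base change. -/
theorem compMul_cancelBaseChange {R R' : Type*} [CommRing R] [Algebra K R] [CommRing R']
    [Algebra K R'] [Algebra R R'] [IsScalarTower K R R'] (h : DirectSum.IsInternal 𝒩)
    (c : Fin n → R) (c' : Fin n → R') {u : R'} (hc : ∀ j, u * algebraMap R R' (c j) = c' j)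
    (i j : ℤ) :
    compMul h c' i j ∘ₗ (AlgebraTensorModule.cancelBaseChange K R R' R' (G 𝒩 i)).toLinearMap =
      (AlgebraTensorModule.cancelBaseChange K R R' R' (G 𝒩 j)).toLinearMap ∘ₗ
        (u • (compMul h c i j).baseChange R') := by
  apply LinearMap.ext
  intro z
  induction z with
  | zero => rw [LinearMap.map_zero, LinearMap.map_zero]
  | add x y hx hy => simp only [map_add, hx, hy]
  | tmul r y =>
    induction y with
    | zero => rw [tmul_zero, LinearMap.map_zero, LinearMap.map_zero]
    | add x y hx hy => simp only [tmul_add, map_add, hx, hy]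
    | tmul s x =>
      simp only [LinearMap.comp_apply, LinearEquiv.coe_coe, LinearMap.smul_apply,
        LinearMap.baseChange_tmul, compMul_tmul, tmul_sum, map_sum, Finset.smul_sum,
        AlgebraTensorModule.cancelBaseChange_tmul, smul_tmul', ← hc, Algebra.smul_def, map_mul]
      refine Finset.sum_congr rfl fun k _ => ?_
      congr 1
      simp only [Algebra.algebraMap_self, RingHom.id_apply]
      ring

theorem exact_smul_iff {L : Type*} [Field L] {A B C : Type*} [AddCommGroup A] [AddCommGroup B]
    [AddCommGroup C] [Module L A] [Module L B] [Module L C] {u : L} (hu : u ≠ 0) (f : A →ₗ[L] B)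
    (g : B →ₗ[L] C) : Function.Exact (u • f) (u • g) ↔ Function.Exact f g := by
  rw [LinearMap.exact_iff, LinearMap.exact_iff, LinearMap.ker_smul _ _ hu,
    LinearMap.range_smul _ _ hu]

/-- Exactness of the complex over an extension field `L` can be tested after base change from a
ring mapping to `L`. -/
theorem exact_baseChange_compMul_iff {R L : Type*} [CommRing R] [Algebra K R] [Field L]
    [Algebra K L] [Algebra R L] [IsScalarTower K R L] (h : DirectSum.IsInternal 𝒩)
    (c : Fin n → R) (c' : Fin n → L) {u : L} (hu : u ≠ 0)
    (hc : ∀ j, u * algebraMap R L (c j) = c' j) (i j k : ℤ) :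
    Function.Exact ((compMul h c i j).baseChange L) ((compMul h c j k).baseChange L) ↔
      Function.Exact (compMul h c' i j) (compMul h c' j k) := by
  rw [← exact_smul_iff hu]
  exact (Function.Exact.iff_of_ladder_linearEquiv (compMul_cancelBaseChange h c c' hc i j)
    (compMul_cancelBaseChange h c c' hc j k)).symm

/-- Exactness of the complex of graded components does not change under field extensions. -/
theorem exact_compMul_iff_of_field {L L' : Type*} [Field L] [Algebra K L] [Field L']
    [Algebra K L'] [Algebra L L'] [IsScalarTower K L L'] (h : DirectSum.IsInternal 𝒩)
    (c : Fin n → L) (c' : Fin n → L') {u : L'} (hu : u ≠ 0)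
    (hc : ∀ j, u * algebraMap L L' (c j) = c' j) (i j k : ℤ) :
    Function.Exact (compMul h c i j) (compMul h c j k) ↔
      Function.Exact (compMul h c' i j) (compMul h c' j k) := by
  rw [← exact_baseChange_compMul_iff h c c' hu hc]
  exact (Module.FaithfullyFlat.lTensor_exact_iff_exact L L' _ _).symm

end GradedMul

/-! ### Projective dimension and resolutions over local rings -/

section ProjDim

variable {R : Type u} [CommRing R]

theorem shortExact_of_exact {A B M : Type u} [AddCommGroup A] [AddCommGroup B] [AddCommGroup M]
    [Module R A] [Module R B] [Module R M] {f : A →ₗ[R] B} {g : B →ₗ[R] M}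
    (hf : Function.Injective f) (h : Function.Exact f g) (hg : Function.Surjective g) :
    (ShortComplex.moduleCatMkOfKerLERange (ModuleCat.ofHom f) (ModuleCat.ofHom g)
      (by rintro _ ⟨x, rfl⟩; exact h.apply_apply_eq_zero x)).ShortExact where
  exact := by
    rw [ShortComplex.moduleCat_exact_iff]
    intro x hx
    exact (h x).mp hx
  mono_f := (ModuleCat.mono_iff_injective _).mpr hf
  epi_g := (ModuleCat.epi_iff_surjective _).mpr hg

variable [IsLocalRing R]

local notation "κ" => IsLocalRing.ResidueField R

variable (R) in
theorem subsingleton_iff_residueField_tensor (M : Type*) [AddCommGroup M] [Module R M]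
    [Module.Finite R M] : Subsingleton (κ ⊗[R] M) ↔ Subsingleton M := by
  exact IsLocalRing.subsingleton_tensorProduct

/-- The first syzygy of a free resolution detects projectivity. -/
theorem exact_residueField_iff_one {A B C M : Type u} [AddCommGroup A] [AddCommGroup B]
    [AddCommGroup C] [AddCommGroup M] [Module R A] [Module R B] [Module R C] [Module R M]
    [Module.Finite R B] [Module.Finite R C] [Module.Free R C]
    {f : A →ₗ[R] B} {g : B →ₗ[R] C} {q : C →ₗ[R] M} (hfg : Function.Exact f g)
    (hgq : Function.Exact g q) (hq : Function.Surjective q) :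
    Function.Exact (f.lTensor κ) (g.lTensor κ) ↔
      HasProjectiveDimensionLT (ModuleCat.of R M) 1 := by
  -- The range of g is the first syzygy of M. By right exactness of the tensor product, the
  -- exactness in question says that κ ⊗ (range g) → κ ⊗ C is injective.
  have hfg' : Function.Exact f g.rangeRestrict := fun x => by
    rw [← hfg x, ← Subtype.coe_inj]; rfl
  have h1 : Function.Exact (f.lTensor κ) (g.rangeRestrict.lTensor κ) :=
    lTensor_exact κ hfg' g.surjective_rangeRestrict
  have h2 : Function.Exact (LinearMap.range g).subtype q := fun x => by
    rw [hgq x]; simp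
  have h3 : ∀ x, g.lTensor κ x =
      (LinearMap.range g).subtype.lTensor κ (g.rangeRestrict.lTensor κ x) := fun x => by
    rw [← LinearMap.lTensor_comp_apply]; rfl
  have h4 : Function.Surjective (g.rangeRestrict.lTensor κ) :=
    LinearMap.lTensor_surjective _ g.surjective_rangeRestrict
  rw [← projective_iff_hasProjectiveDimensionLT_one, ← IsProjective.iff_projective]
  constructor
  · intro h
    have := Module.free_of_lTensor_residueField_injective (LinearMap.range g).subtype q hq h2 (by
      rw [injective_iff_map_eq_zero]
      intro y hy
      obtain ⟨x, rfl⟩ := h4 y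
      rw [← h3] at hy
      exact (h1 x).mpr ((h x).mp hy))
    infer_instance
  · intro hM x
    rw [← h1 x, h3]
    -- If M is projective the syzygy is a direct summand of C, and a retraction survives the tensor
    -- product.
    obtain ⟨r, hr⟩ := Module.projective_lifting_property q LinearMap.id hq
    have h5 := (Function.Exact.split_tfae h2 Subtype.val_injective hq).out 0 1
    obtain ⟨l, hl⟩ := h5.mp ⟨r, hr⟩
    have hinj : Function.Injective ((LinearMap.range g).subtype.lTensor κ) := by
      apply Function.LeftInverse.injective (g := l.lTensor κ)
      intro y
      rw [← LinearMap.lTensor_comp_apply, hl, LinearMap.lTensor_id, LinearMap.id_apply]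
    exact map_eq_zero_iff _ hinj

/-- For a resolution `⋯ → C 1 → C 0 → M → 0` by finite free modules, `Tor_{k+1}(κ, M) = 0` if
and only if the projective dimension of `M` is at most `k`. -/
theorem exact_residueField_iff (k : ℕ) : ∀ {C : ℕ → Type u} [∀ i, AddCommGroup (C i)]
    [∀ i, Module R (C i)] [∀ i, Module.Finite R (C i)] [∀ i, Module.Free R (C i)]
    {M : Type u} [AddCommGroup M] [Module R M] (d : ∀ i, C (i + 1) →ₗ[R] C i) (q : C 0 →ₗ[R] M)
    (_ : ∀ i, Function.Exact (d (i + 1)) (d i)) (_ : Function.Exact (d 0) q)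
    (_ : Function.Surjective q),
    (Function.Exact ((d (k + 1)).lTensor κ) ((d k).lTensor κ) ↔
      HasProjectiveDimensionLT (ModuleCat.of R M) (k + 1)) := by
  induction k with
  | zero =>
    intro C _ _ _ _ M _ _ d q hd hdq hq
    exact exact_residueField_iff_one (hd 0) hdq hq
  | succ k ih =>
    intro C _ _ _ _ M _ _ d q hd hdq hq
    have h1 : Function.Exact (d 1) (d 0).rangeRestrict := fun x => by
      rw [← hd 0 x, ← Subtype.coe_inj]; rfl
    have h2 : Function.Exact (LinearMap.range (d 0)).subtype q := fun x => by
      rw [hdq x]; simp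
    -- Dimension shifting: the truncated complex resolves the first syzygy.
    have := ih (C := fun i => C (i + 1)) (fun i => d (i + 1)) (d 0).rangeRestrict
      (fun i => hd (i + 1)) h1 (d 0).surjective_rangeRestrict
    rw [this]
    have hs := shortExact_of_exact Subtype.val_injective h2 hq
    refine (hs.hasProjectiveDimensionLT_X₃_iff k ?_).symm
    exact ModuleCat.projective_of_free (Module.Free.chooseBasis R (C 0))

omit [IsLocalRing R] in
theorem hasProjectiveDimensionLT_zero_iff (M : Type u) [AddCommGroup M] [Module R M] :
    HasProjectiveDimensionLT (ModuleCat.of R M) 0 ↔ Subsingleton M := by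
  rw [hasProjectiveDimensionLT_zero_iff_isZero, ModuleCat.isZero_iff_subsingleton]

/-- The cokernel of the reduced map is κ ⊗ M, which by Nakayama vanishes only with M. -/
theorem surjective_residueField_iff {A B M : Type u} [AddCommGroup A] [AddCommGroup B]
    [AddCommGroup M] [Module R A] [Module R B] [Module R M] [Module.Finite R B]
    {g : A →ₗ[R] B} {q : B →ₗ[R] M} (hgq : Function.Exact g q) (hq : Function.Surjective q) :
    Function.Surjective (g.lTensor κ) ↔ HasProjectiveDimensionLT (ModuleCat.of R M) 0 := by
  have : Module.Finite R M := Module.Finite.of_surjective q hq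
  rw [hasProjectiveDimensionLT_zero_iff, ← subsingleton_iff_residueField_tensor R]
  have h1 := lTensor_exact κ hgq hq
  have h2 : Function.Surjective (q.lTensor κ) := LinearMap.lTensor_surjective _ hq
  constructor
  · intro h
    refine ⟨fun x y => ?_⟩
    have : ∀ x : κ ⊗[R] M, x = 0 := fun x => by
      obtain ⟨x, rfl⟩ := h2 x
      exact (h1 x).mpr (h x)
    rw [this x, this y]
  · intro h x
    exact (h1 x).mp (Subsingleton.elim _ _)

end ProjDim

/-! ### Homology modulo a regular element -/

section RegularElement

variable {R : Type*} [CommRing R] {D : ℕ → Type*} [∀ i, AddCommGroup (D i)]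
  [∀ i, Module R (D i)] (d : ∀ i, D (i + 1) →ₗ[R] D i)

/-- The homology of `X ⊗ D` vanishes above `r`, is nonzero in index `r`, and is locally nilpotent
there under each of the elements of `I`. -/
structure TopHomology (I : Ideal R) (X : Type*) [AddCommGroup X] [Module R X] (r : ℕ) : Prop where
  exact : ∀ i, r < i → Function.Exact ((d (i + 1)).lTensor X) ((d i).lTensor X)
  not_exact : ∃ z, (d r).lTensor X z = 0 ∧ z ∉ LinearMap.range ((d (r + 1)).lTensor X)
  nilpotent : ∀ b ∈ I, ∀ z, (d r).lTensor X z = 0 → ∃ k : ℕ,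
    b ^ k • z ∈ LinearMap.range ((d (r + 1)).lTensor X)

variable {d}

/-- This is the long exact sequence of 0 → X → X → Y → 0, with the first map multiplication by b. As
the homology of X vanishes above r, the homology of Y in index r + 1 is the b-torsion of that of X
in index r, and local nilpotence makes this torsion nonzero. -/
theorem TopHomology.step [∀ i, Module.Flat R (D i)] (hdd : ∀ i x, d i (d (i + 1) x) = 0)
    {I : Ideal R} {X Y : Type*}
    [AddCommGroup X] [Module R X] [AddCommGroup Y] [Module R Y] {r : ℕ}
    (h : TopHomology d I X r) {b : R} (hb : b ∈ I) (hreg : IsSMulRegular X b) (π : X →ₗ[R] Y)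
    (hπ : Function.Surjective π) (hker : Function.Exact (LinearMap.lsmul R X b) π) :
    TopHomology d I Y (r + 1) := by
  have hπ' : ∀ i, Function.Surjective (π.rTensor (D i)) := fun i =>
    LinearMap.rTensor_surjective _ hπ
  have hlsmul : ∀ i (z : X ⊗[R] D i), (LinearMap.lsmul R X b).rTensor (D i) z = b • z := by
    intro i z
    induction z with
    | zero => simp
    | add x y hx hy => simp only [map_add, smul_add, hx, hy]
    | tmul x y => rfl
  have hreg' : ∀ i (z : X ⊗[R] D i), b • z = 0 → z = 0 := by
    intro i z hz
    rw [← hlsmul] at hz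
    exact (map_eq_zero_iff _ (Module.Flat.rTensor_preserves_injective_linearMap
      (M := D i) (LinearMap.lsmul R X b) hreg)).mp hz
  have hker' : ∀ i (z : X ⊗[R] D i), π.rTensor (D i) z = 0 → ∃ w, b • w = z := by
    intro i z hz
    obtain ⟨w, hw⟩ := (rTensor_exact (D i) hker hπ z).mp hz
    exact ⟨w, by rw [← hlsmul, hw]⟩
  have hπb : ∀ i (z : X ⊗[R] D i), π.rTensor (D i) (b • z) = 0 := fun i z => by
    rw [← hlsmul]
    exact (rTensor_exact (D i) hker hπ).apply_apply_eq_zero z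
  have hcomm : ∀ i (z : X ⊗[R] D (i + 1)), (d i).lTensor Y (π.rTensor _ z) =
      π.rTensor _ ((d i).lTensor X z) := fun i z => by
    rw [← LinearMap.comp_apply, ← LinearMap.comp_apply, LinearMap.lTensor_comp_rTensor,
      LinearMap.rTensor_comp_lTensor]
  have hdX : ∀ (X : Type _) [AddCommGroup X] [Module R X] i (z : X ⊗[R] D (i + 1 + 1)),
      (d i).lTensor X ((d (i + 1)).lTensor X z) = 0 := fun X _ _ i z => by
    rw [← LinearMap.lTensor_comp_apply,
      show d i ∘ₗ d (i + 1) = 0 from LinearMap.ext (hdd i), LinearMap.lTensor_zero,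
      LinearMap.zero_apply]
  have hdY : ∀ i (z : Y ⊗[R] D (i + 1 + 1)),
      (d i).lTensor Y ((d (i + 1)).lTensor Y z) = 0 := fun i z => by
    obtain ⟨z, rfl⟩ := hπ' _ z
    rw [hcomm, hcomm, hdX, map_zero]
  -- The connecting homomorphism: lift, differentiate, divide by b.
  have hlift : ∀ i (z : X ⊗[R] D (i + 1 + 1)),
      (d (i + 1)).lTensor Y (π.rTensor _ z) = 0 →
      ∃ w, b • w = (d (i + 1)).lTensor X z ∧ (d i).lTensor X w = 0 := by
    intro i z hz
    rw [hcomm] at hz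
    obtain ⟨w, hw⟩ := hker' _ _ hz
    refine ⟨w, hw, hreg' _ _ ?_⟩
    rw [← map_smul, hw, hdX]
  refine ⟨fun i hi => ?_, ?_, ?_⟩
  · obtain ⟨i, rfl⟩ : ∃ j, i = j + 1 := ⟨i - 1, by omega⟩
    intro z
    constructor
    · intro hz
      obtain ⟨z, rfl⟩ := hπ' _ z
      obtain ⟨w, hw, hdw⟩ := hlift i z hz
      obtain ⟨v, rfl⟩ := (h.exact i (by omega) w).mp hdw
      have h1 : (d (i + 1)).lTensor X (z - b • v) = 0 := by
        rw [map_sub, map_smul, hw, sub_self]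
      obtain ⟨t, ht⟩ := (h.exact (i + 1) (by omega) _).mp h1
      refine ⟨π.rTensor _ t, ?_⟩
      rw [hcomm, ht, map_sub, hπb, sub_zero]
    · rintro ⟨y, rfl⟩
      exact hdY _ y
  -- The last power b^m z that is not a boundary is a nonzero class killed by b. If w has boundary
  -- b^(m+1) z, then its image in Y is a cycle whose connecting class is that of b^m z.
  · obtain ⟨z, hz, hzr⟩ := h.not_exact
    have hex := h.nilpotent b hb z hz
    classical
    have hk0 : Nat.find hex ≠ 0 := by
      intro h0
      have := Nat.find_spec hex
      rw [h0, pow_zero, one_smul] at this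
      exact hzr this
    obtain ⟨m, hm⟩ := Nat.exists_eq_succ_of_ne_zero hk0
    have hm1 : b ^ m • z ∉ LinearMap.range ((d (r + 1)).lTensor X) :=
      Nat.find_min hex (by omega)
    have hm2 := Nat.find_spec hex
    rw [hm, Nat.succ_eq_add_one, pow_succ', mul_smul] at hm2
    obtain ⟨w, hw⟩ := hm2
    refine ⟨π.rTensor _ w, by rw [hcomm, hw, hπb], ?_⟩
    rintro ⟨y, hy⟩
    obtain ⟨y, rfl⟩ := hπ' _ y
    rw [hcomm, ← sub_eq_zero, ← map_sub] at hy
    obtain ⟨t, ht⟩ := hker' _ _ hy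
    apply hm1
    refine ⟨-t, ?_⟩
    have h1 : b • ((d (r + 1)).lTensor X (-t) - b ^ m • z) = 0 := by
      rw [smul_sub, ← hw, ← map_smul, smul_neg, ht, map_neg, map_sub, hdX]
      abel
    exact sub_eq_zero.mp (hreg' _ _ h1)
  · intro b' hb' z hz
    obtain ⟨z, rfl⟩ := hπ' _ z
    obtain ⟨w, hw, hdw⟩ := hlift r z hz
    obtain ⟨k, v, hv⟩ := h.nilpotent b' hb' w hdw
    refine ⟨k, ?_⟩
    have h1 : (d (r + 1)).lTensor X (b' ^ k • z - b • v) = 0 := by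
      rw [map_sub, map_smul, map_smul, ← hw, hv, smul_comm, sub_self]
    obtain ⟨t, ht⟩ := (h.exact (r + 1) (by omega) _).mp h1
    refine ⟨π.rTensor _ t, ?_⟩
    rw [hcomm, ht, map_sub, hπb, sub_zero, map_smul]

end RegularElement

/-! ### Regular local rings -/

section Regular

open IsLocalRing

/-- `RegularChain R J r`: the ideal `J` is generated by a regular sequence of length `r` of elements
of the maximal ideal. -/
inductive RegularChain (R : Type*) [CommRing R] [IsLocalRing R] : Ideal R → ℕ → Prop
  | bot : RegularChain R ⊥ 0
  | step {J : Ideal R} {r : ℕ} {b : R} (h : RegularChain R J r) (hb : b ∈ maximalIdeal R)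
      (hreg : ∀ x, b * x ∈ J → x ∈ J) : RegularChain R (J ⊔ Ideal.span {b}) (r + 1)

/-- A regular sequence of R/(x) lifts to one of R that begins with x. -/
theorem RegularChain.comap {R : Type*} [CommRing R] [IsLocalRing R] {x : R}
    (hx : x ∈ maximalIdeal R) (hreg : ∀ y, x * y = 0 → y = 0) [IsLocalRing (R ⧸ Ideal.span {x})]
    {J : Ideal (R ⧸ Ideal.span {x})} {r : ℕ} (h : RegularChain (R ⧸ Ideal.span {x}) J r) :
    RegularChain R (J.comap (Ideal.Quotient.mk (Ideal.span {x}))) (r + 1) := by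
  induction h with
  | bot =>
    have : (⊥ : Ideal (R ⧸ Ideal.span {x})).comap (Ideal.Quotient.mk (Ideal.span {x})) =
        ⊥ ⊔ Ideal.span {x} := by
      rw [bot_sup_eq, ← RingHom.ker_eq_comap_bot, Ideal.mk_ker]
    rw [this]
    exact .step .bot hx (by simpa using hreg)
  | step h hb hreg' ih =>
    rename_i J r b
    obtain ⟨b, rfl⟩ := Ideal.Quotient.mk_surjective b
    have hle : RingHom.ker (Ideal.Quotient.mk (Ideal.span {x})) ≤
        J.comap (Ideal.Quotient.mk (Ideal.span {x})) ⊔ Ideal.span {b} :=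
      (Ideal.comap_mono bot_le).trans le_sup_left
    have : (J ⊔ Ideal.span {Ideal.Quotient.mk (Ideal.span {x}) b}).comap
        (Ideal.Quotient.mk (Ideal.span {x})) =
        J.comap (Ideal.Quotient.mk (Ideal.span {x})) ⊔ Ideal.span {b} := by
      have h1 : J ⊔ Ideal.span {Ideal.Quotient.mk (Ideal.span {x}) b} =
          (J.comap (Ideal.Quotient.mk (Ideal.span {x})) ⊔ Ideal.span {b}).map
            (Ideal.Quotient.mk (Ideal.span {x})) := by
        rw [Ideal.map_sup, Ideal.map_comap_of_surjective _ Ideal.Quotient.mk_surjective,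
          Ideal.map_span, Set.image_singleton]
      rw [h1, Ideal.comap_map_of_surjective _ Ideal.Quotient.mk_surjective, sup_eq_left]
      exact hle
    rw [this]
    refine .step ih ?_ fun y hy => hreg' _ ?_
    · rw [mem_maximalIdeal, mem_nonunits_iff] at hb ⊢
      exact fun hu => hb (hu.map _)
    · simpa using hy

/-- The maximal ideal of a regular local ring is generated by a regular sequence. -/
theorem regularChain_maximalIdeal (d : ℕ) : ∀ (R : Type u) [CommRing R] [IsRegularLocalRing R],
    ringKrullDim R = d → IsDomain R ∧ RegularChain R (maximalIdeal R) d := by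
  induction d with
  | zero =>
    intro R _ _ hd
    have h := (isRegularLocalRing_iff R).mp inferInstance
    rw [hd] at h
    have h0 : maximalIdeal R = ⊥ := by
      rw [← Submodule.spanFinrank_eq_zero_iff_eq_bot (maximalIdeal R).fg_of_isNoetherianRing]
      exact_mod_cast h
    refine ⟨(isField_iff_maximalIdeal_eq.mpr h0).isDomain, ?_⟩
    rw [h0]
    exact .bot
  | succ d ih =>
    intro R _ _ hd
    have h := (isRegularLocalRing_iff R).mp inferInstance
    rw [hd] at h
    have h : (maximalIdeal R).spanFinrank = d + 1 := by exact_mod_cast h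
    have hfg := (maximalIdeal R).fg_of_isNoetherianRing
    have hne : maximalIdeal R ≠ ⊥ := by
      rw [Ne, ← Submodule.spanFinrank_eq_zero_iff_eq_bot hfg]
      omega
    -- By prime avoidance, in which 𝔪² is an admissible non-prime exception. Lying outside 𝔪² lowers
    -- the number of generators modulo x; lying outside the minimal primes serves to prove that R is
    -- a domain.
    obtain ⟨x, hx, hx2, hxp⟩ : ∃ x ∈ maximalIdeal R, x ∉ maximalIdeal R ^ 2 ∧
        ∀ p ∈ minimalPrimes R, x ∉ p := by
      by_contra! hcon
      have hsub : (maximalIdeal R : Set R) ⊆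
          ⋃ i ∈ insert (maximalIdeal R ^ 2) (minimalPrimes R), (i : Set R) := by
        intro x hx
        simp only [Set.mem_iUnion]
        by_cases hx2 : x ∈ maximalIdeal R ^ 2
        · exact ⟨_, Set.mem_insert _ _, hx2⟩
        · obtain ⟨p, hp, hxp⟩ := hcon x hx hx2
          exact ⟨p, Set.mem_insert_of_mem _ hp, hxp⟩
      obtain ⟨i, hi, hle⟩ := (Ideal.subset_union_prime_finite
        ((minimalPrimes.finite_of_isNoetherianRing R).insert (maximalIdeal R ^ 2)) (f := id)
        (maximalIdeal R ^ 2) (maximalIdeal R ^ 2) (fun i hi h1 _ =>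
          ((Set.mem_insert_iff.mp hi).resolve_left h1).1.1)).mp hsub
      rcases Set.mem_insert_iff.mp hi with rfl | hi
      · apply hne
        refine Submodule.eq_bot_of_le_smul_of_le_jacobson_bot (maximalIdeal R) _ hfg ?_
          (maximalIdeal_le_jacobson _)
        rw [smul_eq_mul, ← sq]
        exact hle
      · have : i = maximalIdeal R :=
          le_antisymm (le_maximalIdeal hi.1.1.ne_top) hle
        rw [this] at hi
        have h0 : (maximalIdeal R).height = 0 := by
          rwa [Ideal.height_eq_zero_iff]
        have := maximalIdeal_height_eq_ringKrullDim (R := R)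
        rw [h0, hd] at this
        have h2 : ((0 : ℕ) : WithBot ℕ∞) = ((d + 1 : ℕ) : WithBot ℕ∞) := this
        have := Nat.cast_injective h2
        omega
    obtain ⟨s, hs, hspan⟩ := Submodule.FG.exists_span_finset_card_eq_spanFinrank hfg
    have hle : Ideal.span {x} ≤ maximalIdeal R := by simpa [Ideal.span_le] using hx
    have : Nontrivial (R ⧸ Ideal.span {x}) := Ideal.Quotient.nontrivial_iff.mpr
      fun h => (maximalIdeal.isMaximal R).ne_top (top_le_iff.mp (h ▸ hle))
    have : IsLocalRing (R ⧸ Ideal.span {x}) :=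
      IsLocalRing.of_surjective' (Ideal.Quotient.mk _) Ideal.Quotient.mk_surjective
    have hmap : (maximalIdeal (R ⧸ Ideal.span {x})).comap (Ideal.Quotient.mk (Ideal.span {x})) =
        maximalIdeal R := by
      have := Ideal.comap_isMaximal_of_surjective (Ideal.Quotient.mk (Ideal.span {x}))
        Ideal.Quotient.mk_surjective (K := maximalIdeal (R ⧸ Ideal.span {x}))
      exact eq_maximalIdeal this
    -- As x ∉ 𝔪², some coefficient in its expansion by the generators is a unit, so x can replace
    -- the generator a.
    obtain ⟨a, ha, hrep⟩ : ∃ a ∈ s, a ∈ Ideal.span (insert x ((s : Set R) \ {a})) := by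
      have hxs : x ∈ Submodule.span R (s : Set R) := hspan ▸ hx
      obtain ⟨f, hf⟩ := Submodule.mem_span_finset'.mp hxs
      obtain ⟨a, ha⟩ : ∃ a, f a ∉ maximalIdeal R := by
        by_contra! hcon
        apply hx2
        rw [← hf, sq]
        refine sum_mem fun a _ => Ideal.mul_mem_mul (hcon a) ?_
        rw [← hspan]
        exact Submodule.subset_span a.2
      refine ⟨a, a.2, ?_⟩
      have hu : IsUnit (f a) := by simpa using ha
      classical
      rw [← Ideal.unit_mul_mem_iff_mem _ hu]
      have h1 : f a * (a : R) = x - ∑ b ∈ Finset.univ.erase a, f b • (b : R) := by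
        rw [← hf, ← Finset.add_sum_erase _ _ (Finset.mem_univ a), smul_eq_mul]
        ring
      rw [h1]
      refine sub_mem (Ideal.subset_span (Set.mem_insert _ _)) (sum_mem fun b hb => ?_)
      refine Ideal.mul_mem_left _ _ (Ideal.subset_span (Set.mem_insert_of_mem _ ⟨b.2, ?_⟩))
      intro h
      exact (Finset.mem_erase.mp hb).1 (Subtype.ext h)
    have hgen : maximalIdeal (R ⧸ Ideal.span {x}) = Submodule.span (R ⧸ Ideal.span {x})
        (Ideal.Quotient.mk (Ideal.span {x}) '' ((s : Set R) \ {a})) := by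
      have h1 : maximalIdeal R = Ideal.span (insert x ((s : Set R) \ {a})) := by
        apply le_antisymm
        · rw [← hspan]
          refine Submodule.span_le.mpr fun b hb => ?_
          by_cases hba : b = a
          · rw [hba]; exact hrep
          · exact Ideal.subset_span (Set.mem_insert_of_mem _ ⟨hb, hba⟩)
        · rw [Ideal.span_le]
          rintro b (rfl | hb)
          · exact hx
          · rw [SetLike.mem_coe, ← hspan]
            exact Submodule.subset_span hb.1
      rw [← Ideal.map_comap_of_surjective _ Ideal.Quotient.mk_surjective
        (maximalIdeal (R ⧸ Ideal.span {x})), hmap, h1, Ideal.map_span, Set.image_insert_eq]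
      have : Ideal.Quotient.mk (Ideal.span {x}) x = 0 :=
        Ideal.Quotient.eq_zero_iff_mem.mpr (Ideal.mem_span_singleton_self x)
      rw [this]
      exact Submodule.span_insert_zero
    have hrank : (maximalIdeal (R ⧸ Ideal.span {x})).spanFinrank ≤ d := by
      rw [hgen]
      have hfin : ((s : Set R) \ {a}).Finite := s.finite_toSet.sdiff
      refine (Submodule.spanFinrank_span_le_ncard_of_finite (hfin.image _)).trans
        ((Set.ncard_image_le hfin).trans ?_)
      rw [Set.ncard_sdiff_singleton_of_mem (by exact_mod_cast ha), Set.ncard_coe_finset, hs, h]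
      omega
    have hdim1 := ringKrullDim_le_spanFinrank_maximalIdeal (R := R ⧸ Ideal.span {x})
    have hdim2 : ringKrullDim R ≤ ringKrullDim (R ⧸ Ideal.span {x}) + 1 := by
      rw [← maximalIdeal_height_eq_ringKrullDim]
      exact Ideal.height_le_ringKrullDim_quotient_add_one hx
    -- The dimension of R/(x) is at most its number d of generators, and dividing by one element
    -- lowers the dimension d + 1 by at most one.
    have hdim : ringKrullDim (R ⧸ Ideal.span {x}) = d := by
      have h1 : ringKrullDim (R ⧸ Ideal.span {x}) ≤ d := hdim1.trans (by exact_mod_cast hrank)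
      refine le_antisymm h1 ?_
      rw [hd] at hdim2
      by_contra hlt
      rw [not_le] at hlt
      generalize ringKrullDim (R ⧸ Ideal.span {x}) = D at hlt hdim2
      induction D using WithBot.recBotCoe with
      | bot => exact by simp at hdim2
      | coe D =>
        induction D using ENat.recTopCoe with
        | top => exact absurd hlt (by simp)
        | coe D =>
          have h2 : d + 1 ≤ D + 1 := by exact_mod_cast hdim2
          have h3 : D < d := by exact_mod_cast hlt
          omega
    have hreg : IsRegularLocalRing (R ⧸ Ideal.span {x}) :=
      IsRegularLocalRing.of_spanFinrank_maximalIdeal_le _ (by rw [hdim]; exact_mod_cast hrank)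
    obtain ⟨hdom, hchain⟩ := ih (R ⧸ Ideal.span {x}) hdim
    have hprime : (Ideal.span {x}).IsPrime := (Ideal.Quotient.isDomain_iff_prime _).mp hdom
    -- A minimal prime contained in (x) but not containing x satisfies 𝔭 = x𝔭, so it is zero by
    -- Nakayama.
    have hbot : (⊥ : Ideal R) ∈ minimalPrimes R := by
      obtain ⟨p, hp, hpx⟩ := Ideal.exists_minimalPrimes_le (I := ⊥) (J := Ideal.span {x}) bot_le
      have hp' : p.IsPrime := hp.1.1
      have : p = ⊥ := by
        refine Submodule.eq_bot_of_le_smul_of_le_jacobson_bot (maximalIdeal R) _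
          p.fg_of_isNoetherianRing (fun y hy => ?_) (maximalIdeal_le_jacobson _)
        obtain ⟨z, rfl⟩ := Ideal.mem_span_singleton.mp (hpx hy)
        exact Ideal.mul_mem_mul hx ((hp'.mem_or_mem hy).resolve_left (hxp p hp))
      rw [← this]
      exact hp
    have hdomR : IsDomain R := by
      have := hbot.1.1
      exact IsDomain.of_bot_isPrime R
    have hx0 : x ≠ 0 := fun h0 => hxp ⊥ hbot (h0 ▸ zero_mem _)
    refine ⟨hdomR, ?_⟩
    rw [← hmap]
    exact hchain.comap hx fun y hy => (mul_eq_zero.mp hy).resolve_left hx0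

/-- If all elements of the maximal ideal act locally nilpotently on the nonzero module resolved by
the complex, then the homology of `R ⧸ J ⊗ D` is concentrated in indices up to the length of a
regular sequence generating `J`, and it is nonzero in that index. -/
theorem RegularChain.topHomology {R : Type*} [CommRing R] [IsLocalRing R] {D : ℕ → Type*}
    [∀ i, AddCommGroup (D i)] [∀ i, Module R (D i)] [∀ i, Module.Flat R (D i)]
    {d : ∀ i, D (i + 1) →ₗ[R] D i} (hdd : ∀ i x, d i (d (i + 1) x) = 0)
    (h0 : TopHomology d (maximalIdeal R) (R ⧸ (⊥ : Ideal R)) 0)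
    {J : Ideal R} {r : ℕ} (h : RegularChain R J r) :
    TopHomology d (maximalIdeal R) (R ⧸ J) r := by
  induction h with
  | bot => exact h0
  | step h hb hreg ih =>
    rename_i J r b
    have hsurj : Function.Surjective (Submodule.mapQ J (J ⊔ Ideal.span {b}) LinearMap.id
        (le_sup_left (a := J))) := fun y => by
      obtain ⟨y, rfl⟩ := Submodule.mkQ_surjective _ y
      exact ⟨J.mkQ y, rfl⟩
    refine ih.step hdd hb ?_ _ hsurj ?_
    · rw [isSMulRegular_iff_right_eq_zero_of_smul]
      intro y hy
      obtain ⟨y, rfl⟩ := Submodule.mkQ_surjective _ y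
      rw [← map_smul, Submodule.mkQ_apply, Submodule.Quotient.mk_eq_zero] at hy
      rw [Submodule.mkQ_apply, Submodule.Quotient.mk_eq_zero]
      exact hreg y hy
    · intro y
      obtain ⟨y, rfl⟩ := Submodule.mkQ_surjective _ y
      rw [Submodule.mkQ_apply, Submodule.mapQ_apply, LinearMap.id_apply,
        Submodule.Quotient.mk_eq_zero, Submodule.mem_sup]
      constructor
      · rintro ⟨u, hu, w, hw, rfl⟩
        obtain ⟨w, rfl⟩ := Ideal.mem_span_singleton.mp hw
        refine ⟨J.mkQ w, ?_⟩
        rw [LinearMap.lsmul_apply, ← map_smul, Submodule.mkQ_apply, Submodule.Quotient.eq]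
        simpa using hu
      · rintro ⟨w, hw⟩
        obtain ⟨w, rfl⟩ := Submodule.mkQ_surjective _ w
        rw [LinearMap.lsmul_apply, ← map_smul, Submodule.mkQ_apply, Submodule.Quotient.eq] at hw
        refine ⟨-(b • w - y), neg_mem hw, b * w, Ideal.mul_mem_right _ _
          (Ideal.mem_span_singleton_self b), ?_⟩
        rw [smul_eq_mul]
        ring

end Regular

/-! ### The local ring at a point is a regular local ring -/

section LocalRegular

variable {K : Type u} [Field K] {n : ℕ} (p : P K n)

/-- A homogeneous polynomial of degree `a` evaluated at a multiple `x g` of a vector `g`. -/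
theorem aeval_mul_of_isHomogeneous {A : Type*} [CommRing A] [Algebra K A] {a : ℕ} {f : S K n}
    (hf : f ∈ gradS K n a) (x : A) (g g' : Fin n → A) (hg : ∀ k, g' k = x * g k) :
    MvPolynomial.aeval g' f = x ^ a * MvPolynomial.aeval g f := by
  rw [MvPolynomial.aeval_def, MvPolynomial.aeval_def, MvPolynomial.eval₂_eq',
    MvPolynomial.eval₂_eq', Finset.mul_sum]
  refine Finset.sum_congr rfl fun m hm => ?_
  have hdeg : ∑ i, m i = a := by
    rw [← Finsupp.degree_eq_sum, Finsupp.degree_eq_weight_one]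
    exact (MvPolynomial.mem_homogeneousSubmodule a f).mp hf (MvPolynomial.mem_support_iff.mp hm)
  simp only [hg, mul_pow, Finset.prod_mul_distrib, Finset.prod_pow_eq_pow_sum, hdeg]
  ring

/-- The polynomial ring in the affine coordinates at `p`. -/
abbrev affineRing : Type u := MvPolynomial {k : Fin n // k ≠ idx p} K

/-- The evaluation of the polynomials in the affine coordinates. -/
def affineToLocal : affineRing p →ₐ[K] localRing p := MvPolynomial.aeval fun k => coord p k

/-- Dehomogenization. -/
def dehom : S K n →ₐ[K] affineRing p :=
  MvPolynomial.aeval fun k => if h : k ≠ idx p then MvPolynomial.X ⟨k, h⟩ else 1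

theorem mul_coord (k : Fin n) : algebraMap (S K n) (locRing p) (MvPolynomial.X (idx p)) *
    algebraMap (localRing p) (locRing p) (coord p k) =
      algebraMap (S K n) (locRing p) (MvPolynomial.X k) :=
  mul_val_frac p _ _ _

theorem coord_idx : coord p (idx p) = 1 := by
  apply HomogeneousLocalization.val_injective
  have h := mul_coord p (idx p)
  rw [(isUnit_algebraMap p (X_idx_notMem p)).mul_eq_left] at h
  rw [HomogeneousLocalization.val_one]
  exact h

theorem affineToLocal_dehom (f : S K n) :
    affineToLocal p (dehom p f) = MvPolynomial.aeval (coord p) f := by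
  rw [← AlgHom.comp_apply]
  congr 1
  apply MvPolynomial.algHom_ext
  intro k
  by_cases h : k = idx p
  · simp [dehom, affineToLocal, h, coord_idx]
  · simp [dehom, affineToLocal, h]

/-- The identity f = x_0^a f(x/x_0), with x_0 the chosen coordinate. -/
theorem pow_mul_affineToLocal_dehom {a : ℕ} {f : S K n} (hf : f ∈ gradS K n a) :
    algebraMap (S K n) (locRing p) (MvPolynomial.X (idx p)) ^ a *
      algebraMap (localRing p) (locRing p) (affineToLocal p (dehom p f)) =
        algebraMap (S K n) (locRing p) f := by
  have h := aeval_mul_of_isHomogeneous hf (algebraMap (S K n) (locRing p) (MvPolynomial.X (idx p)))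
    (fun k => algebraMap (localRing p) (locRing p) (coord p k))
    (fun k => algebraMap (S K n) (locRing p) (MvPolynomial.X k)) fun k => (mul_coord p k).symm
  rw [affineToLocal_dehom]
  have h1 : algebraMap (localRing p) (locRing p) (MvPolynomial.aeval (coord p) f) =
      MvPolynomial.aeval (fun k => algebraMap (localRing p) (locRing p) (coord p k)) f :=
    (MvPolynomial.aeval_algebraMap_apply (locRing p) (coord p) f).symm
  have h2 := MvPolynomial.aeval_algebraMap_apply (locRing p) (MvPolynomial.X : Fin n → S K n) f
  rw [MvPolynomial.aeval_X_left_apply] at h2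
  rw [h1, ← h, ← h2]
  rfl

/-- Homogenization; two summands are brought to a common degree by powers of the chosen coordinate.
-/
theorem exists_dehom_eq (g : affineRing p) : ∃ (a : ℕ) (f : S K n), f ∈ gradS K n a ∧
    dehom p f = g := by
  have hX : dehom p (MvPolynomial.X (idx p)) = 1 := by simp [dehom]
  induction g using MvPolynomial.induction_on with
  | C c => exact ⟨0, MvPolynomial.C c, MvPolynomial.isHomogeneous_C _ _, by simp [dehom]⟩
  | add x y hx hy =>
    obtain ⟨a, f, hf, rfl⟩ := hx
    obtain ⟨b, g, hg, rfl⟩ := hy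
    refine ⟨a + b, f * MvPolynomial.X (idx p) ^ b + MvPolynomial.X (idx p) ^ a * g,
      add_mem ?_ ?_, by simp [hX]⟩
    · exact SetLike.mul_mem_graded hf (MvPolynomial.isHomogeneous_X_pow _ _)
    · exact SetLike.mul_mem_graded (MvPolynomial.isHomogeneous_X_pow _ _) hg
  | mul_X x k hx =>
    obtain ⟨a, f, hf, rfl⟩ := hx
    refine ⟨a + 1, f * MvPolynomial.X (k : Fin n), SetLike.mul_mem_graded hf
      (MvPolynomial.isHomogeneous_X K _), ?_⟩
    simp [dehom, k.2]

theorem affineToLocal_injective : Function.Injective (affineToLocal p) := by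
  rw [injective_iff_map_eq_zero]
  intro g hg
  obtain ⟨a, f, hf, rfl⟩ := exists_dehom_eq p g
  have h := pow_mul_affineToLocal_dehom p hf
  rw [hg, map_zero, mul_zero, eq_comm, map_eq_zero_iff _ (algebraMap_locRing_injective p)] at h
  rw [h, map_zero]

theorem isUnit_affineToLocal_dehom {a : ℕ} {f : S K n} (hf : f ∈ gradS K n a)
    (h : f ∉ p.asHomogeneousIdeal.toIdeal) : IsUnit (affineToLocal p (dehom p f)) := by
  rw [← HomogeneousLocalization.isUnit_iff_isUnit_val]
  refine isUnit_of_mul_isUnit_right (x := algebraMap (S K n) (locRing p)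
    (MvPolynomial.X (idx p)) ^ a) ?_
  have := pow_mul_affineToLocal_dehom p hf
  rw [HomogeneousLocalization.algebraMap_apply] at this
  rw [this]
  exact isUnit_algebraMap p h

/-- The local ring is the localization of the polynomial ring in the affine coordinates at the
contraction of its maximal ideal, and polynomial rings over a field have regular localizations. -/
instance instIsRegularLocalRing : IsRegularLocalRing (localRing p) := by
  let _ : Algebra (affineRing p) (localRing p) := (affineToLocal p).toRingHom.toAlgebra
  let q := (IsLocalRing.maximalIdeal (localRing p)).comap (algebraMap (affineRing p) (localRing p))
  have hmap : ∀ g, algebraMap (affineRing p) (localRing p) g = affineToLocal p g := fun _ => rfl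
  have : IsLocalization.AtPrime (localRing p) q := by
    refine ⟨?_, ?_, ?_⟩
    · rintro ⟨y, hy⟩
      by_contra h
      exact hy h
    · intro z
      obtain ⟨a, f, s, hf, hs, h, rfl⟩ := exists_frac p z
      have hu := isUnit_affineToLocal_dehom p hs h
      refine ⟨(dehom p f, ⟨dehom p s, fun h' => ?_⟩), ?_⟩
      · exact (IsLocalRing.mem_maximalIdeal _).mp h' hu
      · apply HomogeneousLocalization.val_injective
        have h1 := pow_mul_affineToLocal_dehom p hf
        have h2 := pow_mul_affineToLocal_dehom p hs
        have h3 := mul_val_frac p hf hs h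
        rw [← h1, ← h2, mul_assoc, (isUnit_algebraMap p (X_idx_notMem p)).pow a |>.mul_right_inj]
          at h3
        rw [HomogeneousLocalization.val_mul, mul_comm]
        exact h3
    · intro x y hxy
      exact ⟨1, by rw [affineToLocal_injective p hxy]⟩
  exact IsRegularLocalRing.of_ringEquiv
    (IsLocalization.algEquiv q.primeCompl (Localization.AtPrime q) (localRing p)).toRingEquiv

end LocalRegular

/-! ### Points and irreducible closed subsets -/

section Points

open AlgebraicGeometry

variable {K : Type u} [Field K] {n : ℕ}

instance instQuasiSoberP : QuasiSober (P K n) :=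
  inferInstanceAs (QuasiSober (Proj (gradS K n)))

/-- The dimension of a stalk is the coheight of the point under specialization; the order
isomorphism of points with irreducible closed subsets makes it the codimension of Z. -/
theorem ringKrullDim_localRing (Z : TopologicalSpace.IrreducibleCloseds (P K n)) (p : P K n)
    (hp : (Z : Set (P K n)) = closure {p}) :
    ringKrullDim (localRing p) = (Order.coheight Z : ℕ∞) := by
  let x : Proj (gradS K n) := p
  have h1 := ringKrullDim_stalk_eq_coheight x
  rw [← Order.coheight_orderIso (irreducibleSetEquivPoints (α := Proj (gradS K n))).symm x] at h1
  have h2 : (irreducibleSetEquivPoints (α := Proj (gradS K n))).symm x = Z := by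
    apply TopologicalSpace.IrreducibleCloseds.ext
    exact hp.symm
  rw [h2] at h1
  rw [← ringKrullDim_eq_of_ringEquiv (Proj.stalkIso (gradS K n) x).commRingCatIsoToRingEquiv]
  exact h1

end Points

/-! ### Residue fields -/

section ResidueFields

variable {K : Type u} [Field K] {n : ℕ} (p : P K n)

instance instIsLocalHomVal : IsLocalHom (algebraMap (localRing p) (locRing p)) where
  map_nonunit a h := (HomogeneousLocalization.isUnit_iff_isUnit_val _ _ a).mp h

/-- The inclusion of residue fields induced by `𝒪_{P,p} → S_p`. -/
instance instAlgebraResidueField :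
    Algebra (IsLocalRing.ResidueField (localRing p)) (kappa p) :=
  (IsLocalRing.ResidueField.map (algebraMap (localRing p) (locRing p))).toAlgebra

theorem algebraMap_residue (a : localRing p) :
    algebraMap (IsLocalRing.ResidueField (localRing p)) (kappa p)
      (algebraMap (localRing p) (IsLocalRing.ResidueField (localRing p)) a) =
        algebraMap (locRing p) (kappa p) (algebraMap (localRing p) (locRing p) a) := rfl

instance instTowerResidueField :
    IsScalarTower K (IsLocalRing.ResidueField (localRing p)) (kappa p) := by
  refine IsScalarTower.of_algebraMap_eq fun c => ?_
  rw [IsScalarTower.algebraMap_apply K (localRing p) (IsLocalRing.ResidueField (localRing p)),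
    algebraMap_residue, ← IsScalarTower.algebraMap_apply K (localRing p) (locRing p),
    ← IsScalarTower.algebraMap_apply K (locRing p) (kappa p)]

theorem algebraMap_kappa_ne_zero {s : S K n} (h : s ∉ p.asHomogeneousIdeal.toIdeal) :
    algebraMap (S K n) (kappa p) s ≠ 0 := by
  rwa [Ne, Ideal.algebraMap_residueField_eq_zero]

theorem X_mul_algebraMap_coord (k : Fin n) :
    algebraMap (S K n) (kappa p) (MvPolynomial.X (idx p)) *
      algebraMap (IsLocalRing.ResidueField (localRing p)) (kappa p)
        (algebraMap (localRing p) (IsLocalRing.ResidueField (localRing p)) (coord p k)) =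
      algebraMap (S K n) (kappa p) (MvPolynomial.X k) := by
  rw [algebraMap_residue, IsScalarTower.algebraMap_apply (S K n) (locRing p) (kappa p),
    IsScalarTower.algebraMap_apply (S K n) (locRing p) (kappa p), ← map_mul, mul_coord]

/-- The forms e_j x_k - e_k x_j vanish at e, so the residues of the variables are proportional to
the entries of e. -/
theorem exists_point_scalar (e : V K n) (he : e ≠ 0) : ∃ t : kappa (point e he), t ≠ 0 ∧
    ∀ k, t * algebraMap K (kappa (point e he)) (e k) =
      algebraMap (S K n) (kappa (point e he)) (MvPolynomial.X k) := by
  obtain ⟨j, hj⟩ : ∃ j, e j ≠ 0 := by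
    by_contra! h
    exact he (funext h)
  have hX : algebraMap (S K n) (kappa (point e he)) (MvPolynomial.X j) ≠ 0 := by
    apply algebraMap_kappa_ne_zero
    intro h
    exact hj (by simpa using Ideal.toIdeal_homogeneousCore_le (gradS K n) _ h)
  have hej : algebraMap K (kappa (point e he)) (e j) ≠ 0 := by simpa using hj
  have hC : ∀ c : K, algebraMap (S K n) (kappa (point e he)) (MvPolynomial.C c) =
      algebraMap K (kappa (point e he)) c := fun c =>
    (IsScalarTower.algebraMap_apply K (S K n) (kappa (point e he)) c).symm
  refine ⟨algebraMap (S K n) _ (MvPolynomial.X j) / algebraMap K _ (e j), div_ne_zero hX hej,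
    fun k => ?_⟩
  have h0 : algebraMap (S K n) (kappa (point e he)) (MvPolynomial.C (e j) * MvPolynomial.X k
      - MvPolynomial.C (e k) * MvPolynomial.X j) = 0 := by
    rw [Ideal.algebraMap_residueField_eq_zero]
    refine Ideal.mem_homogeneousCore_of_homogeneous_of_mem ⟨1, ?_⟩ ?_
    · exact ((MvPolynomial.isHomogeneous_C_mul_X _ _).sub
        (MvPolynomial.isHomogeneous_C_mul_X _ _))
    · simp [RingHom.mem_ker, mul_comm]
  rw [map_sub, map_mul, map_mul, hC, hC, sub_eq_zero] at h0
  field_simp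
  rw [mul_comm, ← h0]

end ResidueFields

/-! ### The complex of free modules with terms `R ⊗ N_{1-k}` -/

section Complex

variable {K : Type u} [Field K] {n : ℕ} {N : Type v} [AddCommGroup N] [Module K N]
  [Module (E K n) N] [IsScalarTower K (E K n) N] [Module.Finite K N]
  {𝒩 : ℤ → Submodule K N}

/-- The terms `R ⊗ N_{1-k}`. -/
abbrev term (𝒩 : ℤ → Submodule K N) (R : Type*) [CommRing R] [Algebra K R] (k : ℕ) : Type _ :=
  R ⊗[K] G 𝒩 (1 - (k : ℤ))

/-- The differential given by multiplication by `∑ c_j ⊗ e_j`. -/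
def diff (h : DirectSum.IsInternal 𝒩) {R : Type*} [CommRing R] [Algebra K R] (c : Fin n → R)
    (k : ℕ) : term 𝒩 R (k + 1) →ₗ[R] term 𝒩 R k :=
  compMul h c (1 - ((k + 1 : ℕ) : ℤ)) (1 - (k : ℤ))

variable (hN : IsGradedModule (gradE K n) 𝒩)

theorem diff_diff {R : Type*} [CommRing R] [Algebra K R] (c : Fin n → R) (k : ℕ)
    (z : term 𝒩 R (k + 1 + 1)) : diff hN.isInternal c k (diff hN.isInternal c (k + 1) z) = 0 :=
  compMul_comp hN c (by push_cast; ring) (by push_cast; ring) z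

/-- Indexing by 1 - k puts R ⊗ N_1, which will be zero, in position 0. The homology in every index i
≥ 0, including i = 0, is then that of two consecutive differentials. -/
theorem HPointDeg_eq_bot_iff (p : P K n) (i : ℕ) : HPointDeg 𝒩 p (-(i : ℤ)) = ⊥ ↔
    Function.Exact
      (diff hN.isInternal (fun j => algebraMap (S K n) (kappa p) (MvPolynomial.X j)) (i + 1))
      (diff hN.isInternal (fun j => algebraMap (S K n) (kappa p) (MvPolynomial.X j)) i) := by
  have : -(i : ℤ) = 1 - ((i + 1 : ℕ) : ℤ) := by push_cast; ring
  rw [this]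
  exact homologyPart_tautMul_eq_bot_iff hN _ (by push_cast; ring) (by push_cast; ring)

/-- The field κ(p) is an extension of the residue field of 𝒪_{P,p}, and the two coordinate vectors
differ by a nonzero factor; neither affects exactness. -/
theorem HPointDeg_eq_bot_iff_residueField (p : P K n) (i : ℕ) : HPointDeg 𝒩 p (-(i : ℤ)) = ⊥ ↔
    Function.Exact
      ((diff hN.isInternal (coord p) (i + 1)).lTensor (IsLocalRing.ResidueField (localRing p)))
      ((diff hN.isInternal (coord p) i).lTensor (IsLocalRing.ResidueField (localRing p))) := by
  rw [HPointDeg_eq_bot_iff hN]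
  refine ((exact_compMul_iff_of_field (L := IsLocalRing.ResidueField (localRing p))
    hN.isInternal (fun j => algebraMap _ _ (coord p j)) _
    (algebraMap_kappa_ne_zero p (X_idx_notMem p)) (X_mul_algebraMap_coord p) _ _ _).symm).trans ?_
  exact (exact_baseChange_compMul_iff hN.isInternal (coord p) _ one_ne_zero
    (fun j => one_mul _) _ _ _).symm

theorem Hdeg_eq_bot_iff_exact (e : V K n) (i : ℕ) : Hdeg 𝒩 e (-(i : ℤ)) = ⊥ ↔
    Function.Exact (diff (R := K) hN.isInternal e (i + 1)) (diff hN.isInternal e i) := by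
  have : -(i : ℤ) = 1 - ((i + 1 : ℕ) : ℤ) := by push_cast; ring
  rw [this]
  exact Hdeg_eq_bot_iff hN e (by push_cast; ring) (by push_cast; ring)

include hN in
theorem Hdeg_eq_bot_iff_HPointDeg (e : V K n) (he : e ≠ 0) (i : ℕ) :
    Hdeg 𝒩 e (-(i : ℤ)) = ⊥ ↔ HPointDeg 𝒩 (point e he) (-(i : ℤ)) = ⊥ := by
  obtain ⟨t, ht, h⟩ := exists_point_scalar e he
  rw [Hdeg_eq_bot_iff_exact hN, HPointDeg_eq_bot_iff hN]
  exact exact_compMul_iff_of_field hN.isInternal _ _ ht h _ _ _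

omit [Module.Finite K N] [Module (E K n) N] [IsScalarTower K (E K n) N] in
theorem homologyPart_bot {L M : Type*} [Field L] [AddCommGroup M] [Module L M] (f : M →ₗ[L] M) :
    homologyPart f ⊥ = ⊥ := by
  rw [homologyPart_eq_bot_iff]
  rintro m hm -
  rw [(Submodule.mem_bot L).mp hm]
  exact zero_mem _

end Complex

/-! ### The resolution of the stalks -/

section Resolution

variable {K : Type u} [Field K] {n : ℕ} {N : Type v} [AddCommGroup N] [Module K N]
  [Module (E K n) N] [IsScalarTower K (E K n) N]
  {𝒩 : ℤ → Submodule K N} (hN : IsGradedModule (gradE K n) 𝒩)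
  {F : Type u} [AddCommGroup F] [Module K F] [Module (S K n) F] [IsScalarTower K (S K n) F]
  {ℱ : ℤ → Submodule K F} (hF : IsGradedModule (gradS K n) ℱ) (p : P K n)
  {η : N →ₗ[K] (E K n →ₗ[K] ℱ 0)}

theorem iSup_gradE : ⨆ d, gradE K n d = ⊤ :=
  (DirectSum.Decomposition.isInternal (gradE K n)).submodule_iSup_eq_top

/-- A module embedded in the coinduced module of a space in degree `0` lives in degrees `≤ 0`. -/
theorem eq_bot_of_pos (hdeg : ∀ (i : ℤ), ∀ m ∈ 𝒩 i, ∀ (d : ℕ), -(d : ℤ) ≠ i →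
      ∀ b ∈ gradE K n d, η m b = 0) (hinj : Function.Injective η) {i : ℤ} (hi : 0 < i) :
    𝒩 i = ⊥ := by
  rw [eq_bot_iff]
  intro m hm
  rw [Submodule.mem_bot]
  apply hinj
  rw [map_zero]
  have : (⊤ : Submodule K (E K n)) ≤ LinearMap.ker (η m) := by
    rw [← iSup_gradE]
    exact iSup_le fun d b hb => hdeg i m hm d (by omega) b hb
  exact LinearMap.ext fun b => this (Submodule.mem_top (x := b))

theorem apply_one_eq_zero (hdeg : ∀ (i : ℤ), ∀ m ∈ 𝒩 i, ∀ (d : ℕ), -(d : ℤ) ≠ i →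
      ∀ b ∈ gradE K n d, η m b = 0) {i : ℤ} (hi : i ≠ 0) {m : N} (hm : m ∈ 𝒩 i) :
    η m 1 = 0 :=
  hdeg i m hm 0 (by simpa using hi.symm) 1 (SetLike.one_mem_graded (gradE K n))

/-- Since 1 has degree 0 in E, the augmentation sees only the component N_0. -/
theorem apply_one_gradedProj (h : DirectSum.IsInternal 𝒩)
    (hdeg : ∀ (i : ℤ), ∀ m ∈ 𝒩 i, ∀ (d : ℕ), -(d : ℤ) ≠ i →
      ∀ b ∈ gradE K n d, η m b = 0) (m : N) :
    η (gradedProj h 0 m : N) 1 = η m 1 := by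
  refine gradedProj_induction h (p := fun m => η (gradedProj h 0 m : N) 1 = η m 1) ?_ ?_ ?_ m
  · simp
  · intro x y hx hy
    simp only [map_add, Submodule.coe_add, LinearMap.add_apply, hx, hy]
  · intro i m hm
    by_cases hi : i = 0
    · subst hi
      rw [gradedProj_of_mem _ hm]
    · rw [gradedProj_of_mem_ne _ hm hi, apply_one_eq_zero hdeg hi hm]
      simp

variable [Module.Finite K N]

/-- The augmentation of the resolution of a stalk. -/
def augStalk (η : N →ₗ[K] (E K n →ₗ[K] ℱ 0)) (j : ℤ) :
    localRing p ⊗[K] G 𝒩 j →ₗ[localRing p] stalk hF p :=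
  (augLoc p η ∘ₗ inclR 𝒩 (localRing p) j).codRestrict (stalk hF p)
    fun _ => augLoc_mem_stalk hF p η _

theorem augStalk_coe (j : ℤ) (z : localRing p ⊗[K] G 𝒩 j) :
    (augStalk hF p η j z : locModule F p) = augLoc p η (inclR 𝒩 (localRing p) j z) := rfl

theorem augLoc_inclR_eq_zero (hdeg : ∀ (i : ℤ), ∀ m ∈ 𝒩 i, ∀ (d : ℕ), -(d : ℤ) ≠ i →
      ∀ b ∈ gradE K n d, η m b = 0) {j : ℤ} (hj : j ≠ 0) (z : localRing p ⊗[K] G 𝒩 j) :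
    augLoc p η (inclR 𝒩 (localRing p) j z) = 0 := by
  induction z with
  | zero => rw [LinearMap.map_zero, LinearMap.map_zero]
  | add x y hx hy => rw [map_add, map_add, hx, hy, add_zero]
  | tmul r x =>
    have := apply_one_eq_zero hdeg hj (gIncl_mem 𝒩 j x)
    simp [inclR, augLoc, evalLoc, this]

theorem augLoc_inclR_projR (h : DirectSum.IsInternal 𝒩)
    (hdeg : ∀ (i : ℤ), ∀ m ∈ 𝒩 i, ∀ (d : ℕ), -(d : ℤ) ≠ i →
      ∀ b ∈ gradE K n d, η m b = 0) (z : localRing p ⊗[K] N) :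
    augLoc p η (inclR 𝒩 (localRing p) 0 (projR h 0 z)) = augLoc p η z := by
  induction z with
  | zero => simp only [LinearMap.map_zero]
  | add x y hx hy => simp only [map_add, hx, hy]
  | tmul r x =>
    have := apply_one_gradedProj h hdeg x
    simp [inclR, projR, augLoc, evalLoc, gIncl_gProj, this]

theorem subsingleton_G {j : ℤ} (hj : 𝒩 j = ⊥) : Subsingleton (G 𝒩 j) := by
  have : Subsingleton (𝒩 j) := by rw [hj]; infer_instance
  exact (gEquiv 𝒩 j).toEquiv.subsingleton

theorem subsingleton_tensor_G {R : Type*} [CommRing R] [Algebra K R] {j : ℤ} (hj : 𝒩 j = ⊥) :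
    Subsingleton (R ⊗[K] G 𝒩 j) := by
  have := subsingleton_G hj
  infer_instance

theorem subsingleton_term_zero (hres : IsInjectiveResolution hF 𝒩) {R : Type*} [CommRing R]
    [Algebra K R] : Subsingleton (term 𝒩 R 0) := by
  obtain ⟨-, ⟨η, -, hdeg, hinj, -⟩, -⟩ := hres
  exact subsingleton_tensor_G (eq_bot_of_pos hdeg hinj (by norm_num))

/-- The resolution of the stalk at `p` by the free modules `𝒪_{P,p} ⊗ N_{1-k}`, `k ≥ 1`. -/
theorem exists_resolution_stalk (hres : IsInjectiveResolution hF 𝒩) :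
    ∃ q : term 𝒩 (localRing p) 1 →ₗ[localRing p] stalk hF p, Function.Surjective q ∧
      Function.Exact (diff hN.isInternal (coord p) 1) q ∧
      ∀ k, Function.Exact (diff hN.isInternal (coord p) (k + 1 + 1))
        (diff hN.isInternal (coord p) (k + 1)) := by
  obtain ⟨h0, ⟨η, hη, hdeg, hinj, hker⟩, hex⟩ := hres
  have hsurj := augN_surjective hF h0 hker hex
  have h1 : ∀ j : ℤ, 0 < j → ∀ z : localRing p ⊗[K] G 𝒩 j, z = 0 := fun j hj z => by
    have := subsingleton_tensor_G (R := localRing p) (eq_bot_of_pos hdeg hinj hj)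
    exact Subsingleton.elim _ _
  have h2 : (1 : ℤ) - ((1 : ℕ) : ℤ) = 0 := by norm_num
  refine ⟨augStalk hF p η _, ?_, ?_, ?_⟩
  · rintro ⟨w, hw⟩
    obtain ⟨z, rfl⟩ := exists_augLoc_eq hF p hsurj hw
    refine ⟨projR hN.isInternal _ z, Subtype.ext ?_⟩
    rw [augStalk_coe, h2]
    exact augLoc_inclR_projR p hN.isInternal hdeg z
  · intro z
    rw [← Subtype.coe_inj, augStalk_coe]
    constructor
    · intro hz
      -- Degree 0 is the top degree of N, so every element there is a cycle.
      have h3 : tautMul N (localRing p) (coord p) (inclR 𝒩 (localRing p) _ z) = 0 := by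
        rw [← inclR_compMul hN (coord p) (i := 1 - ((1 : ℕ) : ℤ)) (j := 1) (by norm_num),
          h1 1 one_pos (compMul _ _ _ _ z), map_zero]
      obtain ⟨y, hy⟩ := exists_tautMul_eq hF p hη hinj hker hex h3 hz
      exact (mem_range_compMul_iff hN (coord p) (by norm_num) z).mpr ⟨y, hy⟩
    · rintro ⟨y, rfl⟩
      rw [diff, inclR_compMul hN (coord p) (by norm_num)]
      exact augLoc_tautMul hF p hη hker _
  · intro k
    rw [diff, diff, exact_compMul_iff hN (coord p) (by push_cast; ring) (by push_cast; ring)]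
    intro z hz
    -- Below degree 0 the augmentation vanishes automatically, so a cycle needs no further
    -- condition.
    exact exists_tautMul_eq hF p hη hinj hker hex hz
      (augLoc_inclR_eq_zero p hdeg (by push_cast; omega) z)

include hN in
/-- The homology at `p` in index `i` vanishes if and only if the projective dimension of the stalk
is less than `i`. -/
theorem HPointDeg_eq_bot_iff_projDim (hres : IsInjectiveResolution hF 𝒩) (i : ℕ) :
    HPointDeg 𝒩 p (-(i : ℤ)) = ⊥ ↔
      HasProjectiveDimensionLT (ModuleCat.of (localRing p) (stalk hF p)) i := by
  rw [HPointDeg_eq_bot_iff_residueField hN]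
  obtain ⟨q, hq, hdq, hd⟩ := exists_resolution_stalk hN hF p hres
  cases i with
  | zero =>
    -- In index 0 the outgoing differential has target zero, and exactness means surjectivity of the
    -- incoming one.
    rw [← surjective_residueField_iff hdq hq]
    have := subsingleton_term_zero hF hres (R := localRing p)
    constructor
    · intro h z
      exact (h z).mp (Subsingleton.elim _ _)
    · intro h z
      exact ⟨fun _ => h z, fun _ => Subsingleton.elim _ _⟩
  | succ k =>
    exact exact_residueField_iff k (C := fun i => term 𝒩 (localRing p) (i + 1))
      (fun i => diff hN.isInternal (coord p) (i + 1)) q hd hdq hq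

end Resolution

/-! ### Exactness at the points of a spectrum is an open condition -/

section Openness

/-- Over a field both maps split onto their images; t inverts g on its image, and s inverts f on the
remainder, which lies in ker g. -/
theorem exists_homotopy_of_exact {L M N P : Type*} [Field L] [AddCommGroup M] [AddCommGroup N]
    [AddCommGroup P] [Module L M] [Module L N] [Module L P] {f : M →ₗ[L] N} {g : N →ₗ[L] P}
    (h : Function.Exact f g) : ∃ (s : N →ₗ[L] M) (t : P →ₗ[L] N),
      f ∘ₗ s + t ∘ₗ g = LinearMap.id := by
  obtain ⟨π, hπ⟩ := (LinearMap.range g).subtype.exists_leftInverse_of_injective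
    (LinearMap.ker_eq_bot.mpr Subtype.val_injective)
  obtain ⟨σ, hσ⟩ := g.rangeRestrict.exists_rightInverse_of_surjective
    (LinearMap.range_eq_top.mpr g.surjective_rangeRestrict)
  obtain ⟨τ, hτ⟩ := f.rangeRestrict.exists_rightInverse_of_surjective
    (LinearMap.range_eq_top.mpr f.surjective_rangeRestrict)
  have h1 : ∀ z, g (σ (π (g z))) = g z := by
    intro z
    have h2 : π (g z) = ⟨g z, z, rfl⟩ := LinearMap.congr_fun hπ ⟨g z, z, rfl⟩
    rw [h2]
    exact congrArg Subtype.val (LinearMap.congr_fun hσ ⟨g z, z, rfl⟩)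
  have h3 : ∀ z, (LinearMap.id - σ ∘ₗ π ∘ₗ g : N →ₗ[L] N) z ∈ LinearMap.range f := fun z =>
    (h _).mp (by simp [h1])
  refine ⟨τ ∘ₗ LinearMap.codRestrict _ (LinearMap.id - σ ∘ₗ π ∘ₗ g) h3, σ ∘ₗ π,
    LinearMap.ext fun z => ?_⟩
  have h4 := congrArg Subtype.val (LinearMap.congr_fun hτ ⟨_, h3 z⟩)
  rw [LinearMap.add_apply, LinearMap.comp_apply, LinearMap.comp_apply]
  change f (τ ⟨_, h3 z⟩) + _ = z
  change f (τ ⟨_, h3 z⟩) = _ at h4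
  rw [h4]
  simp

/-- On ker g the homotopy reduces to f s, so injectivity embeds ker g in the image of f, and
dimensions are compared. -/
theorem exact_of_homotopy {L M N P : Type*} [Field L] [AddCommGroup M] [AddCommGroup N]
    [AddCommGroup P] [Module L M] [Module L N] [Module L P] [FiniteDimensional L N]
    {f : M →ₗ[L] N} {g : N →ₗ[L] P} (hgf : g ∘ₗ f = 0) (s : N →ₗ[L] M) (t : P →ₗ[L] N)
    (h : Function.Injective (f ∘ₗ s + t ∘ₗ g)) : Function.Exact f g := by
  have hle : LinearMap.range f ≤ LinearMap.ker g := LinearMap.range_le_ker_iff.mpr hgf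
  rw [LinearMap.exact_iff]
  refine (Submodule.eq_of_le_of_finrank_le hle ?_).symm
  have hmap : (LinearMap.ker g).map (f ∘ₗ s + t ∘ₗ g) ≤ LinearMap.range f := by
    rintro _ ⟨z, hz, rfl⟩
    refine ⟨s z, ?_⟩
    have hz : g z = 0 := hz
    simp [hz]
  rw [(Submodule.equivMapOfInjective (f ∘ₗ s + t ∘ₗ g) h (LinearMap.ker g)).finrank_eq]
  exact Submodule.finrank_mono hmap

variable {A : Type*} [CommRing A] {M N P : Type*} [AddCommGroup M] [AddCommGroup N]
  [AddCommGroup P] [Module A M] [Module A N] [Module A P]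

theorem exists_smul_eq_one_tmul (p : Ideal A) [p.IsPrime] (y : p.ResidueField ⊗[A] N) :
    ∃ u ∉ p, ∃ z : N, u • y = 1 ⊗ₜ z := by
  induction y with
  | zero => exact ⟨1, (Ideal.ne_top_iff_one p).mp ‹p.IsPrime›.ne_top, 0, by simp⟩
  | add x y hx hy =>
    obtain ⟨u, hu, z, hz⟩ := hx
    obtain ⟨u', hu', z', hz'⟩ := hy
    refine ⟨u * u', fun h => (‹p.IsPrime›.mem_or_mem h).elim hu hu', u' • z + u • z', ?_⟩
    rw [smul_add, mul_comm, mul_smul, hz, mul_comm, mul_smul, hz', tmul_add, tmul_smul, tmul_smul]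
  | tmul a z =>
    obtain ⟨b, c, hc, rfl⟩ := IsFractionRing.div_surjective (A := A ⧸ p) a
    obtain ⟨b, rfl⟩ := Ideal.Quotient.mk_surjective b
    obtain ⟨c, rfl⟩ := Ideal.Quotient.mk_surjective c
    have hc' : c ∉ p := by
      rw [← Ideal.Quotient.eq_zero_iff_mem]
      exact nonZeroDivisors.ne_zero hc
    refine ⟨c, hc', b • z, ?_⟩
    have hc0 : algebraMap A p.ResidueField c ≠ 0 := by
      rwa [Ne, Ideal.algebraMap_residueField_eq_zero]
    rw [smul_tmul', tmul_smul, smul_tmul', Algebra.smul_def, Algebra.smul_def, mul_one]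
    congr 1
    simp only [Ideal.algebraMap_quotient_residueField_mk]
    field_simp

/-- Maps between free modules over a residue field come from maps of free modules, up to
scaling. -/
theorem exists_smul_eq_baseChange [Module.Finite A M] [Module.Free A M] (p : Ideal A) [p.IsPrime]
    (φ : p.ResidueField ⊗[A] M →ₗ[p.ResidueField] p.ResidueField ⊗[A] N) :
    ∃ u ∉ p, ∃ ψ : M →ₗ[A] N, ψ.baseChange p.ResidueField = algebraMap A p.ResidueField u • φ := by
  classical
  let b := Module.Free.chooseBasis A M
  choose u hu z hz using fun i => exists_smul_eq_one_tmul p (φ (1 ⊗ₜ b i))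
  refine ⟨∏ i, u i, fun h => ?_, b.constr ℕ fun i => (∏ j ∈ Finset.univ.erase i, u j) • z i, ?_⟩
  · obtain ⟨i, -, hi⟩ := (Ideal.IsPrime.prod_mem_iff).mp h
    exact hu i hi
  · refine (b.baseChange p.ResidueField).ext fun i => ?_
    rw [Module.Basis.baseChange_apply, LinearMap.baseChange_tmul, Module.Basis.constr_basis,
      LinearMap.smul_apply, algebraMap_smul, ← Finset.mul_prod_erase _ _ (Finset.mem_univ i),
      mul_comm, mul_smul, hz, tmul_smul]

/-- A contracting homotopy over the residue field at p lifts to A up to scalars outside p. The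
lifted endomorphism is a nonzero scalar at p and stays invertible wherever its determinant does not
vanish, which suffices for exactness there. -/
theorem exists_notMem_exact [Module.Finite A N] [Module.Free A N]
    [Module.Finite A P] [Module.Free A P] {f : M →ₗ[A] N} {g : N →ₗ[A] P}
    (hgf : g ∘ₗ f = 0) (p : Ideal A) [p.IsPrime]
    (h : Function.Exact (f.baseChange p.ResidueField) (g.baseChange p.ResidueField)) :
    ∃ δ ∉ p, ∀ (q : Ideal A) [q.IsPrime], δ ∉ q →
      Function.Exact (f.baseChange q.ResidueField) (g.baseChange q.ResidueField) := by
  obtain ⟨s, t, hst⟩ := exists_homotopy_of_exact h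
  obtain ⟨u, hu, s', hs'⟩ := exists_smul_eq_baseChange p s
  obtain ⟨v, hv, t', ht'⟩ := exists_smul_eq_baseChange p t
  -- The factors are crossed, v with s' and u with t', so that at p both summands carry the same
  -- scalar u v.
  have hbc : ∀ (q : Ideal A) [q.IsPrime],
      (f ∘ₗ (v • s') + (u • t') ∘ₗ g).baseChange q.ResidueField =
      f.baseChange q.ResidueField ∘ₗ (v • s').baseChange q.ResidueField +
        (u • t').baseChange q.ResidueField ∘ₗ g.baseChange q.ResidueField := fun q _ => by
    rw [LinearMap.baseChange_add, LinearMap.baseChange_comp, LinearMap.baseChange_comp]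
  have hdet : ∀ (q : Ideal A) [q.IsPrime], LinearMap.det (f ∘ₗ (v • s') + (u • t') ∘ₗ g) ∉ q ↔
      LinearMap.det ((f ∘ₗ (v • s') + (u • t') ∘ₗ g).baseChange q.ResidueField) ≠ 0 := by
    intro q _
    rw [LinearMap.det_baseChange, Ne, Ideal.algebraMap_residueField_eq_zero]
  refine ⟨LinearMap.det (f ∘ₗ (v • s') + (u • t') ∘ₗ g), ?_, fun q _ hq => ?_⟩
  · have h1 : (f ∘ₗ (v • s') + (u • t') ∘ₗ g).baseChange p.ResidueField =
        algebraMap A p.ResidueField (u * v) • LinearMap.id := by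
      rw [hbc, LinearMap.baseChange_smul, LinearMap.baseChange_smul, hs', ht', ← hst]
      rw [← algebraMap_smul p.ResidueField v (algebraMap A p.ResidueField u • s),
        ← algebraMap_smul p.ResidueField u (algebraMap A p.ResidueField v • t), smul_smul, smul_smul,
        ← map_mul, ← map_mul, mul_comm v u, LinearMap.comp_smul, LinearMap.smul_comp, smul_add]
    have hne : ∀ a ∉ p, algebraMap A p.ResidueField a ≠ 0 := fun a ha => by
      rwa [Ne, Ideal.algebraMap_residueField_eq_zero]
    rw [hdet, h1, LinearMap.det_smul, LinearMap.det_id, mul_one, map_mul]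
    exact pow_ne_zero _ (mul_ne_zero (hne u hu) (hne v hv))
  · rw [hdet, hbc, ← isUnit_iff_ne_zero, ← LinearMap.isUnit_iff_isUnit_det] at hq
    refine exact_of_homotopy ?_ _ _ ((Module.End.isUnit_iff _).mp hq).1
    rw [← LinearMap.baseChange_comp, hgf, LinearMap.baseChange_zero]

end Openness

/-! ### Openness of the vanishing of the homology -/

section HomologyOpen

variable {K : Type u} [Field K] {n : ℕ} {N : Type v} [AddCommGroup N] [Module K N]
  [Module (E K n) N] [IsScalarTower K (E K n) N] [Module.Finite K N]
  {𝒩 : ℤ → Submodule K N} (hN : IsGradedModule (gradE K n) 𝒩)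

include hN in
/-- The points at which the homology vanishes in a given index form an open set. -/
theorem isOpen_HPointDeg_eq_bot (i : ℕ) : IsOpen {p : P K n | HPointDeg 𝒩 p (-(i : ℤ)) = ⊥} := by
  rw [isOpen_iff_forall_mem_open]
  intro p hp
  -- All the complexes at points are fibres of one complex over S, with the variables as coordinate
  -- vector.
  have hiff : ∀ q : P K n, HPointDeg 𝒩 q (-(i : ℤ)) = ⊥ ↔ Function.Exact
      ((diff hN.isInternal (MvPolynomial.X : Fin n → S K n) (i + 1)).baseChange (kappa q))
      ((diff hN.isInternal (MvPolynomial.X : Fin n → S K n) i).baseChange (kappa q)) := by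
    intro q
    rw [HPointDeg_eq_bot_iff hN]
    exact (exact_baseChange_compMul_iff hN.isInternal _ _ one_ne_zero
      (fun j => one_mul _) _ _ _).symm
  obtain ⟨δ, hδ, hq⟩ := exists_notMem_exact
    (LinearMap.ext (diff_diff hN (MvPolynomial.X : Fin n → S K n) i))
    p.asHomogeneousIdeal.toIdeal ((hiff p).mp hp)
  exact ⟨ProjectiveSpectrum.basicOpen (gradS K n) δ, fun q hδq => (hiff q).mpr (hq _ hδq),
    (ProjectiveSpectrum.basicOpen (gradS K n) δ).isOpen, hδ⟩

end HomologyOpen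

/-! ### Stalks at the generic points of the support -/

section Nilpotent

variable {K : Type u} [Field K] {n : ℕ}
  {F : Type u} [AddCommGroup F] [Module K F] [Module (S K n) F] [IsScalarTower K (S K n) F]
  {ℱ : ℤ → Submodule K F} (hF : IsGradedModule (gradS K n) ℱ) (p : P K n)

/-- If `g` lies in every homogeneous prime contained in `p` at which the stalk does not vanish, then
a power of `g` annihilates `f` at `p`. -/
theorem exists_pow_smul_eq_zero {d : ℕ} {f : F} (hf : f ∈ ℱ d) (g : S K n)
    (h : ∀ q : P K n, q.asHomogeneousIdeal.toIdeal ≤ p.asHomogeneousIdeal.toIdeal →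
      g ∉ q.asHomogeneousIdeal.toIdeal → Subsingleton (stalk hF q)) :
    ∃ (k : ℕ) (u : S K n), u ∉ p.asHomogeneousIdeal.toIdeal ∧ u • g ^ k • f = 0 := by
  by_contra! hcon
  let I : Ideal (S K n) := LinearMap.ker (LinearMap.toSpanSingleton (S K n) F f)
  have hI : ∀ s, s ∈ I ↔ s • f = 0 := fun s => by
    rw [LinearMap.mem_ker, LinearMap.toSpanSingleton_apply]
  -- If no product u g^k kills f, the annihilator of f is disjoint from T, and some prime Q contains
  -- it and is disjoint from T.
  let T : Submonoid (S K n) := p.asHomogeneousIdeal.toIdeal.primeCompl ⊔ Submonoid.powers g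
  have hdisj : Disjoint (I : Set (S K n)) T := by
    rw [Set.disjoint_left]
    intro s hs hsT
    obtain ⟨u, hu, w, ⟨k, rfl⟩, rfl⟩ := Submonoid.mem_sup.mp hsT
    apply hcon k u hu
    rw [← mul_smul]
    exact (hI _).mp hs
  obtain ⟨Q, hQ, hIQ, hQT⟩ := Ideal.exists_le_prime_disjoint I T hdisj
  have hQp : Q ≤ p.asHomogeneousIdeal.toIdeal := by
    intro s hs
    by_contra hsp
    exact Set.disjoint_left.mp hQT hs (Submonoid.mem_sup_left hsp)
  have hgQ : g ∉ Q := fun hg =>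
    Set.disjoint_left.mp hQT hg (Submonoid.mem_sup_right (Submonoid.mem_powers g))
  have hcore : (Q.homogeneousCore (gradS K n)).toIdeal ≤ Q :=
    Ideal.toIdeal_homogeneousCore_le (gradS K n) Q
  let q : P K n :=
    { asHomogeneousIdeal := Q.homogeneousCore (gradS K n)
      isPrime := hQ.homogeneousCore
      not_irrelevant_le := fun hle =>
        p.not_irrelevant_le fun s hs => hQp (hcore (hle hs)) }
  have hsub := h q (hcore.trans hQp) fun hg => hgQ (hcore hg)
  have hX : MvPolynomial.X (idx q) ^ d ∉ q.asHomogeneousIdeal.toIdeal := fun hX =>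
    X_idx_notMem q (q.isPrime.mem_of_pow_mem d hX)
  have hz : (LocalizedModule.mk f ⟨MvPolynomial.X (idx q) ^ d, hX⟩ : locModule F q) = 0 := by
    have hmem : (LocalizedModule.mk f ⟨MvPolynomial.X (idx q) ^ d, hX⟩ : locModule F q) ∈
        stalk hF q :=
      ⟨d, f, ⟨MvPolynomial.X (idx q) ^ d, hX⟩, hf, MvPolynomial.isHomogeneous_X_pow _ _, rfl⟩
    exact congrArg Subtype.val (Subsingleton.elim (⟨_, hmem⟩ : stalk hF q) 0)
  obtain ⟨u, hu⟩ := LocalizedModule.mk_eq.mp (hz.trans (LocalizedModule.zero_mk 1).symm)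
  have hu : (u : S K n) • f = 0 := by simpa [Submonoid.smul_def] using hu
  obtain ⟨b, t, ht, htq, htf⟩ := exists_homogeneous_smul_eq_zero hF q hf u.2 hu
  exact htq (Ideal.mem_homogeneousCore_of_homogeneous_of_mem ⟨b, ht⟩ (hIQ ((hI t).mpr htf)))

/-- If the stalks vanish at all proper generizations of `p`, then the maximal ideal of the local ring
at `p` acts locally nilpotently on the stalk at `p`. -/
theorem exists_pow_smul_stalk_eq_zero
    (h : ∀ q : P K n, q.asHomogeneousIdeal.toIdeal ≤ p.asHomogeneousIdeal.toIdeal → q ≠ p →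
      Subsingleton (stalk hF q))
    {b : localRing p} (hb : b ∈ IsLocalRing.maximalIdeal (localRing p)) (w : stalk hF p) :
    ∃ k : ℕ, b ^ k • w = 0 := by
  obtain ⟨w, d, f, s, hf, hs, rfl⟩ := w
  obtain ⟨a, g, t, hg, ht, htp, rfl⟩ := exists_frac p b
  have hgp : g ∈ p.asHomogeneousIdeal.toIdeal := by
    by_contra hgp
    rw [IsLocalRing.mem_maximalIdeal, mem_nonunits_iff,
      ← HomogeneousLocalization.isUnit_iff_isUnit_val] at hb
    apply hb
    have := mul_val_frac p hg ht htp
    refine isUnit_of_mul_isUnit_right (x := algebraMap (S K n) (locRing p) t) ?_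
    rw [HomogeneousLocalization.algebraMap_apply] at this
    rw [this]
    exact isUnit_algebraMap p hgp
  obtain ⟨k, u, hu, huf⟩ := exists_pow_smul_eq_zero hF p hf g fun q hq hgq => h q hq (by
    rintro rfl
    exact hgq hgp)
  refine ⟨k, Subtype.ext ?_⟩
  have hval : algebraMap (S K n) (locRing p) t ^ k •
      (frac p hg ht htp ^ k • (LocalizedModule.mk f s : locModule F p)) =
        LocalizedModule.mk (g ^ k • f) s := by
    have h1 : frac p hg ht htp ^ k • (LocalizedModule.mk f s : locModule F p) =
        algebraMap (localRing p) (locRing p) (frac p hg ht htp ^ k) •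
          (LocalizedModule.mk f s : locModule F p) := rfl
    rw [h1, ← mul_smul, map_pow, ← mul_pow, mul_val_frac, ← map_pow, algebraMap_smul,
      LocalizedModule.smul'_mk]
  have hzero : (LocalizedModule.mk (g ^ k • f) s : locModule F p) = 0 := by
    rw [← LocalizedModule.zero_mk 1, LocalizedModule.mk_eq]
    refine ⟨⟨u, hu⟩, ?_⟩
    simpa [Submonoid.smul_def] using huf
  rw [hzero] at hval
  exact ((isUnit_algebraMap p htp).pow k).smul_eq_zero.mp hval

end Nilpotent

/-! ### The start of the induction along a regular sequence -/

section TopHomologyZero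

/-- The homology of a resolution of a nonzero module with a locally nilpotent action. -/
theorem topHomology_zero {R : Type u} [CommRing R] {I : Ideal R} {D : ℕ → Type u}
    [∀ i, AddCommGroup (D i)] [∀ i, Module R (D i)] {d : ∀ i, D (i + 1) →ₗ[R] D i}
    {M : Type u} [AddCommGroup M] [Module R M] [Nontrivial M] {q : D 1 →ₗ[R] M}
    [Subsingleton (D 0)] (hq : Function.Surjective q) (hdq : Function.Exact (d 1) q)
    (hd : ∀ i, Function.Exact (d (i + 1 + 1)) (d (i + 1)))
    (hnil : ∀ b ∈ I, ∀ m : M, ∃ k : ℕ, b ^ k • m = 0) :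
    TopHomology d I (R ⧸ (⊥ : Ideal R)) 0 := by
  let e : (R ⧸ (⊥ : Ideal R)) ≃ₗ[R] R := Submodule.quotEquivOfEqBot ⊥ rfl
  have : Module.Flat R (R ⧸ (⊥ : Ideal R)) := Module.Flat.of_linearEquiv e
  let ε : (R ⧸ (⊥ : Ideal R)) ⊗[R] M ≃ₗ[R] M :=
    (TensorProduct.congr e (LinearEquiv.refl R M)).trans (TensorProduct.lid R M)
  have h1 : Function.Exact ((d 1).lTensor (R ⧸ (⊥ : Ideal R))) (q.lTensor _) :=
    lTensor_exact _ hdq hq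
  have h2 : Function.Surjective (q.lTensor (R ⧸ (⊥ : Ideal R))) := LinearMap.lTensor_surjective _ hq
  refine ⟨fun i hi => ?_, ?_, fun b hb z _ => ?_⟩
  · obtain ⟨i, rfl⟩ : ∃ j, i = j + 1 := ⟨i - 1, by omega⟩
    exact Module.Flat.lTensor_exact _ (hd i)
  -- As D 0 is zero, everything in position 1 is a cycle and the homology there is M.
  · obtain ⟨m, hm⟩ := exists_ne (0 : M)
    obtain ⟨z, hz⟩ := h2 (ε.symm m)
    refine ⟨z, Subsingleton.elim _ _, fun hr => hm ?_⟩
    have := (h1 z).mpr hr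
    rw [this, eq_comm, LinearEquiv.map_eq_zero_iff] at hz
    exact hz
  · obtain ⟨k, hk⟩ := hnil b hb (ε (q.lTensor _ z))
    refine ⟨k, (h1 _).mp (ε.injective ?_)⟩
    rw [map_smul, map_smul, hk, map_zero]

end TopHomologyZero

/-! ### The singular variety -/

section Sing

variable {K : Type u} [Field K] {n : ℕ} {N : Type v} [AddCommGroup N] [Module K N]
  [Module (E K n) N] [IsScalarTower K (E K n) N] [Module.Finite K N]
  {𝒩 : ℤ → Submodule K N} (hN : IsGradedModule (gradE K n) 𝒩)
  {F : Type u} [AddCommGroup F] [Module K F] [Module (S K n) F] [IsScalarTower K (S K n) F]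
  {ℱ : ℤ → Submodule K F} (hF : IsGradedModule (gradS K n) ℱ)

/-- Finite dimension leaves only finitely many nonzero components, so one finite set of degrees
works for all elements. -/
theorem exists_sum_gradedProj (h : DirectSum.IsInternal 𝒩) :
    ∃ s : Finset ℤ, ∀ m : N, ∑ i ∈ s, (gradedProj h i m : N) = m := by
  have hfin := WellFoundedGT.finite_ne_bot_of_iSupIndep h.submodule_iSupIndep
  refine ⟨hfin.toFinset, fun m => gradedProj_induction h
    (p := fun m => ∑ i ∈ hfin.toFinset, (gradedProj h i m : N) = m) ?_ ?_ ?_ m⟩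
  · simp
  · intro x y hx hy
    simp only [map_add, Submodule.coe_add, Finset.sum_add_distrib, hx, hy]
  · intro j m hm
    rw [Finset.sum_eq_single j, gradedProj_of_mem h hm]
    · intro i _ hij
      rw [gradedProj_of_mem_ne h hm hij.symm, ZeroMemClass.coe_zero]
    · intro hj
      have hj' : 𝒩 j = ⊥ := by simpa using hj
      rw [gradedProj_of_mem h hm]
      exact (Submodule.mem_bot K).mp (hj' ▸ hm)

theorem exists_sum_inclR_projR (h : DirectSum.IsInternal 𝒩) (R : Type*) [CommRing R]
    [Algebra K R] : ∃ s : Finset ℤ, ∀ z : R ⊗[K] N, ∑ i ∈ s, inclR 𝒩 R i (projR h i z) = z := by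
  obtain ⟨s, hs⟩ := exists_sum_gradedProj h
  refine ⟨s, fun z => ?_⟩
  induction z with
  | zero => simp
  | add x y hx hy => simp only [map_add, Finset.sum_add_distrib, hx, hy]
  | tmul r m =>
    simp only [inclR, projR, LinearMap.baseChange_tmul, gIncl_gProj, ← tmul_sum, hs]

theorem HPointDeg_eq_bot_of_pos (hres : IsInjectiveResolution hF 𝒩) (p : P K n) {i : ℤ}
    (hi : 0 < i) : HPointDeg 𝒩 p i = ⊥ := by
  obtain ⟨-, ⟨η, -, hdeg, hinj, -⟩, -⟩ := hres
  rw [HPointDeg, eq_bot_of_pos hdeg hinj hi, Submodule.baseChange_bot, homologyPart_bot]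

theorem Hdeg_eq_bot_of_pos (hres : IsInjectiveResolution hF 𝒩) (e : V K n) {i : ℤ}
    (hi : 0 < i) : Hdeg 𝒩 e i = ⊥ := by
  obtain ⟨-, ⟨η, -, hdeg, hinj, -⟩, -⟩ := hres
  rw [Hdeg, eq_bot_of_pos hdeg hinj hi, homologyPart_bot]

/-- Bounds on the projective dimension are inherited by larger bounds; hence the homology cannot
reappear after a gap. -/
theorem HPointDeg_eq_bot_of_le (hN : IsGradedModule (gradE K n) 𝒩)
    (hres : IsInjectiveResolution hF 𝒩) (p : P K n) {i j : ℕ}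
    (hij : i ≤ j) (h : HPointDeg 𝒩 p (-(i : ℤ)) = ⊥) : HPointDeg 𝒩 p (-(j : ℤ)) = ⊥ := by
  rw [HPointDeg_eq_bot_iff_projDim hN hF p hres] at h ⊢
  exact hasProjectiveDimensionLT_of_ge _ i j hij

include hN in
theorem mem_sing_iff (hres : IsInjectiveResolution hF 𝒩) (p : P K n) :
    p ∈ sing K n N ↔ HPointDeg 𝒩 p 0 ≠ ⊥ := by
  rw [sing, Set.mem_ofPred_eq, not_iff_not]
  constructor
  · intro h
    rw [HPointDeg, homologyPart_eq_bot_iff]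
    intro m _ hm
    rw [← h]
    exact hm
  · intro h
    have hall : ∀ i : ℤ, HPointDeg 𝒩 p i = ⊥ := by
      intro i
      rcases lt_or_ge 0 i with hi | hi
      · exact HPointDeg_eq_bot_of_pos hF hres p hi
      · obtain ⟨k, rfl⟩ : ∃ k : ℕ, i = -(k : ℤ) := ⟨(-i).toNat, by omega⟩
        exact HPointDeg_eq_bot_of_le hF hN hres p (Nat.zero_le k) (by simpa using h)
    obtain ⟨s, hs⟩ := exists_sum_inclR_projR hN.isInternal (kappa p)
    rw [mulByPoint_eq_tautMul] at *
    apply le_antisymm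
    · intro z hz
      rw [← hs z]
      refine sum_mem fun i _ => ?_
      refine (homologyPart_eq_bot_iff _ _).mp (hall i) _ ?_ ?_
      · rw [← range_inclR]
        exact LinearMap.mem_range_self _ _
      · rw [mulByPoint_eq_tautMul, ← inclR_projR_tautMul hN, LinearMap.mem_ker.mp hz, map_zero,
          map_zero]
    · rintro _ ⟨z, rfl⟩
      exact tautMul_tautMul _ _ z

include hN in
theorem isClosed_sing (hres : IsInjectiveResolution hF 𝒩) : IsClosed (sing K n N) := by
  rw [← isOpen_compl_iff]
  convert isOpen_HPointDeg_eq_bot hN 0 using 1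
  ext p
  rw [Set.mem_compl_iff, mem_sing_iff hN hF hres]
  simp

include hN in
-- The singular variety is the support of the sheaf: index 0 decides both, as projective dimension
-- less than 0 means zero.
theorem subsingleton_stalk_iff (hres : IsInjectiveResolution hF 𝒩) (p : P K n) :
    Subsingleton (stalk hF p) ↔ p ∉ sing K n N := by
  rw [mem_sing_iff hN hF hres, not_not, ← hasProjectiveDimensionLT_zero_iff (R := localRing p),
    ← HPointDeg_eq_bot_iff_projDim hN hF p hres]
  simp

include hN in
/-- The homology at the generic point of a component of the singular variety. -/
theorem HPointDeg_generic (hres : IsInjectiveResolution hF 𝒩)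
    {Z : TopologicalSpace.IrreducibleCloseds (P K n)}
    (hZ : Maximal (fun Y : TopologicalSpace.IrreducibleCloseds (P K n) =>
        (Y : Set (P K n)) ⊆ sing K n N) Z) {p : P K n} (hp : (Z : Set (P K n)) = closure {p})
    {c : ℕ} (hc : ringKrullDim (localRing p) = c) :
    HPointDeg 𝒩 p (-(c : ℤ)) ≠ ⊥ ∧ HPointDeg 𝒩 p (-((c + 1 : ℕ) : ℤ)) = ⊥ := by
  have hpZ : p ∈ (Z : Set (P K n)) := hp ▸ subset_closure rfl
  have hps : p ∈ sing K n N := hZ.prop hpZ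
  -- A proper generization of p in the closed set sing(N) would have a closure in sing(N) strictly
  -- containing Z.
  have hgen : ∀ q : P K n, q.asHomogeneousIdeal.toIdeal ≤ p.asHomogeneousIdeal.toIdeal → q ≠ p →
      Subsingleton (stalk hF q) := by
    intro q hq hqp
    rw [subsingleton_stalk_iff hN hF hres]
    intro hqs
    apply hqp
    have hpq : p ∈ closure {q} := (ProjectiveSpectrum.le_iff_mem_closure _ q p).mp hq
    let Y : TopologicalSpace.IrreducibleCloseds (P K n) :=
      ⟨closure {q}, isIrreducible_singleton.closure, isClosed_closure⟩
    have hY : (Y : Set (P K n)) ⊆ sing K n N :=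
      closure_minimal (Set.singleton_subset_iff.mpr hqs) (isClosed_sing hN hF hres)
    have hZY : Z ≤ Y := by
      change (Z : Set (P K n)) ⊆ closure {q}
      rw [hp]
      exact closure_minimal (Set.singleton_subset_iff.mpr hpq) isClosed_closure
    have hqZ : q ∈ closure {p} := hp ▸ hZ.le_of_ge hY hZY (subset_closure rfl : q ∈ closure {q})
    exact le_antisymm hq ((ProjectiveSpectrum.le_iff_mem_closure _ p q).mpr hqZ)
  obtain ⟨q, hq, hdq, hd⟩ := exists_resolution_stalk hN hF p hres
  have hnt : Nontrivial (stalk hF p) := by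
    rw [← not_subsingleton_iff_nontrivial, subsingleton_stalk_iff hN hF hres, not_not]
    exact hps
  have := subsingleton_term_zero hF hres (R := localRing p)
  have h0 : TopHomology (diff hN.isInternal (coord p)) (IsLocalRing.maximalIdeal (localRing p))
      (localRing p ⧸ (⊥ : Ideal (localRing p))) 0 :=
    topHomology_zero hq hdq hd fun b hb w => exists_pow_smul_stalk_eq_zero hF p hgen hb w
  have htop := (regularChain_maximalIdeal c (localRing p) hc).2.topHomology
    (diff_diff hN (coord p)) h0
  rw [HPointDeg_eq_bot_iff_residueField hN, Ne, HPointDeg_eq_bot_iff_residueField hN]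
  refine ⟨fun h => ?_, htop.exact (c + 1) (Nat.lt_succ_self c)⟩
  obtain ⟨z, hz, hzr⟩ := htop.not_exact
  exact hzr ((h z).mp hz)

include hN in
/-- On a dense open subset of a component of the singular variety of codimension `c`, the homology
is nonzero exactly in the indices `0, …, c`. -/
theorem exists_isOpen_HPointDeg (hres : IsInjectiveResolution hF 𝒩)
    {Z : TopologicalSpace.IrreducibleCloseds (P K n)}
    (hZ : Maximal (fun Y : TopologicalSpace.IrreducibleCloseds (P K n) =>
        (Y : Set (P K n)) ⊆ sing K n N) Z) :
    ∃ U : Set (P K n), IsOpen U ∧ ((Z : Set (P K n)) ∩ U).Nonempty ∧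
      ∀ p ∈ (Z : Set (P K n)) ∩ U, ∀ i : ℕ,
        HPointDeg 𝒩 p (-(i : ℤ)) ≠ ⊥ ↔ (i : ℕ∞) ≤ Order.coheight Z := by
  obtain ⟨x, hx⟩ := QuasiSober.sober Z.isIrreducible Z.isClosed
  have hx' : (Z : Set (P K n)) = closure {x} := hx.symm
  have hdim := ringKrullDim_localRing Z x hx'
  have hreg := (isRegularLocalRing_iff (localRing x)).mp inferInstance
  set c := (IsLocalRing.maximalIdeal (localRing x)).spanFinrank
  have hc : Order.coheight Z = c := by
    rw [hdim] at hreg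
    exact_mod_cast hreg.symm
  obtain ⟨h1, h2⟩ := HPointDeg_generic hN hF hres hZ hx' hreg.symm
  -- U is the locus where index c + 1 vanishes, and hence every larger index too.
  refine ⟨_, isOpen_HPointDeg_eq_bot hN (c + 1), ⟨x, hx' ▸ subset_closure rfl, h2⟩, ?_⟩
  rintro p ⟨hpZ, hpU⟩ i
  rw [hc, Nat.cast_le]
  constructor
  · intro h
    by_contra! hlt
    exact h (HPointDeg_eq_bot_of_le hF hN hres p hlt hpU)
  · intro hi h
    have h3 : HPointDeg 𝒩 p (-(c : ℤ)) = ⊥ := HPointDeg_eq_bot_of_le hF hN hres p hi h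
    rw [hx'] at hpZ
    -- An open set meeting Z contains the generic point, where index c does not vanish.
    obtain ⟨y, hy, rfl⟩ := mem_closure_iff.mp hpZ _ (isOpen_HPointDeg_eq_bot hN c) h3
    exact h1 hy

end Sing

/-! ### Homology of a pair of linear maps -/

section MiddleHomology

variable {k R : Type*} [CommRing k] [CommRing R] [Algebra k R] {A B C A' B' C' : Type*}
  [AddCommGroup A] [Module k A] [AddCommGroup B] [Module k B] [AddCommGroup C] [Module k C]
  [AddCommGroup A'] [Module R A'] [AddCommGroup B'] [Module R B'] [AddCommGroup C'] [Module R C']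

/-- The quotient `ker g / (im f ∩ ker g)`. -/
abbrev MiddleHomology (f : A →ₗ[k] B) (g : B →ₗ[k] C) : Type _ :=
  LinearMap.ker g ⧸ (LinearMap.range f).submoduleOf (LinearMap.ker g)

/-- Isomorphic kernels and ranges give isomorphic homology. -/
theorem nonempty_middleHomology_equiv {f : A →ₗ[k] B} {g : B →ₗ[k] C} {f' : A' →ₗ[R] B'}
    {g' : B' →ₗ[R] C'} [Module k B'] [IsScalarTower k R B'] (ε : B ≃ₗ[k] B')
    (hg : ∀ b, g' (ε b) = 0 ↔ g b = 0)
    (hf : ∀ b, ε b ∈ LinearMap.range f' ↔ b ∈ LinearMap.range f) :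
    Nonempty (MiddleHomology f g ≃ₗ[k] MiddleHomology f' g') := by
  let ψ : LinearMap.ker g →ₗ[k] MiddleHomology f' g' :=
    { toFun := fun x => Submodule.Quotient.mk ⟨ε x, (hg x).mpr x.2⟩
      map_add' := fun x y => by
        rw [← Submodule.Quotient.mk_add]
        congr 1
        exact Subtype.ext (map_add ε (x : B) y)
      map_smul' := fun c x => by
        rw [RingHom.id_apply, ← Submodule.Quotient.mk_smul]
        congr 1
        exact Subtype.ext (map_smul ε c (x : B)) }
  have hψ : Function.Surjective ψ := by
    intro y
    obtain ⟨⟨y, hy⟩, rfl⟩ := Submodule.Quotient.mk_surjective _ y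
    obtain ⟨x, rfl⟩ := ε.surjective y
    exact ⟨⟨x, (hg x).mp hy⟩, rfl⟩
  refine ⟨(Submodule.quotEquivOfEq _ _ ?_).trans (ψ.quotKerEquivOfSurjective hψ)⟩
  ext x
  rw [LinearMap.mem_ker]
  refine (hf x).symm.trans ?_
  exact (Submodule.Quotient.mk_eq_zero ((LinearMap.range f').submoduleOf (LinearMap.ker g'))
    (x := ⟨ε x, (hg x).mpr x.2⟩)).symm

end MiddleHomology

/-! ### Tor computed from a free resolution -/

section Tor

variable {R : Type u} [CommRing R]

/-- The homology of a short complex of modules. -/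
theorem nonempty_homology_equiv (T : ShortComplex (ModuleCat.{u} R)) :
    Nonempty (T.homology ≃ₗ[R] MiddleHomology T.f.hom T.g.hom) := by
  refine ⟨T.moduleCatHomologyIso.toLinearEquiv.trans (Submodule.quotEquivOfEq _ _ ?_)⟩
  ext ⟨x, hx⟩
  exact ⟨fun ⟨y, hy⟩ => ⟨y, congrArg Subtype.val hy⟩, fun ⟨y, hy⟩ => ⟨y, Subtype.ext hy⟩⟩

variable {D : ℕ → Type u} [∀ i, AddCommGroup (D i)] [∀ i, Module R (D i)]
  (d : ∀ i, D (i + 1) →ₗ[R] D i)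

/-- The chain complex given by a sequence of linear maps. -/
abbrev chainComplexOf (h : ∀ i x, d i (d (i + 1) x) = 0) : ChainComplex (ModuleCat.{u} R) ℕ :=
  ChainComplex.of (fun i => ModuleCat.of R (D i)) (fun i => ModuleCat.ofHom (d i))
    fun i => by
      ext x
      exact h i x

theorem chainComplexOf_d (h : ∀ i x, d i (d (i + 1) x) = 0) (i : ℕ) :
    (chainComplexOf d h).d (i + 1) i = ModuleCat.ofHom (d i) :=
  ChainComplex.of_d (fun i => ModuleCat.of R (D i)) (fun i => ModuleCat.ofHom (d i)) i

variable {M : Type u} [AddCommGroup M] [Module R M] {d} {q : D 0 →ₗ[R] M}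

/-- A resolution by free modules as a projective resolution. -/
def projectiveResolutionOf [∀ i, Module.Free R (D i)] (hq : Function.Surjective q)
    (hdq : Function.Exact (d 0) q) (hd : ∀ i, Function.Exact (d (i + 1)) (d i)) :
    ProjectiveResolution (ModuleCat.of R M) where
  complex := chainComplexOf d fun i x => (hd i).apply_apply_eq_zero x
  projective i := ModuleCat.projective_of_free (M := ModuleCat.of R (D i)) (Module.Free.chooseBasis R (D i))
  π := (ChainComplex.toSingle₀Equiv _ _).symm ⟨ModuleCat.ofHom q, by
    rw [chainComplexOf_d]
    ext x
    exact hdq.apply_apply_eq_zero x⟩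
  quasiIso := ⟨fun i => by
    cases i
    · rw [ChainComplex.quasiIsoAt₀_iff, ShortComplex.quasiIso_iff_of_zeros']
      · have w : ModuleCat.ofHom (d 0) ≫ ModuleCat.ofHom q = 0 := by
          ext x
          exact hdq.apply_apply_eq_zero x
        refine (ShortComplex.exact_and_epi_g_iff_of_iso
          (S₂ := ShortComplex.mk (ModuleCat.ofHom (d 0)) (ModuleCat.ofHom q) w) ?_).2
          ⟨(ShortComplex.ShortExact.moduleCat_exact_iff_function_exact _).mpr hdq, (ModuleCat.epi_iff_surjective _).mpr hq⟩
        exact ShortComplex.isoMk (Iso.refl _) (Iso.refl _) (Iso.refl _)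
          (by
            refine (Category.id_comp _).trans (Eq.trans ?_ (Category.comp_id _).symm)
            exact (chainComplexOf_d d (fun i x => (hd i).apply_apply_eq_zero x) 0).symm)
          (by
            refine (Category.id_comp _).trans (Eq.trans ?_ (Category.comp_id _).symm)
            exact (ChainComplex.toSingle₀Equiv_symm_apply_f_zero
              (C := chainComplexOf d fun i x => (hd i).apply_apply_eq_zero x)
              (ModuleCat.ofHom q) _).symm)
      all_goals rfl
    · rename_i i
      rw [quasiIsoAt_iff_exactAt']
      · rw [HomologicalComplex.exactAt_iff' _ (i + 1 + 1) (i + 1) i (by simp) (by simp),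
          ShortComplex.ShortExact.moduleCat_exact_iff_function_exact]
        let X := chainComplexOf d fun i x => (hd i).apply_apply_eq_zero x
        change Function.Exact (X.d (i + 1 + 1) (i + 1)) (X.d (i + 1) i)
        rw [chainComplexOf_d, chainComplexOf_d]
        exact hd i
      · apply ChainComplex.exactAt_succ_single_obj⟩

/-- The modules `Tor_i(A, M)` computed from a free resolution `⋯ → D 2 → D 1 → M → 0`. -/
theorem nonempty_tor_equiv {D : ℕ → Type u} [∀ i, AddCommGroup (D i)] [∀ i, Module R (D i)]
    [∀ i, Module.Free R (D i)] [Subsingleton (D 0)] {d : ∀ i, D (i + 1) →ₗ[R] D i}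
    {q : D 1 →ₗ[R] M} (hq : Function.Surjective q) (hdq : Function.Exact (d 1) q)
    (hd : ∀ i, Function.Exact (d (i + 1 + 1)) (d (i + 1))) (A : Type u) [AddCommGroup A]
    [Module R A] (i : ℕ) :
    Nonempty ((((Tor (ModuleCat.{u} R) i).obj (ModuleCat.of R A)).obj (ModuleCat.of R M)) ≃ₗ[R]
      MiddleHomology ((d (i + 1)).lTensor A) ((d i).lTensor A)) := by
  let Q := projectiveResolutionOf (D := fun i => D (i + 1)) (d := fun i => d (i + 1)) hq hdq hd
  let X := (((MonoidalCategory.tensoringLeft (ModuleCat.{u} R)).obj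
    (ModuleCat.of R A)).mapHomologicalComplex (ComplexShape.down ℕ)).obj Q.complex
  have h1 : (((Tor (ModuleCat.{u} R) i).obj (ModuleCat.of R A)).obj (ModuleCat.of R M)) ≅
      X.homology i := Q.isoLeftDerivedObj _ i
  have hX : ∀ i, (X.d (i + 1) i).hom = (d (i + 1)).lTensor A := by
    intro i
    change ((Q.complex.d (i + 1) i).hom).lTensor A = _
    have : Q.complex.d (i + 1) i = ModuleCat.ofHom (d (i + 1)) :=
      chainComplexOf_d (D := fun i => D (i + 1)) (fun i => d (i + 1))
        (fun i x => (hd i).apply_apply_eq_zero x) i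
    rw [this]
    rfl
  cases i with
  | zero =>
    -- The complex X starts with D 1, so in index 0 its outgoing map is the zero map from position 0
    -- to itself; the map to A ⊗ D 0 = 0 has the same kernel.
    have h2 := ShortComplex.homologyMapIso (X.isoSc' 1 0 0 (by simp) (by simp))
    obtain ⟨h3⟩ := nonempty_homology_equiv (X.sc' 1 0 0)
    have h4 : ∀ z : A ⊗[R] D 0, z = 0 := fun z => Subsingleton.elim _ _
    suffices h : Nonempty (_ ≃ₗ[R] MiddleHomology ((d (0 + 1)).lTensor A) ((d 0).lTensor A)) from
      ⟨(h1 ≪≫ h2).toLinearEquiv.trans (h3.trans h.some)⟩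
    refine nonempty_middleHomology_equiv (LinearEquiv.refl R _) (fun b => ?_) fun b => ?_
    · refine iff_of_true (h4 _) ?_
      change (X.d 0 0).hom b = 0
      rw [X.shape 0 0 (by simp)]
      rfl
    · change b ∈ _ ↔ b ∈ LinearMap.range (X.d (0 + 1) 0).hom
      rw [hX]
      rfl
  | succ i =>
    have h2 := ShortComplex.homologyMapIso (X.isoSc' (i + 1 + 1) (i + 1) i (by simp) (by simp))
    obtain ⟨h3⟩ := nonempty_homology_equiv (X.sc' (i + 1 + 1) (i + 1) i)
    suffices h : Nonempty (_ ≃ₗ[R] MiddleHomology ((d (i + 1 + 1)).lTensor A) ((d (i + 1)).lTensor A)) from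
      ⟨(h1 ≪≫ h2).toLinearEquiv.trans (h3.trans h.some)⟩
    refine nonempty_middleHomology_equiv (LinearEquiv.refl R _) (fun b => ?_) fun b => ?_
    · change _ ↔ (X.d (i + 1) i).hom b = 0
      rw [hX]
      rfl
    · change b ∈ _ ↔ b ∈ LinearMap.range (X.d (i + 1 + 1) (i + 1)).hom
      rw [hX]
      rfl

end Tor

/-! ### Points given by vectors -/

section VectorPoint

variable {K : Type u} [Field K] {n : ℕ} (e : V K n) (he : e ≠ 0)

theorem mem_point_iff {d : ℕ} {f : S K n} (hf : f ∈ gradS K n d) :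
    f ∈ (point e he).asHomogeneousIdeal.toIdeal ↔ MvPolynomial.eval e f = 0 :=
  ⟨fun h => Ideal.toIdeal_homogeneousCore_le (gradS K n) _ h,
    fun h => Ideal.mem_homogeneousCore_of_homogeneous_of_mem ⟨d, hf⟩ h⟩

/-- The residue field at the point given by a vector is the base field. -/
theorem bijective_algebraMap_residueField_point : Function.Bijective
    (algebraMap K (IsLocalRing.ResidueField (localRing (point e he)))) := by
  set p := point e he with hp
  refine ⟨RingHom.injective _, fun x => ?_⟩
  obtain ⟨a, rfl⟩ := IsLocalRing.residue_surjective x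
  obtain ⟨d, f, s, hf, hs, hsp, rfl⟩ := exists_frac p a
  have hs0 : MvPolynomial.eval e s ≠ 0 := fun h => hsp ((mem_point_iff e he hs).mpr h)
  refine ⟨MvPolynomial.eval e f / MvPolynomial.eval e s, ?_⟩
  -- Compared in κ(p), the claim becomes the vanishing at e of the form (f(e)/s(e)) s - f.
  apply (algebraMap (IsLocalRing.ResidueField (localRing p)) (kappa p)).injective
  apply mul_left_cancel₀ (algebraMap_kappa_ne_zero p hsp)
  have h1 : algebraMap (S K n) (kappa p) s * algebraMap (IsLocalRing.ResidueField (localRing p))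
      (kappa p) (IsLocalRing.residue (localRing p) (frac p hf hs hsp)) =
        algebraMap (S K n) (kappa p) f := by
    refine (congrArg _ (algebraMap_residue p _)).trans ?_
    rw [IsScalarTower.algebraMap_apply (S K n) (locRing p) (kappa p),
      IsScalarTower.algebraMap_apply (S K n) (locRing p) (kappa p), ← map_mul, mul_val_frac]
  rw [h1, ← IsScalarTower.algebraMap_apply, IsScalarTower.algebraMap_apply K (S K n) (kappa p),
    ← map_mul, ← sub_eq_zero, ← map_sub, Ideal.algebraMap_residueField_eq_zero,
    mem_point_iff e he (d := d)]
  · simp [hs0, mul_div_cancel₀]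
  · refine sub_mem ?_ hf
    rw [mul_comm, ← Algebra.smul_def]
    exact Submodule.smul_mem _ _ hs

/-- The affine coordinates of the point are the entries of e divided by the entry at the chosen
index. -/
theorem exists_residue_coord : ∃ u : K, u ≠ 0 ∧ ∀ k,
    algebraMap K (IsLocalRing.ResidueField (localRing (point e he))) (u * e k) =
      algebraMap (localRing (point e he)) _ (coord (point e he) k) := by
  obtain ⟨t, ht, h⟩ := exists_point_scalar e he
  set p := point e he with hp
  have hX := algebraMap_kappa_ne_zero p (X_idx_notMem p)
  have hidx : e (idx p) ≠ 0 := fun h0 => hX (by rw [← h, h0, map_zero, mul_zero])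
  refine ⟨(e (idx p))⁻¹, inv_ne_zero hidx, fun k => ?_⟩
  apply (algebraMap (IsLocalRing.ResidueField (localRing p)) (kappa p)).injective
  apply mul_left_cancel₀ hX
  rw [X_mul_algebraMap_coord, ← IsScalarTower.algebraMap_apply, ← h, ← h k, mul_assoc, ← map_mul,
    mul_inv_cancel_left₀ hidx]

end VectorPoint

/-! ### Homology of multiplication by a vector and of the reduced resolution -/

section Comparison

variable {K : Type u} [Field K] {n : ℕ} {N : Type v} [AddCommGroup N] [Module K N]
  [Module (E K n) N] [IsScalarTower K (E K n) N] [Module.Finite K N]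
  {𝒩 : ℤ → Submodule K N} (hN : IsGradedModule (gradE K n) 𝒩)

/-- The graded component of `H(e, N)` as the homology of a complex of graded components. -/
theorem nonempty_middleHomology_equiv_Hdeg (e : V K n) {i j k : ℤ} (hij : i + 1 = j)
    (hjk : j + 1 = k) :
    Nonempty (MiddleHomology (compMul (R := K) hN.isInternal e i j)
      (compMul hN.isInternal e j k) ≃ₗ[K] Hdeg 𝒩 e j) := by
  let θ : K ⊗[K] G 𝒩 j →ₗ[K] N := (TensorProduct.lid K N).toLinearMap ∘ₗ inclR 𝒩 K j
  have hθ : ∀ z, mulBy N e (θ z) = 0 ↔ compMul hN.isInternal e j k z = 0 := fun z => by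
    rw [compMul_eq_zero_iff hN e hjk, ← (TensorProduct.lid K N).map_eq_zero_iff, lid_tautMul]
    rfl
  have hrange : ∀ z, θ z ∈ LinearMap.range (mulBy N e) ↔
      z ∈ LinearMap.range (compMul (R := K) hN.isInternal e i j) := fun z => by
    rw [mem_range_compMul_iff hN e hij]
    constructor
    · rintro ⟨y, hy⟩
      refine ⟨(TensorProduct.lid K N).symm y, (TensorProduct.lid K N).injective ?_⟩
      rw [lid_tautMul, LinearEquiv.apply_symm_apply, hy]
      rfl
    · rintro ⟨y, hy⟩
      exact ⟨TensorProduct.lid K N y, by rw [← lid_tautMul, hy]; rfl⟩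
  have hmem : LinearMap.range θ = 𝒩 j := by
    rw [LinearMap.range_comp, range_inclR]
    ext m
    constructor
    · rintro ⟨z, hz, rfl⟩
      rw [← range_inclR] at hz
      obtain ⟨y, rfl⟩ := hz
      induction y with
      | zero => simp
      | add x y hx hy => simp only [map_add]; exact add_mem hx hy
      | tmul r x => simpa [inclR] using Submodule.smul_mem _ r (gIncl_mem 𝒩 j x)
    · intro hm
      exact ⟨1 ⊗ₜ m, Submodule.tmul_mem_baseChange_of_mem 1 hm, by simp⟩
  let ψ : LinearMap.ker (compMul (R := K) hN.isInternal e j k) →ₗ[K] H N e :=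
    ((LinearMap.range (mulBy N e)).submoduleOf (LinearMap.ker (mulBy N e))).mkQ ∘ₗ
      (θ ∘ₗ Submodule.subtype _).codRestrict (LinearMap.ker (mulBy N e)) fun z => (hθ z).mpr z.2
  have hker : (LinearMap.range (compMul (R := K) hN.isInternal e i j)).submoduleOf
      (LinearMap.ker (compMul hN.isInternal e j k)) = LinearMap.ker ψ := by
    ext z
    rw [LinearMap.mem_ker]
    refine (hrange z).symm.trans ?_
    exact (Submodule.Quotient.mk_eq_zero ((LinearMap.range (mulBy N e)).submoduleOf
      (LinearMap.ker (mulBy N e))) (x := ⟨θ z, (hθ z).mpr z.2⟩)).symm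
  have hψ : LinearMap.range ψ = Hdeg 𝒩 e j := by
    ext x
    constructor
    · rintro ⟨z, rfl⟩
      exact ⟨⟨θ z, (hθ z).mpr z.2⟩, hmem.le ⟨z, rfl⟩, rfl⟩
    · rintro ⟨⟨m, hm⟩, hmj, rfl⟩
      obtain ⟨z, rfl⟩ := hmem.ge hmj
      exact ⟨⟨z, (hθ z).mp hm⟩, rfl⟩
  exact ⟨(Submodule.quotEquivOfEq _ _ hker).trans
    (ψ.quotKerEquivRange.trans (LinearEquiv.ofEq _ _ hψ))⟩

/-- If the residue ring `L` of `R` is the base field, then the complex of graded components over `R`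
becomes the one over the base field after base change to `L`. -/
theorem nonempty_middleHomology_equiv_lTensor {R L : Type*} [CommRing R] [Algebra K R] [CommRing L]
    [Algebra K L] [Algebra R L] [IsScalarTower K R L]
    (hL : Function.Bijective (algebraMap K L)) {e : V K n} {c : Fin n → R} {u : K} (hu : u ≠ 0)
    (hc : ∀ k, algebraMap K L (u * e k) = algebraMap R L (c k)) (i j k : ℤ) :
    Nonempty (MiddleHomology (compMul (R := K) hN.isInternal e i j)
      (compMul hN.isInternal e j k) ≃ₗ[K]
        MiddleHomology ((compMul hN.isInternal c i j).lTensor L)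
          ((compMul hN.isInternal c j k).lTensor L)) := by
  let φ : K ≃ₗ[K] L := LinearEquiv.ofBijective (Algebra.linearMap K L) hL
  let ε : ∀ a : ℤ, K ⊗[K] G 𝒩 a ≃ₗ[K] L ⊗[R] (R ⊗[K] G 𝒩 a) := fun a =>
    (TensorProduct.congr φ (LinearEquiv.refl K (G 𝒩 a))).trans
      ((AlgebraTensorModule.cancelBaseChange K R L L (G 𝒩 a)).symm.restrictScalars K)
  have hε : ∀ (a b : ℤ) (z : K ⊗[K] G 𝒩 a), (compMul hN.isInternal c a b).lTensor L (ε a z) =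
      u • ε b (compMul hN.isInternal e a b z) := by
    intro a b z
    induction z with
    | zero =>
      rw [LinearEquiv.map_zero, LinearMap.map_zero, LinearMap.map_zero, LinearEquiv.map_zero,
        smul_zero]
    | add x y hx hy =>
      rw [LinearEquiv.map_add, LinearMap.map_add, LinearMap.map_add, LinearEquiv.map_add, smul_add,
        hx, hy]
    | tmul r x =>
      have h1 : ∀ (a : ℤ) (s : K) (x : G 𝒩 a),
          ε a (s ⊗ₜ x) = algebraMap K L s ⊗ₜ[R] ((1 : R) ⊗ₜ[K] x) := fun a s x => rfl
      simp only [h1, LinearMap.lTensor_tmul, compMul_tmul, map_sum, tmul_sum, Finset.smul_sum]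
      refine Finset.sum_congr rfl fun l _ => ?_
      have h2 : ∀ (s : L) (r : R) (y : G 𝒩 b), s ⊗ₜ[R] ((r * 1) ⊗ₜ[K] y) =
          (algebraMap R L r * s) ⊗ₜ[R] ((1 : R) ⊗ₜ[K] y) := fun s r y => by
        rw [← Algebra.smul_def, smul_tmul, smul_tmul', smul_eq_mul]
      rw [h2, ← hc, smul_tmul', Algebra.smul_def, ← map_mul, ← map_mul, mul_assoc]
  refine nonempty_middleHomology_equiv (ε j) (fun b => ?_) fun b => ?_
  · rw [hε, (IsUnit.mk0 u hu).smul_eq_zero, LinearEquiv.map_eq_zero_iff]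
  · constructor
    · rintro ⟨y, hy⟩
      obtain ⟨y, rfl⟩ := (ε i).surjective y
      rw [hε, ← LinearEquiv.map_smul] at hy
      exact ⟨u • y, by rw [LinearMap.map_smul]; exact (ε j).injective hy⟩
    · rintro ⟨y, rfl⟩
      refine ⟨ε i (u⁻¹ • y), ?_⟩
      rw [hε, LinearMap.map_smul, LinearEquiv.map_smul, smul_smul, mul_inv_cancel₀ hu, one_smul]

/-- The K-structure on the right is restriction of scalars along the structure map of R, as in
`torStalk`; on the middle homology it agrees with the action through L. -/
theorem nonempty_middleHomology_equiv_restrictScalars {R : Type u} {L : Type*} [CommRing R]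
    [Algebra K R] [CommRing L] [Algebra K L] [Algebra R L] [IsScalarTower K R L]
    (hL : Function.Bijective (algebraMap K L)) {e : V K n} {c : Fin n → R} {u : K} (hu : u ≠ 0)
    (hc : ∀ k, algebraMap K L (u * e k) = algebraMap R L (c k)) (i j k : ℤ) {T : ModuleCat.{u} R}
    (ε : T ≃ₗ[R] MiddleHomology ((compMul hN.isInternal c i j).lTensor L)
      ((compMul hN.isInternal c j k).lTensor L)) :
    Nonempty (MiddleHomology (compMul (R := K) hN.isInternal e i j)
      (compMul hN.isInternal e j k) ≃ₗ[K] (ModuleCat.restrictScalars (algebraMap K R)).obj T) := by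
  obtain ⟨β⟩ := nonempty_middleHomology_equiv_lTensor hN hL hu hc i j k
  let ε' : (ModuleCat.restrictScalars (algebraMap K R)).obj T ≃ₗ[K]
      MiddleHomology ((compMul hN.isInternal c i j).lTensor L)
        ((compMul hN.isInternal c j k).lTensor L) :=
    { ε.toAddEquiv with
      map_smul' := fun c x => (ε.map_smul (algebraMap K R c) x).trans (algebraMap_smul R c _) }
  exact ⟨β.trans ε'.symm⟩

end Comparison

/-! ### The comparison with Tor of the stalk -/

section TorStalk

variable {K : Type u} [Field K] {n : ℕ} {N : Type v} [AddCommGroup N] [Module K N]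
  [Module (E K n) N] [IsScalarTower K (E K n) N] [Module.Finite K N]
  {𝒩 : ℤ → Submodule K N} (hN : IsGradedModule (gradE K n) 𝒩)
  {F : Type u} [AddCommGroup F] [Module K F] [Module (S K n) F] [IsScalarTower K (S K n) F]
  {ℱ : ℤ → Submodule K F} (hF : IsGradedModule (gradS K n) ℱ)

include hN in
/-- The graded components of `H(e, N)` are the `Tor` modules of the stalk at the point `e`. -/
theorem nonempty_Hdeg_equiv_torStalk (hres : IsInjectiveResolution hF 𝒩) (e : V K n) (he : e ≠ 0)
    (i : ℕ) : Nonempty (Hdeg 𝒩 e (-(i : ℤ)) ≃ₗ[K] torStalk hF (point e he) i) := by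
  set p := point e he with hp
  obtain ⟨q, hq, hdq, hd⟩ := exists_resolution_stalk hN hF p hres
  have := subsingleton_term_zero hF hres (R := localRing p)
  obtain ⟨ε⟩ := nonempty_tor_equiv (D := term 𝒩 (localRing p))
    (d := diff hN.isInternal (coord p)) hq hdq hd (IsLocalRing.ResidueField (localRing p)) i
  obtain ⟨u, hu, hc⟩ := exists_residue_coord e he
  have hi : -(i : ℤ) = 1 - ((i + 1 : ℕ) : ℤ) := by push_cast; ring
  rw [hi]
  obtain ⟨α⟩ := nonempty_middleHomology_equiv_Hdeg hN e
    (i := 1 - ((i + 1 + 1 : ℕ) : ℤ)) (j := 1 - ((i + 1 : ℕ) : ℤ)) (k := 1 - (i : ℤ))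
    (by push_cast; ring) (by push_cast; ring)
  obtain ⟨β⟩ := nonempty_middleHomology_equiv_restrictScalars hN
    (bijective_algebraMap_residueField_point e he) hu hc
    (1 - ((i + 1 + 1 : ℕ) : ℤ)) (1 - ((i + 1 : ℕ) : ℤ)) (1 - (i : ℤ)) ε
  exact ⟨α.symm.trans β⟩

end TorStalk

/-! ### Total homology and projective dimension at the points of vectors -/

section Final

variable {K : Type u} [Field K] {n : ℕ} {N : Type v} [AddCommGroup N] [Module K N]
  [Module (E K n) N] [IsScalarTower K (E K n) N]
  {𝒩 : ℤ → Submodule K N} (hN : IsGradedModule (gradE K n) 𝒩)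
  {F : Type u} [AddCommGroup F] [Module K F] [Module (S K n) F] [IsScalarTower K (S K n) F]
  {ℱ : ℤ → Submodule K F} (hF : IsGradedModule (gradS K n) ℱ)

theorem nontrivial_homology_iff {L M : Type*} [Field L] [AddCommGroup M] [Module L M]
    {f : M →ₗ[L] M} (hf : ∀ m, f (f m) = 0) :
    Nontrivial (Homology f) ↔ LinearMap.ker f ≠ LinearMap.range f := by
  rw [Submodule.Quotient.nontrivial_iff, Ne, Submodule.submoduleOf_eq_top, not_iff_not]
  refine ⟨fun h => le_antisymm h ?_, fun h => h.le⟩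
  rintro _ ⟨m, rfl⟩
  exact hf m

theorem mulBy_mulBy (e : V K n) (m : N) : mulBy N e (mulBy N e m) = 0 := by
  change ExteriorAlgebra.ι K e • ExteriorAlgebra.ι K e • m = 0
  rw [← mul_smul, ExteriorAlgebra.ι_sq_zero, zero_smul]

include hN in
/-- A nonzero module embedded in a coinduced module has a nonzero component of degree `0`. -/
theorem ne_bot_of_nontrivial [Nontrivial N] (hres : IsInjectiveResolution hF 𝒩) : 𝒩 0 ≠ ⊥ := by
  obtain ⟨-, ⟨η, hη, hdeg, hinj, -⟩, -⟩ := hres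
  obtain ⟨m, hm⟩ := exists_ne (0 : N)
  intro h0
  apply hm
  apply hinj
  rw [map_zero]
  refine LinearMap.ext fun b => ?_
  -- The value of η m at b is that of η (b m) at 1, which depends only on the degree 0 component of
  -- b m.
  have h1 := apply_one_gradedProj hN.isInternal hdeg (b • m)
  have h2 : (gradedProj hN.isInternal 0 (b • m) : N) = 0 := by
    rw [← Submodule.mem_bot K, ← h0]
    exact SetLike.coe_mem _
  rw [h2, hη, one_mul, map_zero] at h1
  exact h1.symm

variable [Module.Finite K N]

include hN in
theorem nontrivial_H_iff (hres : IsInjectiveResolution hF 𝒩) (e : V K n) :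
    Nontrivial (H N e) ↔ Hdeg 𝒩 e 0 ≠ ⊥ := by
  -- The zero vector gives no point of projective space. There the homology is N itself, whose
  -- degree 0 component is nonzero if N is.
  by_cases he : e = 0
  · constructor
    · intro h
      have hm : mulBy N e = 0 := by
        subst he
        simp [mulBy]
      have : Nontrivial N := by
        obtain ⟨x, hx⟩ := exists_ne (0 : H N e)
        obtain ⟨x, rfl⟩ := Submodule.Quotient.mk_surjective _ x
        refine ⟨x, 0, fun h0 => hx ?_⟩
        rw [show x = 0 from Subtype.ext h0, Submodule.Quotient.mk_zero]
      have h0 := ne_bot_of_nontrivial hN hF hres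
      rw [Ne, homologyPart_eq_bot_iff]
      intro h1
      apply h0
      rw [eq_bot_iff]
      intro m hm0
      obtain ⟨y, hy⟩ := h1 m hm0 (by rw [hm, LinearMap.zero_apply])
      rw [hm, LinearMap.zero_apply] at hy
      exact hy.symm
    · intro h
      by_contra hn
      rw [not_nontrivial_iff_subsingleton] at hn
      exact h (Subsingleton.elim _ _)
  · rw [nontrivial_homology_iff (mulBy_mulBy e), ← point_mem_sing_iff e he,
      mem_sing_iff hN hF hres, Ne, Ne, not_iff_not]
    simpa using (Hdeg_eq_bot_iff_HPointDeg hN e he 0).symm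

include hN in
theorem Hdeg_ne_bot_iff_le_projectiveDimension (hres : IsInjectiveResolution hF 𝒩) (e : V K n)
    (he : e ≠ 0) (i : ℤ) : Hdeg 𝒩 e (-i) ≠ ⊥ ↔ 0 ≤ i ∧ (i.toNat : WithBot ℕ∞) ≤
      projectiveDimension (ModuleCat.of (localRing (point e he)) (stalk hF (point e he))) := by
  by_cases hi : 0 ≤ i
  · lift i to ℕ using hi
    rw [Int.toNat_natCast, projectiveDimension_ge_iff, ← HPointDeg_eq_bot_iff_projDim hN,
      ← Hdeg_eq_bot_iff_HPointDeg hN]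
    · simp
    · exact hres
  · simp [hi, Hdeg_eq_bot_of_pos hF hres e (show 0 < -i by omega)]

end Final

end

end BGG

theorem theorem4p1 {K : Type u} [Field K] {n : ℕ}
    {N : Type v} [AddCommGroup N] [Module K N] [Module (BGG.E K n) N]
    [IsScalarTower K (BGG.E K n) N] [Module.Finite (BGG.E K n) N]
    (𝒩 : ℤ → Submodule K N) (hN : BGG.IsGradedModule (BGG.gradE K n) 𝒩)
    (hsoc : BGG.socle K n N ≤ 𝒩 0)
    {F : Type u} [AddCommGroup F] [Module K F] [Module (BGG.S K n) F]
    [IsScalarTower K (BGG.S K n) F]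
    (ℱ : ℤ → Submodule K F) (hF : BGG.IsGradedModule (BGG.gradS K n) ℱ)
    (hres : BGG.IsInjectiveResolution hF 𝒩) :
    -- part a)
    (∀ (e : BGG.V K n) (he : e ≠ 0) (i : ℕ),
      Nonempty (BGG.Hdeg 𝒩 e (-i) ≃ₗ[K] BGG.torStalk hF (BGG.point e he) i)) ∧
    -- part b)
    (∀ (e : BGG.V K n) (he : e ≠ 0) (i : ℤ),
      BGG.Hdeg 𝒩 e (-i) ≠ ⊥ ↔
        0 ≤ i ∧ (i.toNat : WithBot ℕ∞) ≤
          projectiveDimension (ModuleCat.of (BGG.localRing (BGG.point e he))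
            (BGG.stalk hF (BGG.point e he)))) ∧
    (∀ e : BGG.V K n, Nontrivial (BGG.H N e) ↔ BGG.Hdeg 𝒩 e 0 ≠ ⊥) ∧
    -- part c)
    (∀ Z : TopologicalSpace.IrreducibleCloseds (BGG.P K n),
      Maximal (fun Y : TopologicalSpace.IrreducibleCloseds (BGG.P K n) =>
        (Y : Set (BGG.P K n)) ⊆ BGG.sing K n N) Z →
      ∃ U : Set (BGG.P K n), IsOpen U ∧ ((Z : Set (BGG.P K n)) ∩ U).Nonempty ∧
        (∀ (e : BGG.V K n) (he : e ≠ 0), BGG.point e he ∈ (Z : Set (BGG.P K n)) ∩ U →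
          ∀ i : ℤ, BGG.Hdeg 𝒩 e (-i) ≠ ⊥ ↔ 0 ≤ i ∧ (i.toNat : ℕ∞) ≤ Order.coheight Z) ∧
        (∀ p ∈ (Z : Set (BGG.P K n)) ∩ U,
          ∀ i : ℤ, BGG.HPointDeg 𝒩 p (-i) ≠ ⊥ ↔ 0 ≤ i ∧ (i.toNat : ℕ∞) ≤ Order.coheight Z)) := by
  have : Module.Finite K N := Module.Finite.trans (BGG.E K n) N
  refine ⟨fun e he i => BGG.nonempty_Hdeg_equiv_torStalk hN hF hres e he i,
    fun e he i => BGG.Hdeg_ne_bot_iff_le_projectiveDimension hN hF hres e he i,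
    fun e => BGG.nontrivial_H_iff hN hF hres e, fun Z hZ => ?_⟩
  obtain ⟨U, hU, hne, h⟩ := BGG.exists_isOpen_HPointDeg hN hF hres hZ
  refine ⟨U, hU, hne, fun e he hp i => ?_, fun p hp i => ?_⟩
  · by_cases hi : 0 ≤ i
    · lift i to ℕ using hi
      rw [Int.toNat_natCast, ← h _ hp i, Ne, Ne, BGG.Hdeg_eq_bot_iff_HPointDeg hN e he i]
      simp
    · simp [hi, BGG.Hdeg_eq_bot_of_pos hF hres e (show 0 < -i by omega)]
  · by_cases hi : 0 ≤ i
    · lift i to ℕ using hi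
      rw [Int.toNat_natCast, ← h p hp i]
      simp
    · simp [hi, BGG.HPointDeg_eq_bot_of_pos hF hres p (show 0 < -i by omega)]
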